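/- **Conventions.** For a Hilbert space $\mathcal H$ (of any dimension), a density operator is a positive operator of trace one, $S(\rho)=\mathrm{Tr}(-\rho\log\rho)\in[0,\infty]$ is the von Neumann entropy and $H(\{p_r\})=-\sum_r p_r\log p_r\in[0,\infty]$ the Shannon entropy. **(A) Twirl and superselection sectors.** Let $\Gamma$ be a compact Hausdorff group (e.g. a finite group or a compact Lie group) and $U$ a strongly continuous unitary representation of $\Gamma$ on a Hilbert space $\mathcal H$. Let $\mathfrak G(a)=\int_\Gamma U(g)\,a\,U(g)^\dagger\,dg$ (normalized Haar measure, strong integral) be the twirl of $a\in\mathcal B(\mathcal H)$. Let $[r]$ run over the classes of irreducible unitary representations of $\Gamma$, with representation spaces $\mathcal H_r$ and dimensions $d_r$. Then there is a unitary identification $\mathcal H\cong\bigoplus_{[r]}\mathcal H_r\otimes\mathcal H_{rm}$ with $U(g)=\bigoplus_{[r]}U_r(g)\otimes\mathbb 1$ (the multiplicity spaces $\mathcal H_{rm}$ may be zero), and for every such identification: 1. for all $a\in\mathcal B(\mathcal H)$, $\ \mathfrak G(a)=\bigoplus_{[r]}\tfrac1{d_r}\mathbb 1_r\otimes\mathrm{Tr}_{\mathcal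 H_r}(a|_r)$, where $a|_r$ is the $r$-th diagonal block of $a$; $\mathfrak G(\mathcal B(\mathcal H))$ is the algebra of all bounded operators of the form $\bigoplus_{[r]}\mathbb 1_r\otimes b_r$, and its center consists of the bounded operators that are a scalar $\lambda_r$ on every sector $\mathcal H_r\otimes\mathcal H_{rm}$; 2. if $\rho$ is a density operator on $\mathcal H$, $\rho_{rm}=\mathrm{Tr}_{\mathcal H_r}(\rho|_r)$, $p_r=\mathrm{Tr}\,\rho_{rm}$ and $\hat\rho_r=\rho_{rm}/p_r$ (with $\hat\rho_r=0$ if $p_r=0$), then $\mathfrak G(\rho)$ is a density operator, $\sum_rp_r=1$, $\hat\rho_r$ is a density operator whenever $p_r\ne0$, $\ \mathfrak G(\rho)=\bigoplus_{[r]}p_r\big(\tfrac1{d_r}\mathbb 1_r\otimes\hat\rho_r\big)$, and in $[0,\infty]$ $$S(\mathfrak G(\rho))=H(\{p_r\})+\sum_{[r]}p_r\big(\log d_r+S(\hat\rho_r)\big).$$ **(B) The electric center.** Let $G$ be a compact Hausdorff second countable group (e.g. a compact Lie group or a finite group). Consider lattice gauge theory with structure group $G$ on a finite oriented lattice with vertex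 set $V$, edge set $E$ and a global boundary $\mathcal B\subset V$. The gauge transformation $h\in G^V$ acts on $\mathcal H_{\rm kin}=\bigotimes_{e\in E}L^2(G)$ by $|g_e\rangle\mapsto|h_{t(e)}\,g_e\,h_{s(e)}^{-1}\rangle$ on every edge $e$ from $s(e)$ to $t(e)$, and $\mathcal H_{\rm phys}\subset\mathcal H_{\rm kin}$ is the subspace invariant under all $h$ that are trivial on $\mathcal B$. Let $\Sigma$ be a region in the bulk, given by a set of edges, a set of interior vertices and a disjoint set of corner vertices $\partial\Sigma$ (both disjoint from $\mathcal B$), such that edges of $\Sigma$ have their ends in $\Sigma$ and the other edges do not meet the interior vertices; then $\mathcal H_{\rm kin}=L^2(G^\Sigma)\otimes L^2(G^{\bar\Sigma})$, with $\Sigma,\bar\Sigma$ standing for the sets of edges inside and outside the region. Let $\mathcal H_\Sigma^{\rm phys}\subset L^2(G^\Sigma)$ be the subspace of functions satisfying the Gauss law at the interior vertices of $\Sigma$; it carries the representation $U_\Sigma$ of the corner group $G^{\partial\Sigma}$ by gauge transformations at the corner. Let $\Phi$ be an extrinsic frame: for each $v\in\partial\Sigma$ a Wilson line through edges outside $\Sigma$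 from $\mathcal B$ to $v$, no edge being used twice by the same or by different lines. Its orientation $\mathbf h\in G^{\partial\Sigma}$ is the collection of its holonomies. For $f\in\mathcal B(\mathcal H_\Sigma^{\rm phys})$, the relational observable $\mathcal O_{f|\Phi}$ is the compression to $\mathcal H_{\rm phys}$ of $\int d\mathbf h\,|\mathbf h\rangle\langle\mathbf h|_\Phi\otimes U_\Sigma(\mathbf h)fU_\Sigma(\mathbf h)^\dagger$; these observables form the extrinsic relational algebra. The electric corner group $\mathbb G_{\partial\Sigma}\simeq G^{\partial\Sigma}$ acts on $\mathcal H_{\rm phys}$ by the reorientations $|\mathbf h\rangle_\Phi\mapsto|\mathbf h\mathbf k^{-1}\rangle_\Phi$, realized on the edge of each line that is incident on its anchor point in $\mathcal B$, and the electric center algebra $\mathcal A_E:=\mathbb G_{\partial\Sigma}(\{\mathcal O_{f|\Phi}\})$ is the twirl of the extrinsic algebra over it. Then: 1. $\mathbb G_{\partial\Sigma}(\mathcal O_{f|\Phi})=\mathcal O_{f'|\Phi}$, where $f'$ is the twirl of $f$ over $U_\Sigma$. Hence, for every decomposition $\mathcal H_\Sigma^{\rm phys}\cong\bigoplus_{\mathfrak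 e}\mathcal H_{\mathfrak e}\otimes\mathcal H_{\mathfrak em}$ over the irreducible representations $\mathfrak e$ of $G^{\partial\Sigma}$ as in (A), $\mathcal A_E=\{\mathcal O_{f|\Phi}: f=\bigoplus_{\mathfrak e}\mathbb 1_{\mathfrak e}\otimes b_{\mathfrak e}\ \text{bounded}\}$. 2. Every density operator $\rho$ on $\mathcal H_{\rm phys}$ has a relational state $\sigma$ (a density operator on $\mathcal H_\Sigma^{\rm phys}$ with $\mathrm{Tr}(\rho\,\mathcal O_{f|\Phi})=\mathrm{Tr}(\sigma f)$ for all $f$), a state $\delta$ on $\mathcal A_E$ (a density operator on $\mathcal H_\Sigma^{\rm phys}$ with $\mathcal O_{\delta|\Phi}\in\mathcal A_E$ and $\mathrm{Tr}(\rho\,\mathcal O_{f|\Phi})=\mathrm{Tr}(\delta f)$ whenever $\mathcal O_{f|\Phi}\in\mathcal A_E$), and a reduced state $\tau$ on the regional factor $L^2(G^\Sigma)$ of the extended Hilbert space $L^2(G^\Sigma)\otimes L^2(G^{\bar\Sigma})\supset\mathcal H_{\rm phys}$ (a density operator with $\mathrm{Tr}(\rho\,(a\otimes\mathbb 1))=\mathrm{Tr}(\tau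 a)$ for all $a\in\mathcal B(L^2(G^\Sigma))$, $a\otimes\mathbb 1$ being compressed to $\mathcal H_{\rm phys}$). 3. Any such states satisfy: $\delta$ is the twirl of $\sigma$ over $U_\Sigma$; $\tau$ is $\delta$ extended by zero; and, for every decomposition as in 1 and with $p_{\mathfrak e}$, $\hat\rho_{\mathfrak e}$ formed from $\delta$ as in (A), $\delta=\bigoplus_{\mathfrak e}p_{\mathfrak e}\big(\tfrac1{d_{\mathfrak e}}\mathbb 1_{\mathfrak e}\otimes\hat\rho_{\mathfrak e}\big)$ and $$S(\delta)=H(\{p_{\mathfrak e}\})+\sum_{\mathfrak e}p_{\mathfrak e}\big(\log d_{\mathfrak e}+S(\hat\rho_{\mathfrak e})\big)=S(\tau),$$ so that the entropy of $\mathcal A_E$ equals the extended-Hilbert-space entropy, including the $\log d_{\mathfrak e}$ term. -/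

import Mathlib

set_option linter.unusedSectionVars false

open MeasureTheory Topology
open scoped ENNReal InnerProductSpace

noncomputable section

namespace LGT

/-! ### Unitary representations of compact groups and the incoherent twirl -/

/-- The normalized Haar measure of a compact group. -/
def haarProb (G : Type*) [Group G] [TopologicalSpace G] [IsTopologicalGroup G] [CompactSpace G]
    [MeasurableSpace G] [BorelSpace G] : Measure G :=
  Measure.haarMeasure ⊤

/-- A strongly continuous unitary representation of `G` on `H`. -/
structure UnitaryRep (G : Type*) [Group G] [TopologicalSpace G]
    (H : Type*) [NormedAddCommGroup H] [InnerProductSpace ℂ H] where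
  toHom : G →* (H ≃ₗᵢ[ℂ] H)
  continuous_apply : ∀ x : H, Continuous fun g => toHom g x

section Haar

variable {G : Type*} [Group G] [TopologicalSpace G] [IsTopologicalGroup G] [CompactSpace G]
  [MeasurableSpace G] [BorelSpace G]

instance : IsProbabilityMeasure (haarProb G) :=
  ⟨by simpa [haarProb] using Measure.haarMeasure_self (G := G) (K₀ := ⊤)⟩

instance : (haarProb G).IsHaarMeasure := by unfold haarProb; infer_instance

instance : (haarProb G).Regular := by unfold haarProb; infer_instance

instance : (haarProb G).IsMulRightInvariant := by
  refine ⟨fun g => ?_⟩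
  have hm : Measurable fun x : G => x * g := (continuous_mul_const g).measurable
  have : IsProbabilityMeasure ((haarProb G).map (· * g)) :=
    Measure.isProbabilityMeasure_map hm.aemeasurable
  have : ((haarProb G).map (· * g)).Regular :=
    Measure.Regular.map (Homeomorph.mulRight g)
  have : ((haarProb G).map (· * g)).IsHaarMeasure := inferInstance
  exact Measure.isHaarMeasure_eq_of_isProbabilityMeasure _ _

end Haar

namespace UnitaryRep

variable {G : Type*} [Group G] [TopologicalSpace G]
  {H : Type*} [NormedAddCommGroup H] [InnerProductSpace ℂ H]

/-- The unitary operator `U(g)`. -/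
def op (U : UnitaryRep G H) (g : G) : H →L[ℂ] H :=
  ((U.toHom g).toContinuousLinearEquiv : H →L[ℂ] H)

@[simp] theorem op_apply (U : UnitaryRep G H) (g : G) (x : H) : U.op g x = U.toHom g x := rfl

/-- The action map `(g, x) ↦ U(g) x` is jointly continuous. -/
theorem continuous_uncurry (U : UnitaryRep G H) :
    Continuous fun p : G × H => U.toHom p.1 p.2 := by
  rw [continuous_iff_continuousAt]
  rintro ⟨g, x⟩
  rw [ContinuousAt, tendsto_iff_dist_tendsto_zero]
  have h1 : Filter.Tendsto (fun p : G × H => dist p.2 x + dist (U.toHom p.1 x) (U.toHom g x))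
      (𝓝 (g, x)) (𝓝 0) := by
    have hc : Continuous fun p : G × H => dist p.2 x + dist (U.toHom p.1 x) (U.toHom g x) :=
      (continuous_snd.dist continuous_const).add
        (((U.continuous_apply x).comp continuous_fst).dist continuous_const)
    simpa using hc.tendsto (g, x)
  refine squeeze_zero (fun _ => dist_nonneg) (fun p => ?_) h1
  calc dist (U.toHom p.1 p.2) (U.toHom g x)
      ≤ dist (U.toHom p.1 p.2) (U.toHom p.1 x) + dist (U.toHom p.1 x) (U.toHom g x) :=
        dist_triangle _ _ _
    _ = _ := by rw [(U.toHom p.1).isometry.dist_eq]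

/-- Pull-back of a representation along a continuous homomorphism. -/
def comap {N : Type*} [Group N] [TopologicalSpace N] (U : UnitaryRep G H) (φ : N →* G)
    (hφ : Continuous φ) : UnitaryRep N H where
  toHom := U.toHom.comp φ
  continuous_apply x := (U.continuous_apply x).comp hφ

/-- Restriction of a representation to an invariant subspace. -/
def restrict (U : UnitaryRep G H) (S : Submodule ℂ H) (hS : ∀ g, ∀ x ∈ S, U.toHom g x ∈ S) :
    UnitaryRep G S where
  toHom :=
    { toFun := fun g =>
        { toFun := fun x => ⟨U.toHom g x, hS g x x.2⟩
          invFun := fun x => ⟨U.toHom g⁻¹ x, hS g⁻¹ x x.2⟩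
          left_inv := fun x => Subtype.ext (by simp)
          right_inv := fun x => Subtype.ext (by simp)
          map_add' := fun x y => Subtype.ext (by simp)
          map_smul' := fun c x => Subtype.ext (by simp)
          norm_map' := fun x => (U.toHom g).norm_map x }
      map_one' := by ext x; simp
      map_mul' := fun g h => by ext x; simp }
  continuous_apply x := (U.continuous_apply (x : H)).subtype_mk _

section Twirl

variable [IsTopologicalGroup G] [CompactSpace G] [MeasurableSpace G] [BorelSpace G]

theorem integrable_conj (U : UnitaryRep G H) (a : H →L[ℂ] H) (x : H) :
    Integrable (fun g => U.toHom g (a (U.toHom g⁻¹ x))) (haarProb G) := by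
  have hc : Continuous fun g => U.toHom g (a (U.toHom g⁻¹ x)) :=
    U.continuous_uncurry.comp (continuous_id.prodMk
      (a.continuous.comp ((U.continuous_apply x).comp continuous_inv)))
  exact hc.integrable_of_hasCompactSupport (HasCompactSupport.of_compactSpace _)

/-- The incoherent `G`-twirl `𝔊(a) = ∫ U(g) a U(g)† dg`, as a strong operator integral over the
normalized Haar measure. -/
def twirl (U : UnitaryRep G H) (a : H →L[ℂ] H) : H →L[ℂ] H :=
  LinearMap.mkContinuous
    { toFun := fun x => ∫ g, U.toHom g (a (U.toHom g⁻¹ x)) ∂(haarProb G)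
      map_add' := fun x y => by
        rw [← integral_add (U.integrable_conj a x) (U.integrable_conj a y)]
        simp
      map_smul' := fun c x => by
        rw [RingHom.id_apply, ← integral_smul]
        simp }
    ‖a‖
    (fun x => by
      have h := norm_integral_le_of_norm_le_const (μ := haarProb G) (C := ‖a‖ * ‖x‖)
        (f := fun g => U.toHom g (a (U.toHom g⁻¹ x)))
        (Filter.Eventually.of_forall fun g => by
          rw [LinearIsometryEquiv.norm_map]
          refine (a.le_opNorm _).trans ?_
          rw [LinearIsometryEquiv.norm_map])
      simpa using h)

end Twirl

end UnitaryRep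

/-! ### Traces, density operators and entropies -/

section Trace

variable {H : Type*} [NormedAddCommGroup H] [InnerProductSpace ℂ H] [CompleteSpace H]

/-- A fixed Hilbert basis of `H`; the traces below do not depend on the choice. -/
def stdBasis (H : Type*) [NormedAddCommGroup H] [InnerProductSpace ℂ H] [CompleteSpace H] :
    HilbertBasis (exists_hilbertBasis ℂ H).choose ℂ H :=
  (exists_hilbertBasis ℂ H).choose_spec.choose

/-- The trace of a positive operator, with values in `[0, ∞]`. -/
def posTrace (T : H →L[ℂ] H) : ℝ≥0∞ :=
  ∑' i, ENNReal.ofReal (⟪stdBasis H i, T (stdBasis H i)⟫_ℂ).re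

/-- The trace of a trace-class operator. -/
def trace (T : H →L[ℂ] H) : ℂ :=
  ∑' i, ⟪stdBasis H i, T (stdBasis H i)⟫_ℂ

/-- Density operators: positive operators of trace one. -/
def IsDensityOperator (ρ : H →L[ℂ] H) : Prop :=
  ρ.IsPositive ∧ posTrace ρ = 1

/-- The von Neumann entropy `S(ρ) = Tr(-ρ log ρ)`, with values in `[0, ∞]`. -/
def vonNeumannEntropy (ρ : H →L[ℂ] H) : ℝ≥0∞ :=
  posTrace (cfc Real.negMulLog ρ)

end Trace

/-- The Shannon entropy `-∑ p_i log p_i`, with values in `[0, ∞]`. -/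
def shannonEntropy {ι : Type*} (p : ι → ℝ≥0∞) : ℝ≥0∞ :=
  ∑' i, ENNReal.ofReal (Real.negMulLog (p i).toReal)

/-! ### Irreducible representations and the isotypic decomposition -/

/-- An irreducible continuous unitary representation of `G` on some `ℂ^d`, `d ≥ 1`. -/
structure Irrep (G : Type*) [Group G] [TopologicalSpace G] where
  dim : ℕ
  dim_pos : 0 < dim
  rep : UnitaryRep G (EuclideanSpace ℂ (Fin dim))
  irreducible : ∀ W : Submodule ℂ (EuclideanSpace ℂ (Fin dim)),
    (∀ g, ∀ w ∈ W, rep.toHom g w ∈ W) → W = ⊥ ∨ W = ⊤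

section Dual

variable (G : Type*) [Group G] [TopologicalSpace G]

/-- Unitary equivalence of irreducible representations. -/
instance irrepSetoid : Setoid (Irrep G) where
  r π π' := ∃ T : EuclideanSpace ℂ (Fin π.dim) ≃ₗᵢ[ℂ] EuclideanSpace ℂ (Fin π'.dim),
    ∀ g x, T (π.rep.toHom g x) = π'.rep.toHom g (T x)
  iseqv :=
    { refl := fun _ => ⟨LinearIsometryEquiv.refl ℂ _, fun _ _ => rfl⟩
      symm := fun ⟨T, hT⟩ => ⟨T.symm, fun g x => by
        rw [LinearIsometryEquiv.symm_apply_eq, hT, LinearIsometryEquiv.apply_symm_apply]⟩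
      trans := fun ⟨T, hT⟩ ⟨T', hT'⟩ => ⟨T.trans T', fun g x => by
        simp [hT, hT']⟩ }

/-- The set of isomorphism classes `[r]` of irreducible unitary representations of `G`. -/
def Dual : Type _ := Quotient (irrepSetoid G)

variable {G}

/-- A chosen representative of the class `[r]`. -/
def Dual.irrep (r : Dual G) : Irrep G := Quotient.out r

/-- The dimension `d_r`. -/
def Dual.dim (r : Dual G) : ℕ := r.irrep.dim

/-- The matrix element `ρ_r(g)_{ji} = ⟨j, U_r(g) i⟩`. -/
def Dual.matrix (r : Dual G) (g : G) (j i : Fin r.dim) : ℂ :=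
  r.irrep.rep.toHom g (EuclideanSpace.single (i : Fin r.irrep.dim) (1 : ℂ)) (j : Fin r.irrep.dim)

end Dual

/-- A unitary identification `H ≅ ⨁_[r] H_r ⊗ K_r` under which `U(g) = ⨁_[r] U_r(g) ⊗ 1`. With
`|r, i⟩` the standard basis of `H_r`, the map `J r i : K_r → H` is `k ↦ |r, i⟩ ⊗ k`. -/
structure IsotypicDecomposition {G : Type*} [Group G] [TopologicalSpace G]
    {H : Type*} [NormedAddCommGroup H] [InnerProductSpace ℂ H] [CompleteSpace H]
    (U : UnitaryRep G H) (K : Dual G → Type*) [∀ r, NormedAddCommGroup (K r)]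
    [∀ r, InnerProductSpace ℂ (K r)] where
  J : ∀ r : Dual G, Fin r.dim → K r →ₗᵢ[ℂ] H
  isHilbertSum : IsHilbertSum ℂ (fun x : Σ r : Dual G, Fin r.dim => K x.1) fun x => J x.1 x.2
  equivariant : ∀ g r i (k : K r), U.toHom g (J r i k) = ∑ j, r.matrix g j i • J r j k

namespace IsotypicDecomposition

variable {G : Type*} [Group G] [TopologicalSpace G]
  {H : Type*} [NormedAddCommGroup H] [InnerProductSpace ℂ H] [CompleteSpace H]
  {U : UnitaryRep G H} {K : Dual G → Type*} [∀ r, NormedAddCommGroup (K r)]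
  [∀ r, InnerProductSpace ℂ (K r)] [∀ r, CompleteSpace (K r)]

/-- `J r i` as a bounded operator. -/
def inc (D : IsotypicDecomposition U K) (r : Dual G) (i : Fin r.dim) : K r →L[ℂ] H :=
  (D.J r i).toContinuousLinearMap

/-- The operator `Tr_{H_r}(a|_r)` on the multiplicity space `K_r`: the partial trace over `H_r` of
the diagonal block of `a`. -/
def mult (D : IsotypicDecomposition U K) (a : H →L[ℂ] H) (r : Dual G) : K r →L[ℂ] K r :=
  ∑ i, (D.inc r i).adjoint ∘L a ∘L D.inc r i

/-- `a = ⨁_[r] 1_r ⊗ b_r`. -/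
def IsBlockSum (D : IsotypicDecomposition U K) (a : H →L[ℂ] H) (b : ∀ r, K r →L[ℂ] K r) : Prop :=
  ∀ x, HasSum (fun r => ∑ j, D.inc r j (b r ((D.inc r j).adjoint x))) (a x)

/-- The sector probability `p_r`. -/
def prob (D : IsotypicDecomposition U K) (ρ : H →L[ℂ] H) (r : Dual G) : ℝ≥0∞ :=
  posTrace (D.mult ρ r)

/-- The normalized state `p_r⁻¹ Tr_{H_r}(ρ|_r)` on the multiplicity space of sector `r`
(the zero operator if `p_r = 0`). -/
def sectorState (D : IsotypicDecomposition U K) (ρ : H →L[ℂ] H) (r : Dual G) : K r →L[ℂ] K r :=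
  (((D.prob ρ r).toReal⁻¹ : ℝ) : ℂ) • D.mult ρ r

end IsotypicDecomposition

/-! ### Operators on square-integrable functions on a compact group -/

section Biregular

variable (P : Type*) [Group P] [TopologicalSpace P] [IsTopologicalGroup P] [CompactSpace P]
  [MeasurableSpace P] [BorelSpace P]
  (F : Type*) [NormedAddCommGroup F] [InnerProductSpace ℂ F]

/-- The map `g ↦ l⁻¹ g r`. -/
def lrMap {P : Type*} [Group P] (p : P × P) (g : P) : P := p.1⁻¹ * g * p.2

variable {P} in
theorem continuous_lrMap (p : P × P) : Continuous (lrMap p) := by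
  unfold lrMap; fun_prop

variable {P} in
theorem measurePreserving_lrMap (p : P × P) :
    MeasurePreserving (lrMap p) (haarProb P) (haarProb P) :=
  (measurePreserving_mul_right (haarProb P) p.2).comp
    (measurePreserving_mul_left (haarProb P) p.1⁻¹)

variable {P F} in
/-- `ψ ↦ ψ(l⁻¹ · r)`. -/
def lrLin (p : P × P) : Lp F 2 (haarProb P) →ₗᵢ[ℂ] Lp F 2 (haarProb P) :=
  Lp.compMeasurePreservingₗᵢ ℂ (lrMap p) (measurePreserving_lrMap p)

variable {P F} in
theorem lrLin_coeFn (p : P × P) (ψ : Lp F 2 (haarProb P)) :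
    lrLin p ψ =ᵐ[haarProb P] ψ ∘ lrMap p :=
  Lp.coeFn_compMeasurePreserving ψ (measurePreserving_lrMap p)

variable {P F} in
theorem lrLin_mul (p q : P × P) (ψ : Lp F 2 (haarProb P)) :
    lrLin (p * q) ψ = lrLin p (lrLin q ψ) := by
  refine Lp.ext ?_
  filter_upwards [lrLin_coeFn (p * q) ψ, lrLin_coeFn p (lrLin q ψ),
    (measurePreserving_lrMap p).quasiMeasurePreserving.ae (lrLin_coeFn q ψ)] with x h1 h2 h3
  rw [h1, h2, Function.comp_apply, Function.comp_apply, h3, Function.comp_apply]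
  congr 1
  simp [lrMap, mul_assoc]

variable {P F} in
theorem lrLin_one (ψ : Lp F 2 (haarProb P)) : lrLin 1 ψ = ψ := by
  refine Lp.ext ?_
  filter_upwards [lrLin_coeFn 1 ψ] with x h1
  rw [h1, Function.comp_apply]
  simp [lrMap]

/-- The two-sided regular representation of `P × P` on `L²(P; F)`,
`|g⟩ ↦ |l g r⁻¹⟩`, that is `ψ ↦ ψ(l⁻¹ · r)`. -/
def biregular : UnitaryRep (P × P) (Lp F 2 (haarProb P)) where
  toHom :=
    { toFun := fun p =>
        { (lrLin p).toLinearMap with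
          invFun := lrLin p⁻¹
          left_inv := fun ψ => by
            change lrLin p⁻¹ (lrLin p ψ) = ψ
            rw [← lrLin_mul, inv_mul_cancel, lrLin_one]
          right_inv := fun ψ => by
            change lrLin p (lrLin p⁻¹ ψ) = ψ
            rw [← lrLin_mul, mul_inv_cancel, lrLin_one]
          norm_map' := (lrLin p).norm_map }
      map_one' := by ext1 ψ; exact lrLin_one ψ
      map_mul' := fun p q => by ext1 ψ; exact lrLin_mul p q ψ }
  continuous_apply ψ := by
    have hg : Continuous fun p : P × P => (⟨lrMap p, continuous_lrMap p⟩ : C(P, P)) := by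
      refine ContinuousMap.continuous_of_continuous_uncurry _ ?_
      change Continuous fun q : (P × P) × P => q.1.1⁻¹ * q.2 * q.1.2
      fun_prop
    exact (continuous_const (y := ψ)).compMeasurePreservingLp hg measurePreserving_lrMap
      (by norm_num)

variable {P F}

theorem compLpL_lrLin (a : F →L[ℂ] F) (p : P × P) (ψ : Lp F 2 (haarProb P)) :
    a.compLpL 2 (haarProb P) (lrLin p ψ) = lrLin p (a.compLpL 2 (haarProb P) ψ) := by
  refine Lp.ext ?_
  filter_upwards [a.coeFn_compLpL (lrLin p ψ), lrLin_coeFn p ψ,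
    lrLin_coeFn p (a.compLpL 2 (haarProb P) ψ),
    (measurePreserving_lrMap p).quasiMeasurePreserving.ae (a.coeFn_compLpL ψ)] with x h1 h2 h3 h4
  rw [h1, h2, h3, Function.comp_apply, Function.comp_apply, h4]

theorem aestronglyMeasurable_fiberwise {N : Type*} [Group N] [TopologicalSpace N]
    [TopologicalSpace.PseudoMetrizableSpace N] [SecondCountableTopology N]
    (U : UnitaryRep N F) (k : C(P, N)) (ψ : Lp F 2 (haarProb P)) :
    AEStronglyMeasurable (fun y => U.toHom (k y) (ψ y)) (haarProb P) :=
  U.continuous_uncurry.comp_aestronglyMeasurable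
    (k.continuous.stronglyMeasurable.aestronglyMeasurable.prodMk (Lp.aestronglyMeasurable ψ))

theorem memLp_fiberwise {N : Type*} [Group N] [TopologicalSpace N]
    [TopologicalSpace.PseudoMetrizableSpace N] [SecondCountableTopology N]
    (U : UnitaryRep N F) (k : C(P, N)) (ψ : Lp F 2 (haarProb P)) :
    MemLp (fun y => U.toHom (k y) (ψ y)) 2 (haarProb P) :=
  (Lp.memLp ψ).congr_norm (aestronglyMeasurable_fiberwise U k ψ)
    (Filter.Eventually.of_forall fun y => by simp)

/-- Fibrewise application of a representation: `(Wψ)(y) = U(k(y)) ψ(y)`. -/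
def fiberwise {N : Type*} [Group N] [TopologicalSpace N]
    [TopologicalSpace.PseudoMetrizableSpace N] [SecondCountableTopology N]
    (U : UnitaryRep N F) (k : C(P, N)) :
    Lp F 2 (haarProb P) →ₗᵢ[ℂ] Lp F 2 (haarProb P) where
  toFun ψ := (memLp_fiberwise U k ψ).toLp _
  map_add' ψ χ := by
    refine Lp.ext ?_
    filter_upwards [(memLp_fiberwise U k (ψ + χ)).coeFn_toLp, (memLp_fiberwise U k ψ).coeFn_toLp,
      (memLp_fiberwise U k χ).coeFn_toLp, Lp.coeFn_add ψ χ,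
      Lp.coeFn_add ((memLp_fiberwise U k ψ).toLp _) ((memLp_fiberwise U k χ).toLp _)]
      with y h1 h2 h3 h4 h5
    rw [h1, h5, Pi.add_apply, h2, h3, h4, Pi.add_apply, map_add]
  map_smul' c ψ := by
    refine Lp.ext ?_
    filter_upwards [(memLp_fiberwise U k (c • ψ)).coeFn_toLp, (memLp_fiberwise U k ψ).coeFn_toLp,
      Lp.coeFn_smul c ψ, Lp.coeFn_smul c ((memLp_fiberwise U k ψ).toLp _)] with y h1 h2 h3 h4
    rw [h1, RingHom.id_apply, h4, Pi.smul_apply, h2, h3, Pi.smul_apply, map_smul]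
  norm_map' ψ := by
    change ‖(memLp_fiberwise U k ψ).toLp _‖ = ‖ψ‖
    rw [Lp.norm_toLp, Lp.norm_def]
    congr 1
    exact eLpNorm_congr_norm_ae (Filter.Eventually.of_forall fun y => by simp)

end Biregular

/-- The vectors fixed by a family of bounded operators. -/
def fixedSubspace {ι H : Type*} [NormedAddCommGroup H] [InnerProductSpace ℂ H]
    (T : ι → H →L[ℂ] H) : Submodule ℂ H where
  carrier := {x | ∀ i, T i x = x}
  zero_mem' := by simp
  add_mem' := fun hx hy i => by rw [map_add, hx i, hy i]
  smul_mem' := fun c x hx i => by rw [map_smul, hx i]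

instance {ι H : Type*} [NormedAddCommGroup H] [InnerProductSpace ℂ H] [CompleteSpace H]
    (T : ι → H →L[ℂ] H) : CompleteSpace (fixedSubspace T) := by
  have h : IsClosed (fixedSubspace T : Set H) := by
    have : (fixedSubspace T : Set H) = ⋂ i, {x | T i x = x} := by
      ext x; simp [fixedSubspace]
    rw [this]
    exact isClosed_iInter fun i => isClosed_eq (T i).continuous continuous_id
  exact h.completeSpace_coe

/-! ### Lattice gauge theory: lattice, region and gauge transformations -/

/-- An oriented spatial lattice with vertex set `V`, edge set `E` and global boundary `boundary`. -/
structure Lattice (V E : Type*) where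
  src : E → V
  tgt : E → V
  boundary : Set V

/-- A region `Σ` inside the bulk of the lattice. Its vertices are the interior vertices `inner` and
the vertices `corner` of the entangling surface `∂Σ`; `edges` are the edges of `Σ`, including those
of `∂Σ`. Edges of the complement meet the region at most in corner vertices. -/
structure Region {V E : Type*} (L : Lattice V E) where
  inner : Set V
  corner : Set V
  edges : Set E
  disjoint_inner_corner : Disjoint inner corner
  disjoint_inner_boundary : Disjoint inner L.boundary
  disjoint_corner_boundary : Disjoint corner L.boundary
  src_mem : ∀ e ∈ edges, L.src e ∈ inner ∪ corner
  tgt_mem : ∀ e ∈ edges, L.tgt e ∈ inner ∪ corner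
  src_notMem : ∀ e ∉ edges, L.src e ∉ inner
  tgt_notMem : ∀ e ∉ edges, L.tgt e ∉ inner

/-- A group-valued function on a set of vertices, extended by `1` to all vertices. -/
def extendOne {V : Type*} (G : Type*) [Group G] (A : Set V) : (A → G) →* (V → G) :=
  Function.ExtendByOne.hom G (Subtype.val : A → V)

theorem extendOne_of_notMem {V G : Type*} [Group G] {A : Set V} (h : A → G) {v : V} (hv : v ∉ A) :
    extendOne G A h v = 1 :=
  Function.extend_apply' h (1 : V → G) v (by rintro ⟨⟨a, ha⟩, rfl⟩; exact hv ha)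

theorem continuous_extendOne {V G : Type*} [Group G] [TopologicalSpace G] (A : Set V) :
    Continuous (extendOne G A) := by
  refine continuous_pi fun v => ?_
  by_cases hv : v ∈ A
  · have h : (fun h : A → G => extendOne G A h v) = fun h => h ⟨v, hv⟩ := by
      funext h
      exact Subtype.val_injective.extend_apply h 1 (⟨v, hv⟩ : A)
    rw [h]; exact continuous_apply _
  · have h : (fun h : A → G => extendOne G A h v) = fun _ => 1 := by
      funext h
      exact extendOne_of_notMem h hv
    rw [h]; exact continuous_const

/-- On a set `X` of edges, the gauge transformation `h` acts as `g_e ↦ h_{tgt e} g_e h_{src e}⁻¹`: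
it is given by left translation with `h ∘ tgt` and right translation with `(h ∘ src)⁻¹`. -/
def gaugeHom {V E : Type*} (L : Lattice V E) (G : Type*) [Group G] (X : Set E) :
    (V → G) →* (X → G) × (X → G) where
  toFun h := (fun e => h (L.tgt e), fun e => h (L.src e))
  map_one' := rfl
  map_mul' _ _ := rfl

theorem continuous_gaugeHom {V E : Type*} (L : Lattice V E) {G : Type*} [Group G]
    [TopologicalSpace G] (X : Set E) : Continuous (gaugeHom L G X) := by
  refine Continuous.prodMk ?_ ?_
  · exact continuous_pi fun e => continuous_apply _
  · exact continuous_pi fun e => continuous_apply _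

/-- `L²(G^X)` for a finite set `X` of edges. -/
abbrev LinkSpace (G : Type*) [Group G] [TopologicalSpace G] [IsTopologicalGroup G] [CompactSpace G]
    [SecondCountableTopology G] [MeasurableSpace G] [BorelSpace G]
    {E : Type*} [Finite E] (X : Set E) : Type _ :=
  Lp ℂ 2 (haarProb (X → G))

section Gauge

variable {V E : Type*} [Finite V] [Finite E] {L : Lattice V E} (R : Region L)
  (G : Type*) [Group G] [TopologicalSpace G] [IsTopologicalGroup G] [CompactSpace G]
  [T2Space G] [SecondCountableTopology G] [MeasurableSpace G] [BorelSpace G]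

namespace Region

/-- The gauge transformations of all vertices, acting on the links of `Σ`. -/
def gaugeRep : UnitaryRep (V → G) (LinkSpace G R.edges) :=
  (biregular (R.edges → G) ℂ).comap (gaugeHom L G R.edges) (continuous_gaugeHom L R.edges)

/-- The regional space `H_Σ^phys`: functions of the links of `Σ` satisfying the Gauss law at all
interior vertices of `Σ`, but not on the corner. -/
def physSpace : Submodule ℂ (LinkSpace G R.edges) :=
  fixedSubspace fun h : R.inner → G => (R.gaugeRep G).op (extendOne G R.inner h)

instance : CompleteSpace (R.physSpace G) := by unfold physSpace; infer_instance

variable {G} in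
theorem extendOne_commute (h : R.corner → G) (k : R.inner → G) :
    extendOne G R.inner k * extendOne G R.corner h =
      extendOne G R.corner h * extendOne G R.inner k := by
  funext v
  by_cases hv : v ∈ R.corner
  · have h1 : extendOne G R.inner k v = 1 :=
      extendOne_of_notMem k fun hv' => Set.disjoint_left.1 R.disjoint_inner_corner hv' hv
    simp [h1]
  · have h1 : extendOne G R.corner h v = 1 :=
      extendOne_of_notMem h hv
    simp [h1]

/-- The corner gauge transformations, acting on the links of `Σ`. -/
def cornerRepLinks : UnitaryRep (R.corner → G) (LinkSpace G R.edges) :=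
  (R.gaugeRep G).comap (extendOne G R.corner) (continuous_extendOne R.corner)

/-- The unitary representation `U_Σ` of the corner group `G^{V_∂Σ}` on `H_Σ^phys`. -/
def cornerRep : UnitaryRep (R.corner → G) (R.physSpace G) :=
  (R.cornerRepLinks G).restrict (R.physSpace G) fun h x hx k => by
    change (R.gaugeRep G).toHom (extendOne G R.inner k)
      ((R.gaugeRep G).toHom (extendOne G R.corner h) x) =
        (R.gaugeRep G).toHom (extendOne G R.corner h) x
    have hx' : (R.gaugeRep G).toHom (extendOne G R.inner k) x = x := hx k
    have hc := congrArg (fun q => (R.gaugeRep G).toHom q x) (R.extendOne_commute h k)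
    simp only [map_mul] at hc
    refine hc.trans ?_
    exact congrArg ((R.gaugeRep G).toHom (extendOne G R.corner h)) hx'

/-- An operator on `H_Σ^phys`, extended by zero to `L²(G^Σ)`. -/
def extendOp (f : R.physSpace G →L[ℂ] R.physSpace G) : LinkSpace G R.edges →L[ℂ] LinkSpace G R.edges :=
  (R.physSpace G).subtypeL ∘L f ∘L (R.physSpace G).orthogonalProjectionOnto

/-- The kinematical space `H_kin = ⨂_e L²(G) = L²(G^Σ) ⊗ L²(G^Σ̄)`, realized as the space
`L²(G^Σ̄; L²(G^Σ))` of `L²(G^Σ)`-valued functions of the links outside `Σ`. -/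
abbrev KinSpace : Type _ := Lp (LinkSpace G R.edges) 2 (haarProb ((R.edgesᶜ : Set E) → G))

/-- The operator `a ⊗ 1` on `H_kin`, for `a` acting on the links of `Σ`. -/
def ampliation (a : LinkSpace G R.edges →L[ℂ] LinkSpace G R.edges) :
    R.KinSpace G →L[ℂ] R.KinSpace G :=
  a.compLpL 2 (haarProb ((R.edgesᶜ : Set E) → G))

/-- The gauge transformation `U(h)` on `H_kin`, acting on all links. -/
def gaugeOp (h : V → G) : R.KinSpace G →L[ℂ] R.KinSpace G :=
  R.ampliation G ((R.gaugeRep G).op h) ∘L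
    (biregular ((R.edgesᶜ : Set E) → G) (LinkSpace G R.edges)).op (gaugeHom L G R.edgesᶜ h)

/-- The physical Hilbert space: the vectors invariant under the gauge transformations of all bulk
vertices (no Gauss law is imposed on the global boundary). -/
def globalPhysSpace : Submodule ℂ (R.KinSpace G) :=
  fixedSubspace fun h : (L.boundaryᶜ : Set V) → G => R.gaugeOp G (extendOne G L.boundaryᶜ h)

instance : CompleteSpace (R.globalPhysSpace G) := by unfold globalPhysSpace; infer_instance

/-- Compression `a ↦ Π_phys a Π_phys` of a kinematical operator to the physical Hilbert space. -/
def compress (a : R.KinSpace G →L[ℂ] R.KinSpace G) :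
    R.globalPhysSpace G →L[ℂ] R.globalPhysSpace G :=
  (R.globalPhysSpace G).orthogonalProjectionOnto ∘L a ∘L (R.globalPhysSpace G).subtypeL

variable {G}

/-- `τ` is the reduced density operator of the global physical state `ρ` on the links of `Σ`, when
the physical Hilbert space is embedded into the extended, factorized Hilbert space
`L²(G^Σ) ⊗ L²(G^Σ̄)`. -/
def IsExtendedReducedState (ρ : R.globalPhysSpace G →L[ℂ] R.globalPhysSpace G)
    (τ : LinkSpace G R.edges →L[ℂ] LinkSpace G R.edges) : Prop :=
  IsDensityOperator τ ∧ ∀ a, trace (ρ ∘L R.compress G (R.ampliation G a)) = trace (τ ∘L a)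

end Region

end Gauge

/-! ### Extrinsic frames, relational observables and the electric center algebra -/

/-- Starting vertex of an edge traversed forward (`true`) or backward (`false`). -/
def Lattice.stepSrc {V E : Type*} (L : Lattice V E) (s : E × Bool) : V :=
  if s.2 then L.src s.1 else L.tgt s.1

/-- Final vertex of an edge traversed forward (`true`) or backward (`false`). -/
def Lattice.stepTgt {V E : Type*} (L : Lattice V E) (s : E × Bool) : V :=
  if s.2 then L.tgt s.1 else L.src s.1

/-- The list of steps is a path from `a` to `b`. -/
def Lattice.IsPath {V E : Type*} (L : Lattice V E) : V → List (E × Bool) → V → Prop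
  | a, [], b => a = b
  | a, s :: l, b => L.stepSrc s = a ∧ L.IsPath (L.stepTgt s) l b

/-- The holonomy `g_n ⋯ g_2 g_1` along a list of steps, with `g_i⁻¹` in place of `g_i` for an edge
traversed backward. -/
def holonomy {X G : Type*} [Group G] : List (X × Bool) → (X → G) → G
  | [], _ => 1
  | s :: l, y => holonomy l y * (if s.2 then y s.1 else (y s.1)⁻¹)

theorem continuous_holonomy {X G : Type*} [Group G] [TopologicalSpace G] [IsTopologicalGroup G]
    (l : List (X × Bool)) : Continuous fun y : X → G => holonomy l y := by
  induction l with
  | nil => exact continuous_const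
  | cons s l ih =>
    refine ih.mul ?_
    cases s.2
    · exact (continuous_apply s.1).inv
    · exact continuous_apply s.1

/-- An extrinsic frame `Φ`: for every corner vertex `v` a Wilson line in the complement of `Σ` from
an anchor vertex on the global boundary to `v`; no edge is used twice, neither within a line nor by
two different lines. -/
structure ExtrinsicFrame {V E : Type*} {L : Lattice V E} (R : Region L) where
  anchor : R.corner → V
  anchor_mem : ∀ v, anchor v ∈ L.boundary
  line : R.corner → List ((R.edgesᶜ : Set E) × Bool)
  isPath : ∀ v, L.IsPath (anchor v) ((line v).map fun s => (s.1.1, s.2)) v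
  nodup : ∀ v, ((line v).map Prod.fst).Nodup
  disjoint : ∀ v w, v ≠ w → List.Disjoint ((line v).map Prod.fst) ((line w).map Prod.fst)

namespace ExtrinsicFrame

variable {V E : Type*} {L : Lattice V E} {R : Region L} (Φ : ExtrinsicFrame R)

open Classical in
/-- The value at `e` of `h_v` if `e` is the first edge of the line to `v`, traversed in direction
`d`, and `1` if there is no such `v`. -/
def firstEdgeHom (G : Type*) [Group G] (d : Bool) : (R.corner → G) →* ((R.edgesᶜ : Set E) → G) where
  toFun h e := if hv : ∃ v, (Φ.line v).head? = some (e, d) then h hv.choose else 1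
  map_one' := by funext e; simp
  map_mul' h k := by
    funext e
    rw [Pi.mul_apply]
    split_ifs <;> simp

theorem continuous_firstEdgeHom {G : Type*} [Group G] [TopologicalSpace G] (d : Bool) :
    Continuous (Φ.firstEdgeHom G d) := by
  refine continuous_pi fun e => ?_
  by_cases hv : ∃ v, (Φ.line v).head? = some (e, d)
  · simpa [firstEdgeHom, hv] using continuous_apply _
  · simpa [firstEdgeHom, hv] using continuous_const

/-- A corner group element `h` changes the orientation of the line to `v` from `g_v` to
`g_v h_v⁻¹`, by acting on its first edge at the anchor vertex. -/
def reorientHom (G : Type*) [Group G] :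
    (R.corner → G) →* ((R.edgesᶜ : Set E) → G) × ((R.edgesᶜ : Set E) → G) :=
  (Φ.firstEdgeHom G false).prod (Φ.firstEdgeHom G true)

variable [Finite V] [Finite E]
  (G : Type*) [Group G] [TopologicalSpace G] [IsTopologicalGroup G] [CompactSpace G]
  [T2Space G] [SecondCountableTopology G] [MeasurableSpace G] [BorelSpace G]

/-- The orientation of the frame: the holonomies of its Wilson lines. -/
def orientation : C((R.edgesᶜ : Set E) → G, R.corner → G) :=
  ⟨fun y v => holonomy (Φ.line v) y, continuous_pi fun v => continuous_holonomy (Φ.line v)⟩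

/-- The dressed kinematical observable
`O_{f|Φ} = ∫ dh |h⟩⟨h|_Φ ⊗ U_Σ(h) f U_Σ(h)†`, the gauge average over the corner of
`|1⟩⟨1|_Φ ⊗ f`: it acts as `U_Σ(h) f U_Σ(h)†` on the links of `Σ` where the frame has orientation
`h`. -/
def kinObservable (f : R.physSpace G →L[ℂ] R.physSpace G) : R.KinSpace G →L[ℂ] R.KinSpace G :=
  (fiberwise (R.cornerRepLinks G) (Φ.orientation G)).toContinuousLinearMap ∘L
    R.ampliation G (R.extendOp G f) ∘L
      (fiberwise (R.cornerRepLinks G) (Φ.orientation G)⁻¹).toContinuousLinearMap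

/-- The relational observable on the physical Hilbert space describing the regional observable `f`
relative to the frame `Φ`. -/
def relObservable (f : R.physSpace G →L[ℂ] R.physSpace G) :
    R.globalPhysSpace G →L[ℂ] R.globalPhysSpace G :=
  R.compress G (Φ.kinObservable G f)

variable {G} in
theorem firstEdgeHom_of_notMem (d : Bool) (k : R.corner → G) (e : (R.edgesᶜ : Set E))
    (he : L.stepSrc (e.1, d) ∉ L.boundary) : Φ.firstEdgeHom G d k e = 1 := by
  have hne : ¬ ∃ v, (Φ.line v).head? = some (e, d) := by
    rintro ⟨v, hv⟩
    have hp := Φ.isPath v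
    cases hl : Φ.line v with
    | nil => simp [hl] at hv
    | cons s l =>
      rw [hl, List.head?_cons, Option.some.injEq] at hv
      rw [hl, hv] at hp
      refine he ?_
      have h1 : L.stepSrc (e.1, d) = Φ.anchor v := hp.1
      rw [h1]
      exact Φ.anchor_mem v
  exact dif_neg hne

variable {G} in
theorem gaugeHom_reorientHom_commute (h : (L.boundaryᶜ : Set V) → G) (k : R.corner → G) :
    gaugeHom L G R.edgesᶜ (extendOne G L.boundaryᶜ h) * Φ.reorientHom G k =
      Φ.reorientHom G k * gaugeHom L G R.edgesᶜ (extendOne G L.boundaryᶜ h) := by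
  refine Prod.ext (funext fun e => ?_) (funext fun e => ?_)
  · change extendOne G L.boundaryᶜ h (L.tgt e) * Φ.firstEdgeHom G false k e =
      Φ.firstEdgeHom G false k e * extendOne G L.boundaryᶜ h (L.tgt e)
    by_cases he : L.tgt e ∈ L.boundary
    · rw [extendOne_of_notMem h (by simpa using he), one_mul, mul_one]
    · rw [Φ.firstEdgeHom_of_notMem false k e (by simpa [Lattice.stepSrc] using he), one_mul, mul_one]
  · change extendOne G L.boundaryᶜ h (L.src e) * Φ.firstEdgeHom G true k e =
      Φ.firstEdgeHom G true k e * extendOne G L.boundaryᶜ h (L.src e)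
    by_cases he : L.src e ∈ L.boundary
    · rw [extendOne_of_notMem h (by simpa using he), one_mul, mul_one]
    · rw [Φ.firstEdgeHom_of_notMem true k e (by simpa [Lattice.stepSrc] using he), one_mul, mul_one]

/-- The reorientations of the frame, acting on `H_kin`. -/
def kinReorientRep : UnitaryRep (R.corner → G) (R.KinSpace G) :=
  (biregular ((R.edgesᶜ : Set E) → G) (LinkSpace G R.edges)).comap (Φ.reorientHom G)
    ((Φ.continuous_firstEdgeHom false).prodMk (Φ.continuous_firstEdgeHom true))

/-- The electric corner symmetry group: the reorientations of the frame, acting on the physical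
Hilbert space. -/
def reorientRep : UnitaryRep (R.corner → G) (R.globalPhysSpace G) :=
  (Φ.kinReorientRep G).restrict (R.globalPhysSpace G) fun k ψ hψ h => by
    have hψ' := hψ h
    change R.ampliation G ((R.gaugeRep G).op (extendOne G L.boundaryᶜ h))
      (lrLin (gaugeHom L G R.edgesᶜ (extendOne G L.boundaryᶜ h)) (lrLin (Φ.reorientHom G k) ψ)) =
        lrLin (Φ.reorientHom G k) ψ
    change R.ampliation G ((R.gaugeRep G).op (extendOne G L.boundaryᶜ h))
      (lrLin (gaugeHom L G R.edgesᶜ (extendOne G L.boundaryᶜ h)) ψ) = ψ at hψ'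
    rw [← lrLin_mul, Φ.gaugeHom_reorientHom_commute h k, lrLin_mul, Region.ampliation,
      compLpL_lrLin]
    exact congrArg (lrLin (Φ.reorientHom G k)) hψ'

/-- The electric center algebra `A_E`: the twirl of the extrinsic relational algebra of `Σ` over
the electric corner symmetry group. -/
def electricCenterAlgebra : Set (R.globalPhysSpace G →L[ℂ] R.globalPhysSpace G) :=
  {a | ∃ f, a = (Φ.reorientRep G).twirl (Φ.relObservable G f)}

variable {G}

/-- `σ` is the state of the global physical state `ρ` on the extrinsic relational algebra of `Σ`:
the density operator on `H_Σ^phys` giving the same expectation values. -/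
def IsRelationalState (ρ : R.globalPhysSpace G →L[ℂ] R.globalPhysSpace G)
    (σ : R.physSpace G →L[ℂ] R.physSpace G) : Prop :=
  IsDensityOperator σ ∧ ∀ f, trace (ρ ∘L Φ.relObservable G f) = trace (σ ∘L f)

/-- `δ` is the state of the global physical state `ρ` on the electric center algebra: a density
operator that belongs to `A_E` and gives the same expectation values on `A_E`. -/
def IsElectricCenterState (ρ : R.globalPhysSpace G →L[ℂ] R.globalPhysSpace G)
    (δ : R.physSpace G →L[ℂ] R.physSpace G) : Prop :=
  IsDensityOperator δ ∧ Φ.relObservable G δ ∈ Φ.electricCenterAlgebra G ∧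
    ∀ f, Φ.relObservable G f ∈ Φ.electricCenterAlgebra G →
      trace (ρ ∘L Φ.relObservable G f) = trace (δ ∘L f)

end ExtrinsicFrame

end LGT
end

noncomputable section

namespace LGT

/-! ### Traces of operators on Hilbert spaces -/

section TraceTheory

variable {H : Type*} [NormedAddCommGroup H] [InnerProductSpace ℂ H] [CompleteSpace H]
  {H' : Type*} [NormedAddCommGroup H'] [InnerProductSpace ℂ H'] [CompleteSpace H']
  {ι ι' : Type*}

/-! Part (A) is Schur's lemma together with complete reducibility. The twirl of a non-zero rank-one
projector is a non-zero compact self-adjoint operator commuting with the representation, so one of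
its eigenspaces is finite-dimensional and invariant and contains an irreducible subspace
(`UnitaryRep.exists_intertwiner`). Applied to the orthogonal complement of everything already found,
this gives the decomposition (`isHilbertSum_multEmbedding`). By Schur, an operator commuting with
`U` is `⨁ 1_r ⊗ b_r` with `b_r` equal to its partial trace over `d_r` (`apply_inc_of_commute`). The
twirl commutes with `U` by Haar invariance and leaves partial traces unchanged (`mult_twirl`), which
fixes its form. For the entropy, the functional calculus acts block by block
(`cfc_comp_intertwine`), and with `η(x) = -x log x` the sector `r` contributes `d_r` copies of `η`
applied to `(p_r/d_r) ρ̂_r`; the product rule for `η` splits this into the Shannon term, `log d_r`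
and `S(ρ̂_r)`.

Part (B) rests on the unitary `W` that applies `U_Σ(h)` to the links of `Σ` wherever the frame has
orientation `h` (`fiberwise`). The dressed observable is `W (f ⊗ 1) W†`. A reorientation `R(k)`
multiplies the orientation by `k` from the right, so `R(k) W = W (U_Σ(k) ⊗ 1) R(k)`, and twirling
over reorientations becomes twirling `f` over `U_Σ` (`twirl_kinObservable`). Dressed states `∫ dh
|h⟩ ⊗ U_Σ(h) φ` are physical and recover all matrix elements of `f`, so `f ↦ O_f` is injective
(`relObservable_injective`) and the states on `A_E` are exactly the twirl-invariant ones.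

The comparison with the extended Hilbert space is `compress_ampliation`. On physical states the
Gauss law at the corner trades the corner action on `Σ` for an action on the outside links, so `a ⊗
1` compresses to the same operator as its corner twirl; a twirled operator commutes with `U_Σ`, so
`W` drops out and the result is a relational observable. Hence the reduced state is the center state
extended by zero, and extension by zero preserves entropy.

Traces are handled without trace-class theory: a density operator is written as a square-summable
ensemble (`IsEnsemble`), and absolutely convergent double sums are exchanged. -/

theorem hasSum_norm_inner_sq (e : HilbertBasis ι ℂ H) (x : H) :
    HasSum (fun i => ‖⟪e i, x⟫_ℂ‖ ^ 2) (‖x‖ ^ 2) := by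
  have h := (e.hasSum_inner_mul_inner x x).mapL Complex.reCLM
  convert h using 1
  · funext i
    have : ⟪x, e i⟫_ℂ * ⟪e i, x⟫_ℂ = ((‖⟪e i, x⟫_ℂ‖ ^ 2 : ℝ) : ℂ) := by
      rw [← inner_conj_symm, RCLike.conj_mul]; norm_cast
    rw [this]; exact (Complex.ofReal_re _).symm
  · rw [inner_self_eq_norm_sq_to_K]; simp [← Complex.ofReal_pow]

theorem tsum_norm_inner_sq (e : HilbertBasis ι ℂ H) (x : H) :
    ∑' i, ENNReal.ofReal (‖⟪e i, x⟫_ℂ‖ ^ 2) = ENNReal.ofReal (‖x‖ ^ 2) := by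
  rw [← (hasSum_norm_inner_sq e x).tsum_eq,
    ENNReal.ofReal_tsum_of_nonneg (fun _ => by positivity) (hasSum_norm_inner_sq e x).summable]

/-- Both sides are the double sum of `|⟨f_j, A e_i⟩|²` in `[0, ∞]`, so no finiteness is needed.
Basis independence of the trace and `Tr A†A = Tr AA†` both come from here. -/
theorem tsum_norm_sq_adjoint (e : HilbertBasis ι ℂ H) (f : HilbertBasis ι' ℂ H')
    (A : H →L[ℂ] H') :
    ∑' i, ENNReal.ofReal (‖A (e i)‖ ^ 2) = ∑' j, ENNReal.ofReal (‖A.adjoint (f j)‖ ^ 2) := by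
  simp_rw [← tsum_norm_inner_sq f, ← tsum_norm_inner_sq e]
  rw [ENNReal.tsum_comm]
  refine tsum_congr fun j => tsum_congr fun i => ?_
  rw [ContinuousLinearMap.adjoint_inner_right, ← inner_conj_symm, RCLike.norm_conj]

theorem exists_sqrt {T : H →L[ℂ] H} (hT : T.IsPositive) :
    ∃ s : H →L[ℂ] H, s.adjoint = s ∧ ∀ x, s (s x) = T x := by
  have h0 : 0 ≤ T := (ContinuousLinearMap.nonneg_iff_isPositive T).2 hT
  refine ⟨CFC.sqrt T, ?_, fun x => ?_⟩
  · exact ((ContinuousLinearMap.nonneg_iff_isPositive _).1 (CFC.sqrt_nonneg T)).isSelfAdjoint.adjoint_eq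
  · exact congrArg (fun q : H →L[ℂ] H => q x) (CFC.sqrt_mul_sqrt_self T h0)

theorem inner_adjoint_comp_self (A : H →L[ℂ] H') (x : H) :
    (⟪x, A.adjoint (A x)⟫_ℂ).re = ‖A x‖ ^ 2 := by
  rw [ContinuousLinearMap.adjoint_inner_right, inner_self_eq_norm_sq_to_K]
  simp [← Complex.ofReal_pow]

theorem inner_sqrt {T s : H →L[ℂ] H} (hs : s.adjoint = s) (hsT : ∀ x, s (s x) = T x) (x : H) :
    (⟪x, T x⟫_ℂ).re = ‖s x‖ ^ 2 := by
  rw [← inner_adjoint_comp_self, hs, hsT]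

/-- The trace of a positive operator can be computed in any Hilbert basis. -/
theorem posTrace_eq_tsum (e : HilbertBasis ι ℂ H) {T : H →L[ℂ] H} (hT : T.IsPositive) :
    posTrace T = ∑' i, ENNReal.ofReal (⟪e i, T (e i)⟫_ℂ).re := by
  -- The trace is the squared Hilbert–Schmidt norm of the square root, which does not depend on the
  -- basis.
  obtain ⟨s, hs, hsT⟩ := exists_sqrt hT
  unfold posTrace
  simp_rw [inner_sqrt hs hsT]
  rw [tsum_norm_sq_adjoint (stdBasis H) e, hs]

theorem posTrace_adjoint_comp (A : H →L[ℂ] H') :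
    posTrace (A.adjoint ∘L A) = posTrace (A ∘L A.adjoint) := by
  unfold posTrace
  have h1 (x : H) : (⟪x, (A.adjoint ∘L A) x⟫_ℂ).re = ‖A x‖ ^ 2 := inner_adjoint_comp_self A x
  have h2 (x : H') : (⟪x, (A ∘L A.adjoint) x⟫_ℂ).re = ‖A.adjoint x‖ ^ 2 := by
    have := inner_adjoint_comp_self A.adjoint x
    rwa [ContinuousLinearMap.adjoint_adjoint] at this
  simp_rw [h1, h2]
  exact tsum_norm_sq_adjoint _ _ A

/-- With `s = √T`, Parseval expands `‖s x‖²` into the terms `|⟨s e_i, x⟩|²` and Cauchy–Schwarz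
bounds each by `‖s e_i‖² ‖x‖²`. -/
theorem re_inner_le_posTrace {T : H →L[ℂ] H} (hT : T.IsPositive) (x : H) :
    ENNReal.ofReal (⟪x, T x⟫_ℂ).re ≤ posTrace T * ENNReal.ofReal (‖x‖ ^ 2) := by
  obtain ⟨s, hs, hsT⟩ := exists_sqrt hT
  rw [inner_sqrt hs hsT]
  unfold posTrace
  simp_rw [inner_sqrt hs hsT]
  rw [← tsum_norm_inner_sq (stdBasis H) (s x), ← ENNReal.tsum_mul_right]
  refine ENNReal.tsum_le_tsum fun i => ?_
  rw [← ENNReal.ofReal_mul (by positivity), ← mul_pow]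
  refine ENNReal.ofReal_le_ofReal (pow_le_pow_left₀ (norm_nonneg _) ?_ 2)
  rw [← ContinuousLinearMap.adjoint_inner_left, hs]
  exact norm_inner_le_norm _ _

theorem eq_zero_of_posTrace_eq_zero {T : H →L[ℂ] H} (hT : T.IsPositive) (h : posTrace T = 0) :
    T = 0 := by
  obtain ⟨s, hs, hsT⟩ := exists_sqrt hT
  have hs0 (x : H) : s x = 0 := by
    have h1 := re_inner_le_posTrace hT x
    rw [h, zero_mul, nonpos_iff_eq_zero, ENNReal.ofReal_eq_zero, inner_sqrt hs hsT] at h1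
    exact norm_eq_zero.1 (pow_eq_zero_iff two_ne_zero |>.1 (le_antisymm h1 (by positivity)))
  ext x
  rw [← hsT, hs0]; simp

theorem posTrace_add {S T : H →L[ℂ] H} (hS : S.IsPositive) (hT : T.IsPositive) :
    posTrace (S + T) = posTrace S + posTrace T := by
  unfold posTrace
  rw [← ENNReal.tsum_add]
  refine tsum_congr fun i => ?_
  rw [add_apply, inner_add_right, Complex.add_re, ENNReal.ofReal_add]
  · exact (RCLike.nonneg_iff.1 (hS.inner_nonneg_right _)).1
  · exact (RCLike.nonneg_iff.1 (hT.inner_nonneg_right _)).1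

theorem posTrace_smul {c : ℝ} (hc : 0 ≤ c) (T : H →L[ℂ] H) :
    posTrace ((c : ℂ) • T) = ENNReal.ofReal c * posTrace T := by
  unfold posTrace
  rw [← ENNReal.tsum_mul_left]
  refine tsum_congr fun i => ?_
  rw [smul_apply, inner_smul_right, Complex.re_ofReal_mul,
    ENNReal.ofReal_mul hc]

theorem posTrace_zero : posTrace (0 : H →L[ℂ] H) = 0 := by simp [posTrace]

/-- The trace bounds the quadratic form, so `0 ≤ ρ ≤ 1`. Since `negMulLog` is nonnegative on `[0,
1]`, the operator `-ρ log ρ` is positive, and the truncation by `ENNReal.ofReal` inside `posTrace`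
loses nothing. -/
theorem IsDensityOperator.spectrum_subset {ρ : H →L[ℂ] H} (hρ : IsDensityOperator ρ) :
    spectrum ℝ ρ ⊆ Set.Icc 0 1 := by
  have h0 : 0 ≤ ρ := (ContinuousLinearMap.nonneg_iff_isPositive ρ).2 hρ.1
  have h1 : ρ ≤ 1 := by
    rw [ContinuousLinearMap.le_def]
    refine (ContinuousLinearMap.isPositive_iff _).2 ⟨?_, fun x => ?_⟩
    · exact (IsSelfAdjoint.sub (.one _) hρ.1.isSelfAdjoint).isSymmetric
    · have h2 := re_inner_le_posTrace hρ.1 x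
      rw [hρ.2, one_mul, ENNReal.ofReal_le_ofReal_iff (by positivity)] at h2
      have h3 : ⟪(1 - ρ) x, x⟫_ℂ = ((‖x‖ ^ 2 - (⟪x, ρ x⟫_ℂ).re : ℝ) : ℂ) := by
        rw [sub_apply, inner_sub_left, one_apply_eq_self,
          inner_self_eq_norm_sq_to_K]
        have h4 := hρ.1.inner_nonneg_left x
        have h5 : ⟪ρ x, x⟫_ℂ = ⟪x, ρ x⟫_ℂ := hρ.1.isSelfAdjoint.isSymmetric x x
        rw [Complex.nonneg_iff] at h4
        rw [← h5]
        apply Complex.ext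
        · simp [← Complex.ofReal_pow]
        · simp [← Complex.ofReal_pow, ← h4.2]
      rw [h3]
      exact_mod_cast sub_nonneg.2 h2
  intro t ht
  refine ⟨spectrum_nonneg_of_nonneg h0 ht, ?_⟩
  have h2 := (CStarAlgebra.norm_le_one_iff_of_nonneg ρ h0).2 h1
  have h3 := spectrum.norm_le_norm_mul_of_mem ht
  have h4 : ‖(1 : H →L[ℂ] H)‖ ≤ 1 := ContinuousLinearMap.norm_id_le
  calc t ≤ ‖t‖ := Real.le_norm_self t
    _ ≤ ‖ρ‖ * ‖(1 : H →L[ℂ] H)‖ := h3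
    _ ≤ 1 * 1 := mul_le_mul h2 h4 (norm_nonneg _) zero_le_one
    _ = 1 := one_mul 1

/-- `σ = ∑ |v_n⟩⟨v_n|`, weakly, for a square-summable family `v`. -/
structure IsEnsemble (v : ι → H) (σ : H →L[ℂ] H) : Prop where
  summable : Summable fun n => ‖v n‖ ^ 2
  hasSum_inner : ∀ x y, HasSum (fun n => ⟪x, v n⟫_ℂ * ⟪v n, y⟫_ℂ) ⟪x, σ y⟫_ℂ

theorem summable_norm_inner_sq_prod {v : ι → H} (hv : Summable fun n => ‖v n‖ ^ 2)
    (e : HilbertBasis ι' ℂ H) :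
    Summable fun p : ι × ι' => ‖⟪e p.2, v p.1⟫_ℂ‖ ^ 2 := by
  rw [summable_prod_of_nonneg (fun _ => by positivity)]
  refine ⟨fun n => (hasSum_norm_inner_sq e (v n)).summable, ?_⟩
  simpa only [(hasSum_norm_inner_sq e (v _)).tsum_eq] using hv

theorem summable_norm_apply_sq {v : ι → H} (hv : Summable fun n => ‖v n‖ ^ 2)
    (f : H →L[ℂ] H') : Summable fun n => ‖f (v n)‖ ^ 2 := by
  refine Summable.of_nonneg_of_le (fun _ => by positivity) (fun n => ?_) (hv.mul_left (‖f‖ ^ 2))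
  rw [← mul_pow]
  exact pow_le_pow_left₀ (norm_nonneg _) (f.le_opNorm _) 2

/-! ### Ensembles and traces of products. -/

namespace IsEnsemble

variable {v : ι → H} {σ : H →L[ℂ] H}

/-- The family `⟨e_i, v_n⟩ ⟨f† v_n, e_i⟩` is absolutely summable over pairs, because both factors
are square-summable. Summing over `i` first gives one series, over `n` first the other. This makes
the trace of a product independent of the basis and computable from the ensemble. -/
theorem hasSum_diagonal (hv : IsEnsemble v σ) (e : HilbertBasis ι' ℂ H) (f : H →L[ℂ] H) :
    ∃ t, HasSum (fun n => ⟪v n, f (v n)⟫_ℂ) t ∧ HasSum (fun i => ⟪e i, σ (f (e i))⟫_ℂ) t := by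
  have hs : Summable fun p : ι × ι' => ⟪e p.2, v p.1⟫_ℂ * ⟪f.adjoint (v p.1), e p.2⟫_ℂ := by
    refine Summable.of_norm_bounded (((summable_norm_inner_sq_prod hv.summable e).add
      (summable_norm_inner_sq_prod (summable_norm_apply_sq hv.summable f.adjoint) e))) fun p => ?_
    rw [norm_mul, norm_inner_symm (f.adjoint _)]
    nlinarith [sq_nonneg (‖⟪e p.2, v p.1⟫_ℂ‖ - ‖⟪e p.2, f.adjoint (v p.1)⟫_ℂ‖),
      sq_nonneg ‖⟪e p.2, v p.1⟫_ℂ‖, sq_nonneg ‖⟪e p.2, f.adjoint (v p.1)⟫_ℂ‖]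
  refine ⟨_, hs.hasSum.prod_fiberwise fun n => ?_,
    ((Equiv.prodComm ι' ι).hasSum_iff.2 hs.hasSum).prod_fiberwise fun i => ?_⟩
  · rw [← ContinuousLinearMap.adjoint_inner_left]
    simpa only [mul_comm] using e.hasSum_inner_mul_inner (f.adjoint (v n)) (v n)
  · simpa [ContinuousLinearMap.adjoint_inner_left] using hv.hasSum_inner (e i) (f (e i))

theorem hasSum_trace (hv : IsEnsemble v σ) (f : H →L[ℂ] H) :
    HasSum (fun n => ⟪v n, f (v n)⟫_ℂ) (trace (σ ∘L f)) := by
  obtain ⟨t, h1, h2⟩ := hv.hasSum_diagonal (stdBasis H) f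
  rwa [show trace (σ ∘L f) = t from h2.tsum_eq]

theorem hasSum_trace_basis (hv : IsEnsemble v σ) (e : HilbertBasis ι' ℂ H) (f : H →L[ℂ] H) :
    HasSum (fun i => ⟪e i, σ (f (e i))⟫_ℂ) (trace (σ ∘L f)) := by
  obtain ⟨t, h1, h2⟩ := hv.hasSum_diagonal e f
  rwa [(hv.hasSum_trace f).unique h1]

theorem isPositive (hv : IsEnsemble v σ) : σ.IsPositive := by
  refine ⟨fun x y => ?_, fun x => ?_⟩
  · have h1 := (hv.hasSum_inner y x).star
    have h2 := hv.hasSum_inner x y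
    change ⟪σ x, y⟫_ℂ = ⟪x, σ y⟫_ℂ
    rw [← inner_conj_symm]
    refine h1.unique (h2.congr_fun ?_)
    intro n
    simp [mul_comm]
  · have h := (hv.hasSum_inner x x).mapL Complex.reCLM
    rw [ContinuousLinearMap.reApplyInnerSelf_apply, inner_re_symm]
    refine h.nonneg fun n => ?_
    rw [← inner_conj_symm (v n) x, RCLike.mul_conj]
    change 0 ≤ (((‖⟪x, v n⟫_ℂ‖ : ℝ) : ℂ) ^ 2).re
    rw [← Complex.ofReal_pow, Complex.ofReal_re]
    positivity

theorem posTrace_eq (hv : IsEnsemble v σ) : posTrace σ = ENNReal.ofReal (∑' n, ‖v n‖ ^ 2) := by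
  unfold posTrace
  have h (x : H) : ENNReal.ofReal (⟪x, σ x⟫_ℂ).re = ∑' n, ENNReal.ofReal (‖⟪x, v n⟫_ℂ‖ ^ 2) := by
    have h1 := (hv.hasSum_inner x x).mapL Complex.reCLM
    have h2 (n : ι) : Complex.reCLM (⟪x, v n⟫_ℂ * ⟪v n, x⟫_ℂ) = ‖⟪x, v n⟫_ℂ‖ ^ 2 := by
      have : ⟪x, v n⟫_ℂ * ⟪v n, x⟫_ℂ = ((‖⟪x, v n⟫_ℂ‖ ^ 2 : ℝ) : ℂ) := by
        rw [← inner_conj_symm (v n) x, RCLike.mul_conj]; norm_cast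
      rw [this]; exact Complex.ofReal_re _
    simp only [h2] at h1
    rw [← ENNReal.ofReal_tsum_of_nonneg (fun _ => by positivity) h1.summable, h1.tsum_eq]
    rfl
  simp_rw [h]
  rw [ENNReal.tsum_comm, ENNReal.ofReal_tsum_of_nonneg (fun _ => by positivity) hv.summable]
  exact tsum_congr fun n => tsum_norm_inner_sq _ _

theorem isDensityOperator (hv : IsEnsemble v σ) (h : ∑' n, ‖v n‖ ^ 2 = 1) :
    IsDensityOperator σ :=
  ⟨hv.isPositive, by rw [hv.posTrace_eq, h, ENNReal.ofReal_one]⟩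

theorem conj (hv : IsEnsemble v σ) (A : H →L[ℂ] H') :
    IsEnsemble (fun n => A (v n)) (A ∘L σ ∘L A.adjoint) where
  summable := summable_norm_apply_sq hv.summable A
  hasSum_inner x y := by
    simpa [ContinuousLinearMap.adjoint_inner_left, ContinuousLinearMap.adjoint_inner_right] using
      hv.hasSum_inner (A.adjoint x) (A.adjoint y)

end IsEnsemble

/-- The rank-one operators have norm `‖v_n‖²`, so their sum converges in operator norm. -/
theorem exists_isEnsemble {v : ι → H} (hv : Summable fun n => ‖v n‖ ^ 2) :
    ∃ σ : H →L[ℂ] H, IsEnsemble v σ := by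
  have hs : Summable fun n => InnerProductSpace.rankOne ℂ (v n) (v n) :=
    Summable.of_norm (by simpa [← sq] using hv)
  refine ⟨∑' n, InnerProductSpace.rankOne ℂ (v n) (v n), hv, fun x y => ?_⟩
  have h := (hs.hasSum.mapL (ContinuousLinearMap.apply ℂ H y)).mapL (innerSL ℂ x)
  simpa [inner_smul_right, mul_comm] using h

/-- The ensemble is `v_n = √ρ e_n`; its total weight is the trace. -/
theorem IsDensityOperator.exists_isEnsemble {ρ : H →L[ℂ] H} (hρ : IsDensityOperator ρ) :
    ∃ v : (exists_hilbertBasis ℂ H).choose → H, IsEnsemble v ρ ∧ ∑' n, ‖v n‖ ^ 2 = 1 := by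
  obtain ⟨s, hs, hsT⟩ := exists_sqrt hρ.1
  have h1 : ∑' n, ENNReal.ofReal (‖s (stdBasis H n)‖ ^ 2) = 1 := by
    rw [← hρ.2]
    unfold posTrace
    simp_rw [inner_sqrt hs hsT]
  have h2 : Summable fun n => ‖s (stdBasis H n)‖ ^ 2 := by
    have := ENNReal.summable_toReal (h1.trans_ne ENNReal.one_ne_top)
    simpa [ENNReal.toReal_ofReal] using this
  have h3 : IsEnsemble (fun n => s (stdBasis H n)) ρ := by
    refine ⟨h2, fun x y => ?_⟩
    have := (stdBasis H).hasSum_inner_mul_inner (s x) (s y)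
    have h4 (a b : H) : ⟪s a, b⟫_ℂ = ⟪a, s b⟫_ℂ := by
      conv_lhs => rw [← hs]
      exact ContinuousLinearMap.adjoint_inner_left s b a
    rw [← hsT, ← h4]
    simpa only [h4 x, ← h4 _ y] using this
  refine ⟨_, h3, ?_⟩
  have h4 := h3.posTrace_eq
  rw [hρ.2] at h4
  exact (ENNReal.ofReal_eq_one.1 h4.symm)

theorem IsDensityOperator.hasSum_trace_basis {ρ : H →L[ℂ] H} (hρ : IsDensityOperator ρ)
    (e : HilbertBasis ι ℂ H) (f : H →L[ℂ] H) :
    HasSum (fun i => ⟪e i, ρ (f (e i))⟫_ℂ) (trace (ρ ∘L f)) := by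
  obtain ⟨v, hv, -⟩ := hρ.exists_isEnsemble
  exact hv.hasSum_trace_basis e f

/-- A density operator is determined by its expectation values. -/
theorem IsDensityOperator.ext {ρ σ : H →L[ℂ] H} (hρ : IsDensityOperator ρ)
    (hσ : IsDensityOperator σ) (h : ∀ f, trace (ρ ∘L f) = trace (σ ∘L f)) : ρ = σ := by
  -- Rank-one observables read off the matrix elements.
  have key {τ : H →L[ℂ] H} (hτ : IsDensityOperator τ) (x y : H) :
      trace (τ ∘L InnerProductSpace.rankOne ℂ y x) = ⟪x, τ y⟫_ℂ := by
    obtain ⟨v, hv, -⟩ := hτ.exists_isEnsemble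
    refine (hv.hasSum_trace _).unique ((hv.hasSum_inner x y).congr_fun fun n => ?_)
    simp
  ext y
  refine ext_inner_left ℂ fun x => ?_
  rw [← key hρ, ← key hσ, h]

end TraceTheory

/-! ### Functional calculus and intertwiners -/

section Intertwine

variable {H : Type*} [NormedAddCommGroup H] [InnerProductSpace ℂ H] [CompleteSpace H]
  {H' : Type*} [NormedAddCommGroup H'] [InnerProductSpace ℂ H'] [CompleteSpace H']

theorem aeval_comp_intertwine {b : H →L[ℂ] H} {c : H' →L[ℂ] H'} {J : H' →L[ℂ] H}
    (h : b ∘L J = J ∘L c) (p : Polynomial ℝ) :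
    Polynomial.aeval b p ∘L J = J ∘L Polynomial.aeval c p := by
  have hn (n : ℕ) : (b ^ n) ∘L J = J ∘L (c ^ n) := by
    induction n with
    | zero => rfl
    | succ n ih =>
      rw [pow_succ, pow_succ, ContinuousLinearMap.mul_def, ContinuousLinearMap.mul_def,
        ContinuousLinearMap.comp_assoc, h, ← ContinuousLinearMap.comp_assoc, ih,
        ContinuousLinearMap.comp_assoc]
  induction p using Polynomial.induction_on' with
  | add p q hp hq =>
    rw [map_add, map_add, ContinuousLinearMap.add_comp, ContinuousLinearMap.comp_add, hp, hq]
  | monomial n r =>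
    rw [Polynomial.aeval_monomial, Polynomial.aeval_monomial, ← Algebra.smul_def,
      ← Algebra.smul_def, ContinuousLinearMap.smul_comp, hn]
    ext x
    simp

theorem norm_cfc_sub_aeval_le {b : H →L[ℂ] H} (hb : IsSelfAdjoint b) {f : ℝ → ℝ}
    (hf : Continuous f) {M ε : ℝ} (hM : ‖b‖ ≤ M) (hε : 0 < ε) (p : Polynomial ℝ)
    (hp : ∀ x ∈ Set.Icc (-M) M, |Polynomial.eval x p - f x| < ε) :
    ‖cfc f b - Polynomial.aeval b p‖ ≤ ε := by
  rw [← cfc_polynomial p b hb, ← cfc_sub f (fun x => Polynomial.eval x p) b hf.continuousOn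
    p.continuous.continuousOn]
  refine norm_cfc_le hε.le fun x hx => ?_
  have h1 : ‖x‖ ≤ M := calc
    ‖x‖ ≤ ‖b‖ * ‖(1 : H →L[ℂ] H)‖ := spectrum.norm_le_norm_mul_of_mem hx
    _ ≤ ‖b‖ * 1 := by gcongr; exact ContinuousLinearMap.norm_id_le
    _ ≤ M := by rwa [mul_one]
  rw [norm_sub_rev]
  exact (hp x (abs_le.1 h1)).le

/-- Polynomials in `b` and `c` are intertwined by `J`, and Weierstrass approximation on an interval
containing both spectra passes this on to continuous functions. It lets the entropy function act
separately on each block. -/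
theorem cfc_comp_intertwine {b : H →L[ℂ] H} {c : H' →L[ℂ] H'} (hb : IsSelfAdjoint b)
    (hc : IsSelfAdjoint c) {J : H' →L[ℂ] H} (h : b ∘L J = J ∘L c) {f : ℝ → ℝ}
    (hf : Continuous f) : cfc f b ∘L J = J ∘L cfc f c := by
  rw [← sub_eq_zero, ← norm_eq_zero]
  refine le_antisymm (le_of_forall_pos_le_add fun ε hε => ?_) (norm_nonneg _)
  -- Two approximation errors of size `‖J‖ η` must add up to at most `ε`; the `+ 1` allows `J = 0`.
  set η : ℝ := ε / (2 * (‖J‖ + 1))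
  have hη : 0 < η := by positivity
  obtain ⟨p, hp⟩ := exists_polynomial_near_of_continuousOn (-max ‖b‖ ‖c‖) (max ‖b‖ ‖c‖) f
    hf.continuousOn η hη
  have h1 := norm_cfc_sub_aeval_le hb hf (le_max_left ‖b‖ ‖c‖) hη p hp
  have h2 := norm_cfc_sub_aeval_le hc hf (le_max_right ‖b‖ ‖c‖) hη p hp
  have h3 : cfc f b ∘L J - J ∘L cfc f c =
      (cfc f b - Polynomial.aeval b p) ∘L J - J ∘L (cfc f c - Polynomial.aeval c p) := by
    rw [ContinuousLinearMap.sub_comp, ContinuousLinearMap.comp_sub, aeval_comp_intertwine h]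
    abel
  rw [h3, zero_add]
  calc _ ≤ ‖(cfc f b - Polynomial.aeval b p) ∘L J‖ + ‖J ∘L (cfc f c - Polynomial.aeval c p)‖ :=
        norm_sub_le _ _
    _ ≤ η * ‖J‖ + ‖J‖ * η := by
        gcongr
        · exact (ContinuousLinearMap.opNorm_comp_le _ _).trans (by gcongr)
        · exact (ContinuousLinearMap.opNorm_comp_le _ _).trans (by gcongr)
    _ = 2 * ‖J‖ * η := by ring
    _ ≤ 2 * (‖J‖ + 1) * η := by gcongr; linarith
    _ = ε := by simp only [η]; field_simp

/-- Entropy is unchanged when a density operator is extended by zero along an isometry. -/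
theorem vonNeumannEntropy_conj_isometry {δ : H' →L[ℂ] H'} (hδ : IsDensityOperator δ)
    {J : H' →L[ℂ] H} (hJ : J.adjoint ∘L J = 1) :
    vonNeumannEntropy (J ∘L δ ∘L J.adjoint) = vonNeumannEntropy δ := by
  have hJx (x : H') : J.adjoint (J x) = x := congrArg (fun q : H' →L[ℂ] H' => q x) hJ
  have hsa : IsSelfAdjoint (J ∘L δ ∘L J.adjoint) := (hδ.1.conj_adjoint J).isSelfAdjoint
  have hc := Real.continuous_negMulLog
  have h1 : (J ∘L δ ∘L J.adjoint) ∘L J = J ∘L δ := by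
    ext x; simp [hJx]
  have h2 := cfc_comp_intertwine hsa hδ.1.isSelfAdjoint h1 hc
  -- Off the range of `J` the extended operator is zero, and `negMulLog 0 = 0` keeps it zero under
  -- the functional calculus.
  have h3 : (J ∘L δ ∘L J.adjoint) ∘L (1 - J ∘L J.adjoint) =
      (1 - J ∘L J.adjoint) ∘L (0 : H →L[ℂ] H) := by
    ext x; simp [hJx]
  have h4 := cfc_comp_intertwine hsa (.zero _) h3 hc
  rw [cfc_apply_zero, Real.negMulLog_zero, map_zero] at h4
  have h5 : cfc Real.negMulLog (J ∘L δ ∘L J.adjoint) =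
      J ∘L cfc Real.negMulLog δ ∘L J.adjoint := by
    rw [ContinuousLinearMap.comp_zero, ContinuousLinearMap.comp_sub, sub_eq_zero] at h4
    ext x
    exact (congrArg (fun q : H →L[ℂ] H => q x) h4).trans
      (congrArg (fun q : H' →L[ℂ] H => q (J.adjoint x)) h2)
  have h6 : (cfc Real.negMulLog δ).IsPositive := by
    rw [← ContinuousLinearMap.nonneg_iff_isPositive]
    refine cfc_nonneg fun x hx => ?_
    exact Real.negMulLog_nonneg (hδ.spectrum_subset hx).1 (hδ.spectrum_subset hx).2
  -- With `s` the square root of `η(δ)`, the traces agree as `Tr AA† = Tr A†A` for `A = J s`.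
  obtain ⟨s, hs, hsT⟩ := exists_sqrt h6
  unfold vonNeumannEntropy
  rw [h5]
  have h7 := posTrace_adjoint_comp (J ∘L s)
  rw [ContinuousLinearMap.adjoint_comp, hs] at h7
  convert h7.symm using 2
  · ext x; simp [hsT]
  · ext x; simp [hsT, hJx]

end Intertwine

/-! ### Unitary representations and the twirl -/

namespace UnitaryRep

variable {G : Type*} [Group G] [TopologicalSpace G]
  {H : Type*} [NormedAddCommGroup H] [InnerProductSpace ℂ H]

theorem toHom_mul_apply (U : UnitaryRep G H) (g h : G) (x : H) :
    U.toHom (g * h) x = U.toHom g (U.toHom h x) := by rw [map_mul]; rfl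

@[simp] theorem toHom_one_apply (U : UnitaryRep G H) (x : H) : U.toHom 1 x = x := by
  rw [map_one]; rfl

@[simp] theorem toHom_inv_apply_apply (U : UnitaryRep G H) (g : G) (x : H) :
    U.toHom g⁻¹ (U.toHom g x) = x := by rw [← toHom_mul_apply]; simp

@[simp] theorem toHom_apply_inv_apply (U : UnitaryRep G H) (g : G) (x : H) :
    U.toHom g (U.toHom g⁻¹ x) = x := by rw [← toHom_mul_apply]; simp

theorem inner_toHom_left (U : UnitaryRep G H) (g : G) (x y : H) :
    ⟪U.toHom g x, y⟫_ℂ = ⟪x, U.toHom g⁻¹ y⟫_ℂ := by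
  rw [← (U.toHom g).inner_map_map x, toHom_apply_inv_apply]

section Twirl

variable [IsTopologicalGroup G] [CompactSpace G] [MeasurableSpace G] [BorelSpace G]

theorem twirl_apply (U : UnitaryRep G H) (a : H →L[ℂ] H) (x : H) :
    U.twirl a x = ∫ g, U.toHom g (a (U.toHom g⁻¹ x)) ∂(haarProb G) := rfl

theorem toHom_twirl [CompleteSpace H] (U : UnitaryRep G H) (a : H →L[ℂ] H) (h : G) (x : H) :
    U.toHom h (U.twirl a x) = U.twirl a (U.toHom h x) := by
  have h1 := (U.op h).integral_comp_comm (U.integrable_conj a x)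
  have h2 := integral_mul_left_eq_self (μ := haarProb G)
    (fun g => U.toHom g (a (U.toHom g⁻¹ (U.toHom h x)))) h
  rw [twirl_apply, twirl_apply, ← op_apply, ← h1, ← h2]
  refine integral_congr_ae (.of_forall fun g => ?_)
  simp only [op_apply, toHom_mul_apply, mul_inv_rev, toHom_inv_apply_apply]

theorem twirl_eq_self [CompleteSpace H] (U : UnitaryRep G H) {a : H →L[ℂ] H}
    (ha : ∀ g x, U.toHom g (a x) = a (U.toHom g x)) : U.twirl a = a := by
  ext x
  rw [twirl_apply]
  simp [ha]

theorem inner_twirl [CompleteSpace H] (U : UnitaryRep G H) (a : H →L[ℂ] H) (x y : H) :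
    ⟪x, U.twirl a y⟫_ℂ = ∫ g, ⟪U.toHom g⁻¹ x, a (U.toHom g⁻¹ y)⟫_ℂ ∂(haarProb G) := by
  rw [twirl_apply, ← integral_inner (U.integrable_conj a y) x]
  refine integral_congr_ae (.of_forall fun g => ?_)
  simp only [inner_toHom_left, inv_inv]

theorem isPositive_twirl [CompleteSpace H] (U : UnitaryRep G H) {a : H →L[ℂ] H}
    (ha : a.IsPositive) : (U.twirl a).IsPositive := by
  refine ⟨fun x y => ?_, fun x => ?_⟩
  · change ⟪U.twirl a x, y⟫_ℂ = ⟪x, U.twirl a y⟫_ℂ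
    rw [← inner_conj_symm, inner_twirl, inner_twirl, ← integral_conj]
    refine integral_congr_ae (.of_forall fun g => ?_)
    simp only [inner_conj_symm]
    exact ha.isSelfAdjoint.isSymmetric _ _
  · rw [ContinuousLinearMap.reApplyInnerSelf_apply, inner_re_symm, inner_twirl, ← integral_re]
    · refine integral_nonneg fun g => ?_
      exact (RCLike.nonneg_iff.1 (ha.inner_nonneg_right _)).1
    · have := (innerSL ℂ x).integrable_comp (U.integrable_conj a x)
      simpa only [innerSL_apply_apply, inner_toHom_left, inv_inv] using this

/-- The twirl of `C a B` for operators `B`, `C` that intertwine the conjugation actions. -/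
theorem twirl_conj [CompleteSpace H] {H' : Type*} [NormedAddCommGroup H'] [InnerProductSpace ℂ H']
    [CompleteSpace H'] (U : UnitaryRep G H) (U' : UnitaryRep G H') (C : H →L[ℂ] H')
    (B : H' →L[ℂ] H) (a : H →L[ℂ] H)
    (h : ∀ g x, U'.toHom g (C (a (B (U'.toHom g⁻¹ x)))) = C (U.toHom g (a (U.toHom g⁻¹ (B x))))) :
    U'.twirl (C ∘L a ∘L B) = C ∘L U.twirl a ∘L B := by
  ext x
  have h1 := C.integral_comp_comm (U.integrable_conj a (B x))
  rw [twirl_apply]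
  simp only [ContinuousLinearMap.comp_apply, twirl_apply, ← h1, h]

end Twirl

end UnitaryRep

/-! ### Schur's lemma and complete reducibility -/

namespace Irrep

variable {G : Type*} [Group G] [TopologicalSpace G]

/-- The representation space of an irreducible representation. -/
abbrev Space (π : Irrep G) : Type := EuclideanSpace ℂ (Fin π.dim)

/-- The first standard basis vector. -/
def vec (π : Irrep G) : π.Space := EuclideanSpace.single ⟨0, π.dim_pos⟩ 1

@[simp] theorem norm_vec (π : Irrep G) : ‖π.vec‖ = 1 := by simp [vec]

theorem vec_ne_zero (π : Irrep G) : π.vec ≠ 0 := fun h => by simpa [h] using π.norm_vec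

/-- An eigenspace of `A` is invariant and non-zero, hence everything. -/
theorem schur_self (π : Irrep G) (A : π.Space →L[ℂ] π.Space)
    (hA : ∀ g x, A (π.rep.toHom g x) = π.rep.toHom g (A x)) : ∃ c : ℂ, ∀ x, A x = c • x := by
  have : Nontrivial π.Space := ⟨⟨π.vec, 0, π.vec_ne_zero⟩⟩
  obtain ⟨c, hc⟩ := Module.End.exists_eigenvalue (A : π.Space →ₗ[ℂ] π.Space)
  refine ⟨c, fun x => ?_⟩
  have hmem (y : π.Space) : y ∈ Module.End.eigenspace (A : π.Space →ₗ[ℂ] π.Space) c ↔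
      A y = c • y := Module.End.mem_eigenspace_iff
  rcases π.irreducible (Module.End.eigenspace (A : π.Space →ₗ[ℂ] π.Space) c) fun g w hw => by
    rw [hmem] at hw ⊢
    rw [hA, hw, map_smul] with h | h
  · exact absurd h hc
  · rw [← hmem, h]; trivial

theorem adjoint_comp_equivariant {H : Type*} [NormedAddCommGroup H] [InnerProductSpace ℂ H]
    [CompleteSpace H] {U : UnitaryRep G H} {π π' : Irrep G} {S : π'.Space →L[ℂ] H}
    {T : π.Space →L[ℂ] H} (hS : ∀ g x, S (π'.rep.toHom g x) = U.toHom g (S x))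
    (hT : ∀ g x, T (π.rep.toHom g x) = U.toHom g (T x)) (g : G) (x : π.Space) :
    (S.adjoint ∘L T) (π.rep.toHom g x) = π'.rep.toHom g ((S.adjoint ∘L T) x) := by
  refine ext_inner_left ℂ fun y => ?_
  rw [← inv_inv g, ← UnitaryRep.inner_toHom_left, ContinuousLinearMap.comp_apply,
    ContinuousLinearMap.comp_apply, ContinuousLinearMap.adjoint_inner_right,
    ContinuousLinearMap.adjoint_inner_right, hS, hT, UnitaryRep.inner_toHom_left]

/-- `S† T` commutes with the irreducible representation, so it is a scalar; the scalar is read off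
at the unit vector `vec`. This one identity yields both the orthogonality of `|r, i⟩ ⊗ k` for
different `i` and the independence of `i` of diagonal coefficients. -/
theorem exists_inner_eq {H : Type*} [NormedAddCommGroup H] [InnerProductSpace ℂ H]
    [CompleteSpace H] {U : UnitaryRep G H} {π : Irrep G} {S T : π.Space →L[ℂ] H}
    (hS : ∀ g x, S (π.rep.toHom g x) = U.toHom g (S x))
    (hT : ∀ g x, T (π.rep.toHom g x) = U.toHom g (T x)) (x y : π.Space) :
    ⟪S x, T y⟫_ℂ = ⟪S π.vec, T π.vec⟫_ℂ * ⟪x, y⟫_ℂ := by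
  obtain ⟨c, hc⟩ := π.schur_self _ (adjoint_comp_equivariant hS hT)
  have h (x y : π.Space) : ⟪S x, T y⟫_ℂ = c * ⟪x, y⟫_ℂ := by
    rw [← inner_smul_right, ← hc, ContinuousLinearMap.comp_apply,
      ContinuousLinearMap.adjoint_inner_right]
  rw [h x y, h π.vec, inner_self_eq_norm_sq_to_K]
  simp

theorem norm_apply_eq {H : Type*} [NormedAddCommGroup H] [InnerProductSpace ℂ H]
    [CompleteSpace H] {U : UnitaryRep G H} {π : Irrep G} {T : π.Space →L[ℂ] H}
    (hT : ∀ g x, T (π.rep.toHom g x) = U.toHom g (T x)) (x : π.Space) :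
    ‖T x‖ = ‖T π.vec‖ * ‖x‖ := by
  have h := exists_inner_eq hT hT x x
  rw [inner_self_eq_norm_sq_to_K, inner_self_eq_norm_sq_to_K, inner_self_eq_norm_sq_to_K] at h
  norm_cast at h
  rwa [← mul_pow, sq_eq_sq₀ (norm_nonneg _) (by positivity)] at h

/-- A non-zero intertwiner between irreducible representations is, up to a scalar, a unitary
equivalence. -/
theorem equiv_of_ne_zero {π π' : Irrep G} (A : π.Space →L[ℂ] π'.Space)
    (hA : ∀ g x, A (π.rep.toHom g x) = π'.rep.toHom g (A x)) (h0 : A ≠ 0) : π ≈ π' := by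
  have hr : ‖A π.vec‖ ≠ 0 := fun h => h0 <| by
    ext1 x
    rw [zero_apply, ← norm_eq_zero, norm_apply_eq hA, h, zero_mul]
  let T : π.Space →ₗᵢ[ℂ] π'.Space :=
    { toLinearMap := ((‖A π.vec‖⁻¹ : ℝ) : ℂ) • (A : π.Space →ₗ[ℂ] π'.Space)
      norm_map' := fun x => by
        change ‖((‖A π.vec‖⁻¹ : ℝ) : ℂ) • A x‖ = ‖x‖
        rw [norm_smul, norm_apply_eq hA x, Complex.norm_real, norm_inv, norm_norm]
        field_simp }
  have hT (x : π.Space) : T x = ((‖A π.vec‖⁻¹ : ℝ) : ℂ) • A x := rfl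
  have hTe (g : G) (x : π.Space) : T (π.rep.toHom g x) = π'.rep.toHom g (T x) := by
    rw [hT, hA, hT, map_smul]
  have hsurj : Function.Surjective T := by
    rcases π'.irreducible T.toLinearMap.range (by
      rintro g _ ⟨x, rfl⟩
      exact ⟨π.rep.toHom g x, hTe g x⟩) with h | h
    · have h1 : T π.vec ∈ T.toLinearMap.range := ⟨_, rfl⟩
      rw [h, Submodule.mem_bot] at h1
      exact absurd ((map_eq_zero_iff T T.injective).1 h1) π.vec_ne_zero
    · exact LinearMap.range_eq_top.1 h
  exact ⟨LinearIsometryEquiv.ofSurjective T hsurj, hTe⟩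

end Irrep

theorem Dual.eq_of_equiv {G : Type*} [Group G] [TopologicalSpace G] {r s : Dual G}
    (h : r.irrep ≈ s.irrep) : r = s := Quotient.out_equiv_out.1 h

namespace UnitaryRep

variable {G : Type*} [Group G] [TopologicalSpace G]
  {H : Type*} [NormedAddCommGroup H] [InnerProductSpace ℂ H]

/-- Transport of a representation along a unitary map. -/
def congr {H' : Type*} [NormedAddCommGroup H'] [InnerProductSpace ℂ H'] (U : UnitaryRep G H)
    (e : H ≃ₗᵢ[ℂ] H') : UnitaryRep G H' where
  toHom :=
    { toFun := fun g => (e.symm.trans (U.toHom g)).trans e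
      map_one' := by ext x; simp
      map_mul' := fun g h => by ext x; simp }
  continuous_apply x := e.continuous.comp (U.continuous_apply (e.symm x))

theorem congr_apply {H' : Type*} [NormedAddCommGroup H'] [InnerProductSpace ℂ H']
    (U : UnitaryRep G H) (e : H ≃ₗᵢ[ℂ] H') (g : G) (x : H) :
    (U.congr e).toHom g (e x) = e (U.toHom g x) := by
  change e (U.toHom g (e.symm (e x))) = _
  rw [e.symm_apply_apply]

/-- The intertwiners from an irreducible representation to `U`. -/
def intertwiners (U : UnitaryRep G H) (π : Irrep G) : Submodule ℂ (π.Space →L[ℂ] H) where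
  carrier := {T | ∀ g x, T (π.rep.toHom g x) = U.toHom g (T x)}
  zero_mem' g x := by simp
  add_mem' hS hT g x := by
    rw [add_apply, add_apply, hS, hT, map_add]
  smul_mem' c T hT g x := by
    rw [smul_apply, smul_apply, hT, map_smul]

theorem isClosed_intertwiners (U : UnitaryRep G H) (π : Irrep G) :
    IsClosed (U.intertwiners π : Set (π.Space →L[ℂ] H)) := by
  have : (U.intertwiners π : Set (π.Space →L[ℂ] H)) =
      ⋂ g, ⋂ x, {T | T (π.rep.toHom g x) = U.toHom g (T x)} := by
    ext T; simp [intertwiners]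
  rw [this]
  refine isClosed_iInter fun g => isClosed_iInter fun x => isClosed_eq (by fun_prop) ?_
  exact (U.toHom g).continuous.comp (by fun_prop)

/-- A finite-dimensional invariant subspace contains an irreducible one. -/
theorem exists_intertwiner_of_finiteDimensional (U : UnitaryRep G H) (E : Submodule ℂ H)
    [FiniteDimensional ℂ E] (hE : ∀ g, ∀ x ∈ E, U.toHom g x ∈ E) (hE0 : E ≠ ⊥) :
    ∃ (r : Dual G) (T : r.irrep.Space →L[ℂ] H), T ∈ U.intertwiners r.irrep ∧ T ≠ 0 := by
  classical
  -- A non-zero invariant subspace of least dimension is irreducible.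
  have hex : ∃ n, ∃ W : Submodule ℂ H, (∀ g, ∀ x ∈ W, U.toHom g x ∈ W) ∧ W ≠ ⊥ ∧ W ≤ E ∧
      Module.finrank ℂ W = n := ⟨_, E, hE, hE0, le_rfl, rfl⟩
  obtain ⟨W, hW, hW0, hWE, hWn⟩ := Nat.find_spec hex
  have hmin (W' : Submodule ℂ H) (hW' : ∀ g, ∀ x ∈ W', U.toHom g x ∈ W') (h0 : W' ≠ ⊥)
      (hle : W' ≤ W) : W' = W := by
    by_contra hne
    have : FiniteDimensional ℂ W := Submodule.finiteDimensional_of_le hWE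
    refine Nat.find_min hex ?_ ⟨W', hW', h0, hle.trans hWE, rfl⟩
    rw [← hWn]
    exact Submodule.finrank_lt_finrank_of_lt (lt_of_le_of_ne hle hne)
  have : FiniteDimensional ℂ W := Submodule.finiteDimensional_of_le hWE
  let e : W ≃ₗᵢ[ℂ] EuclideanSpace ℂ (Fin (Module.finrank ℂ W)) := (stdOrthonormalBasis ℂ W).repr
  let UW := U.restrict W hW
  have hUW (g : G) (x : W) : ((UW.toHom g x : W) : H) = U.toHom g x := rfl
  have hcoe (y) (g : G) : (((e.symm ((UW.congr e).toHom g y)) : W) : H) =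
      U.toHom g (e.symm y) := by
    have := UW.congr_apply e g (e.symm y)
    rw [e.apply_symm_apply] at this
    rw [this, e.symm_apply_apply, hUW]
  let π : Irrep G :=
    { dim := Module.finrank ℂ W
      dim_pos := Submodule.one_le_finrank_iff.2 hW0
      rep := UW.congr e
      irreducible := fun W0 hW0' => by
        refine or_iff_not_imp_left.2 fun hne => ?_
        let f := W.subtype ∘ₗ e.symm.toLinearEquiv.toLinearMap
        have hf : Function.Injective f := Subtype.val_injective.comp e.symm.injective
        have h1 := hmin (W0.map f) (by
          rintro g _ ⟨y, hy, rfl⟩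
          exact ⟨_, hW0' g y hy, hcoe y g⟩)
          (fun h => hne (Submodule.map_injective_of_injective hf (by rw [h, Submodule.map_bot])))
          (by rintro _ ⟨y, -, rfl⟩; exact (e.symm y).2)
        refine eq_top_iff.2 fun y _ => ?_
        have h2 : f y ∈ W0.map f := by rw [h1]; exact (e.symm y).2
        obtain ⟨z, hz, hzy⟩ := h2
        rwa [← hf hzy] }
  -- The chosen representative of the class of `π` need not be `π` itself, so a unitary equivalence
  -- is inserted.
  obtain ⟨T, hT⟩ : (Dual.irrep (Quotient.mk _ π)) ≈ π := Quotient.mk_out π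
  let S : W →ₗᵢ[ℂ] H := W.subtypeₗᵢ
  let A := (S.comp e.symm.toLinearIsometry).comp T.toLinearIsometry
  refine ⟨Quotient.mk _ π, A.toContinuousLinearMap, fun g x => ?_, fun h => ?_⟩
  · change ((e.symm (T _) : W) : H) = U.toHom g (e.symm (T x))
    rw [hT]
    exact hcoe _ _
  · have h1 : A (Dual.irrep (Quotient.mk _ π)).vec = 0 :=
      congrArg (fun q : _ →L[ℂ] H => q (Dual.irrep (Quotient.mk _ π)).vec) h
    exact Irrep.vec_ne_zero _ ((map_eq_zero_iff A A.injective).1 h1)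

theorem isCompactOperator_rankOne (x y : H) :
    IsCompactOperator (InnerProductSpace.rankOne ℂ x y : H →L[ℂ] H) :=
  (((isCompactOperator_id_iff_finiteDimensional (𝕜 := ℂ) (E := ℂ)).2 inferInstance).clm_comp
    (ContinuousLinearMap.toSpanSingleton ℂ x)).comp_clm (innerSL ℂ y)

section Compact

variable [IsTopologicalGroup G] [CompactSpace G] [MeasurableSpace G] [BorelSpace G]
  [CompleteSpace H]

/-- Although `U` is only strongly continuous, the projectors onto the orbit of `x` depend
norm-continuously on `g`. The twirl is therefore a norm-convergent integral of rank-one operators,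
and the compact operators form a closed convex set. -/
theorem isCompactOperator_twirl_rankOne (U : UnitaryRep G H) (x : H) :
    IsCompactOperator (U.twirl (InnerProductSpace.rankOne ℂ x x)) := by
  have hc : Continuous fun g : G =>
      (InnerProductSpace.rankOne ℂ (U.toHom g x) (U.toHom g x) : H →L[ℂ] H) :=
    ((ContinuousLinearMap.smulRightL ℂ H H).continuous.comp
      ((innerSL ℂ).continuous.comp (U.continuous_apply x))).clm_apply (U.continuous_apply x)
  have hi : Integrable (fun g : G =>
      (InnerProductSpace.rankOne ℂ (U.toHom g x) (U.toHom g x) : H →L[ℂ] H)) (haarProb G) :=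
    hc.integrable_of_hasCompactSupport (HasCompactSupport.of_compactSpace _)
  have h : U.twirl (InnerProductSpace.rankOne ℂ x x) =
      ∫ g, InnerProductSpace.rankOne ℂ (U.toHom g x) (U.toHom g x) ∂(haarProb G) := by
    ext y
    rw [twirl_apply, ContinuousLinearMap.integral_apply hi]
    refine integral_congr_ae (.of_forall fun g => ?_)
    simp only [InnerProductSpace.rankOne_apply, map_smul, inner_toHom_left]
  rw [h]
  exact Convex.integral_mem
    (((compactOperator (RingHom.id ℂ) H H).restrictScalars ℝ).convex)
    (isClosed_setOfPred_isCompactOperator (𝕜₁ := ℂ) (σ₁₂ := RingHom.id ℂ) (M₁ := H) (M₂ := H))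
    (.of_forall fun g => isCompactOperator_rankOne _ _) hi

/-- The expectation value at `x` is the integral of `|⟨x, U(g⁻¹) x⟩|²`, a continuous nonnegative
function that is positive at `g = 1`. -/
theorem twirl_rankOne_ne_zero (U : UnitaryRep G H) {x : H} (hx : x ≠ 0) :
    U.twirl (InnerProductSpace.rankOne ℂ x x) ≠ 0 := by
  intro h
  have h1 := U.inner_twirl (InnerProductSpace.rankOne ℂ x x) x x
  have h2 (g : G) : ⟪U.toHom g⁻¹ x, InnerProductSpace.rankOne ℂ x x (U.toHom g⁻¹ x)⟫_ℂ =
      ((‖⟪x, U.toHom g⁻¹ x⟫_ℂ‖ ^ 2 : ℝ) : ℂ) := by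
    rw [InnerProductSpace.rankOne_apply, inner_smul_right, ← inner_conj_symm _ x,
      RCLike.mul_conj]
    norm_cast
  simp_rw [h2] at h1
  rw [h, integral_complex_ofReal] at h1
  simp only [zero_apply, inner_zero_right] at h1
  have hc : Continuous fun g : G => ‖⟪x, U.toHom g⁻¹ x⟫_ℂ‖ ^ 2 :=
    ((continuous_const.inner ((U.continuous_apply x).comp continuous_inv)).norm).pow 2
  have hpos := hc.integral_pos_of_hasCompactSupport_nonneg_nonzero (μ := haarProb G)
    (HasCompactSupport.of_compactSpace _) (fun g => by positivity) (x := 1) (by simpa using hx)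
  exact hpos.ne (by exact_mod_cast h1)

/-- A non-zero unitary representation of a compact group contains an irreducible one. -/
theorem exists_intertwiner (U : UnitaryRep G H) [Nontrivial H] :
    ∃ (r : Dual G) (T : r.irrep.Space →L[ℂ] H), T ∈ U.intertwiners r.irrep ∧ T ≠ 0 := by
  obtain ⟨x, hx⟩ := exists_ne (0 : H)
  have hpos : (InnerProductSpace.rankOne ℂ x x : H →L[ℂ] H).IsPositive :=
    InnerProductSpace.isPositive_rankOne_self x
  have hA := U.isCompactOperator_twirl_rankOne x
  have hS := (U.isPositive_twirl hpos).isSelfAdjoint.isSymmetric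
  -- A non-zero compact self-adjoint operator has a non-zero eigenvalue; its eigenspace is
  -- finite-dimensional, and invariant because the twirl commutes with `U`.
  have h0 := mt (ContinuousLinearMap.eq_zero_of_forall_hasEigenvalue_eq_zero hA hS).1
    (U.twirl_rankOne_ne_zero hx)
  push Not at h0
  obtain ⟨μ, hμ, hμ0⟩ := h0
  have := ContinuousLinearMap.finite_dimensional_eigenspace hA μ hμ0
  refine U.exists_intertwiner_of_finiteDimensional _ (fun g y hy => ?_) hμ
  rw [Module.End.mem_eigenspace_iff] at hy ⊢
  change U.twirl _ (U.toHom g y) = _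
  rw [← toHom_twirl, ← map_smul, ← hy]
  rfl

end Compact

end UnitaryRep

/-! ### Existence of the isotypic decomposition -/

/-- The basis vector `|r, i⟩`. -/
def Dual.basisVec {G : Type*} [Group G] [TopologicalSpace G] (r : Dual G) (i : Fin r.dim) :
    r.irrep.Space := EuclideanSpace.single (i : Fin r.irrep.dim) (1 : ℂ)

theorem Dual.norm_basisVec {G : Type*} [Group G] [TopologicalSpace G] (r : Dual G)
    (i : Fin r.dim) : ‖r.basisVec i‖ = 1 := by
  have h (i : Fin r.irrep.dim) : ‖(EuclideanSpace.single i (1 : ℂ) : r.irrep.Space)‖ = 1 := by simp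
  exact h i

theorem Dual.inner_basisVec {G : Type*} [Group G] [TopologicalSpace G] (r : Dual G)
    {i j : Fin r.dim} (hij : i ≠ j) : ⟪r.basisVec i, r.basisVec j⟫_ℂ = 0 := by
  have h (i j : Fin r.irrep.dim) (hij : i ≠ j) :
      ⟪(EuclideanSpace.single i (1 : ℂ) : r.irrep.Space), EuclideanSpace.single j (1 : ℂ)⟫_ℂ = 0 := by
    rw [EuclideanSpace.inner_single_left]
    simp [hij]
  exact h i j hij

namespace UnitaryRep

variable {G : Type*} [Group G] [TopologicalSpace G]
  {H : Type*} [NormedAddCommGroup H] [InnerProductSpace ℂ H] [CompleteSpace H]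

/-- Evaluation of intertwiners at the first basis vector. -/
def evalVec (U : UnitaryRep G H) (π : Irrep G) : U.intertwiners π →ₗᵢ[ℂ] H where
  toFun T := (T : π.Space →L[ℂ] H) π.vec
  map_add' _ _ := rfl
  map_smul' _ _ := rfl
  norm_map' T := by
    -- An intertwiner out of an irreducible representation is a multiple of an isometry, so its
    -- operator norm is attained at any unit vector.
    refine le_antisymm ?_ ?_
    · refine ((T : π.Space →L[ℂ] H).le_opNorm _).trans ?_
      simp
    · exact ContinuousLinearMap.opNorm_le_bound _ (norm_nonneg _) fun x =>
        (Irrep.norm_apply_eq T.2 x).le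

/-- The multiplicity space of `[r]`, realized as the image of `|r, 0⟩ ⊗ K_r`. -/
def multSpace (U : UnitaryRep G H) (r : Dual G) : Submodule ℂ H :=
  (U.evalVec r.irrep).toLinearMap.range

theorem isClosed_multSpace (U : UnitaryRep G H) (r : Dual G) :
    IsClosed (U.multSpace r : Set H) := by
  have : CompleteSpace (U.intertwiners r.irrep) :=
    (U.isClosed_intertwiners r.irrep).completeSpace_coe
  have h := (U.evalVec r.irrep).isometry.isClosedEmbedding.isClosed_range
  convert h using 1
  exact LinearMap.coe_range _

/-- The intertwiner with a given value at the first basis vector. -/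
def ofVec (U : UnitaryRep G H) (r : Dual G) : U.multSpace r ≃ₗ[ℂ] U.intertwiners r.irrep :=
  (LinearEquiv.ofInjective (U.evalVec r.irrep).toLinearMap (U.evalVec r.irrep).injective).symm

theorem ofVec_vec (U : UnitaryRep G H) (r : Dual G) (k : U.multSpace r) :
    (U.ofVec r k : r.irrep.Space →L[ℂ] H) r.irrep.vec = k :=
  congrArg Subtype.val ((U.ofVec r).symm_apply_apply k)

/-- The map `k ↦ |r, i⟩ ⊗ k`. -/
def multEmbedding (U : UnitaryRep G H) (r : Dual G) (i : Fin r.dim) : U.multSpace r →ₗᵢ[ℂ] H where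
  toFun k := (U.ofVec r k : r.irrep.Space →L[ℂ] H) (r.basisVec i)
  map_add' k l := by rw [map_add]; rfl
  map_smul' c k := by rw [map_smul]; rfl
  norm_map' k := by
    change ‖(U.ofVec r k : r.irrep.Space →L[ℂ] H) _‖ = ‖k‖
    rw [Irrep.norm_apply_eq (U.ofVec r k).2, ofVec_vec, Dual.norm_basisVec, mul_one]
    rfl

theorem multEmbedding_apply (U : UnitaryRep G H) (r : Dual G) (i : Fin r.dim)
    (k : U.multSpace r) : U.multEmbedding r i k = (U.ofVec r k : r.irrep.Space →L[ℂ] H)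
      (r.basisVec i) := rfl

theorem euclidean_eq_sum {n : ℕ} (x : EuclideanSpace ℂ (Fin n)) :
    x = ∑ j, x j • EuclideanSpace.single j (1 : ℂ) := by
  simpa using ((EuclideanSpace.basisFun (Fin n) ℂ).sum_repr x).symm

theorem inner_intertwiner_eq_zero (U : UnitaryRep G H) {π π' : Irrep G} (h : ¬ π ≈ π')
    {S : π'.Space →L[ℂ] H} {T : π.Space →L[ℂ] H} (hS : S ∈ U.intertwiners π')
    (hT : T ∈ U.intertwiners π) (x : π'.Space) (y : π.Space) : ⟪S x, T y⟫_ℂ = 0 := by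
  have h0 : S.adjoint ∘L T = 0 := by
    by_contra h0
    exact h (Irrep.equiv_of_ne_zero _ (Irrep.adjoint_comp_equivariant hS hT) h0)
  rw [← ContinuousLinearMap.adjoint_inner_right]
  change ⟪x, (S.adjoint ∘L T) y⟫_ℂ = 0
  rw [h0]; simp

theorem orthogonalFamily_multEmbedding (U : UnitaryRep G H) :
    OrthogonalFamily ℂ (fun x : Σ r : Dual G, Fin r.dim => U.multSpace x.1)
      fun x => U.multEmbedding x.1 x.2 := by
  rintro ⟨r, i⟩ ⟨s, j⟩ hne k l
  rw [multEmbedding_apply, multEmbedding_apply]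
  by_cases h : r = s
  · subst h
    have hij : i ≠ j := fun h => hne (by rw [h])
    rw [Irrep.exists_inner_eq (U.ofVec r k).2 (U.ofVec r l).2]
    rw [r.inner_basisVec hij, mul_zero]
  · exact U.inner_intertwiner_eq_zero (fun h' => h (Dual.eq_of_equiv h').symm) (U.ofVec r k).2
      (U.ofVec s l).2 _ _

theorem equivariant_multEmbedding (U : UnitaryRep G H) (g : G) (r : Dual G) (i : Fin r.dim)
    (k : U.multSpace r) :
    U.toHom g (U.multEmbedding r i k) = ∑ j, r.matrix g j i • U.multEmbedding r j k := by
  rw [multEmbedding_apply, ← (U.ofVec r k).2,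
    euclidean_eq_sum (r.irrep.rep.toHom g (r.basisVec i)), map_sum]
  simp only [map_smul]
  rfl

section Compact

variable [IsTopologicalGroup G] [CompactSpace G] [MeasurableSpace G] [BorelSpace G]

/-- Orthogonality is Schur's lemma. For totality, the orthogonal complement `W` is invariant; if it
were non-zero it would contain an irreducible subspace, given by some intertwiner. The image of that
intertwiner also lies in the span of the blocks, so it would be orthogonal to itself. -/
theorem isHilbertSum_multEmbedding (U : UnitaryRep G H) :
    IsHilbertSum ℂ (fun x : Σ r : Dual G, Fin r.dim => U.multSpace x.1)
      fun x => U.multEmbedding x.1 x.2 := by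
  have hcomp (x : Σ r : Dual G, Fin r.dim) : CompleteSpace (U.multSpace x.1) :=
    (U.isClosed_multSpace x.1).completeSpace_coe
  refine IsHilbertSum.mk U.orthogonalFamily_multEmbedding ?_
  rw [top_le_iff, Submodule.topologicalClosure_eq_top_iff]
  set W : Submodule ℂ H := (⨆ x : Σ r : Dual G, Fin r.dim,
    (U.multEmbedding x.1 x.2).toLinearMap.range)ᗮ with hW
  have hmem (y : H) : y ∈ W ↔ ∀ r i k, ⟪U.multEmbedding r i k, y⟫_ℂ = 0 := by
    rw [hW, ← Submodule.iInf_orthogonal, Submodule.mem_iInf]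
    constructor
    · intro h r i k
      exact (Submodule.mem_orthogonal _ _).1 (h ⟨r, i⟩) _ ⟨k, rfl⟩
    · rintro h ⟨r, i⟩
      rw [Submodule.mem_orthogonal]
      rintro _ ⟨k, rfl⟩
      exact h r i k
  have hinv (g : G) (y : H) (hy : y ∈ W) : U.toHom g y ∈ W := by
    rw [hmem] at hy ⊢
    intro r i k
    rw [← inv_inv g, ← inner_toHom_left, equivariant_multEmbedding, sum_inner]
    exact Finset.sum_eq_zero fun j _ => by rw [inner_smul_left, hy, mul_zero]
  by_contra h0
  have : Nontrivial W := Submodule.nontrivial_iff_ne_bot.2 h0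
  obtain ⟨r, T, hT, hT0⟩ := (U.restrict W hinv).exists_intertwiner
  let S : U.intertwiners r.irrep := ⟨W.subtypeL ∘L T, fun g x => congrArg Subtype.val (hT g x)⟩
  let k : U.multSpace r := ⟨_, S, rfl⟩
  have hk : U.ofVec r k = S := (U.ofVec r).apply_symm_apply S
  have hzero (x y : r.irrep.Space) : ⟪(T x : H), (T y : H)⟫_ℂ = 0 := by
    rw [euclidean_eq_sum x, map_sum]
    simp only [map_smul, AddSubmonoidClass.coe_finsetSum, SetLike.val_smul, sum_inner,
      inner_smul_left]
    refine Finset.sum_eq_zero fun i _ => ?_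
    have h1 : ⟪(U.ofVec r k : r.irrep.Space →L[ℂ] H) (r.basisVec i), (T y : H)⟫_ℂ = 0 :=
      (hmem _).1 (T y).2 r i k
    rw [hk] at h1
    exact mul_eq_zero_of_right _ h1
  refine hT0 (ContinuousLinearMap.ext fun x => Subtype.ext ?_)
  exact inner_self_eq_zero.1 (hzero x x)

/-- The isotypic decomposition of a unitary representation of a compact group. -/
def isotypicDecomposition (U : UnitaryRep G H) :
    IsotypicDecomposition U fun r => U.multSpace r where
  J := U.multEmbedding
  isHilbertSum := U.isHilbertSum_multEmbedding
  equivariant := U.equivariant_multEmbedding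

end Compact

end UnitaryRep

/-! ### Hilbert sums -/

section HilbertSum

variable {H : Type*} [NormedAddCommGroup H] [InnerProductSpace ℂ H] [CompleteSpace H]
  {ι : Type*} {F : ι → Type*} [∀ i, NormedAddCommGroup (F i)] [∀ i, InnerProductSpace ℂ (F i)]
  [∀ i, CompleteSpace (F i)] {V : ∀ i, F i →ₗᵢ[ℂ] H}

theorem adjoint_apply_apply {F : Type*} [NormedAddCommGroup F] [InnerProductSpace ℂ F]
    [CompleteSpace F] (V : F →ₗᵢ[ℂ] H) (x : F) :
    V.toContinuousLinearMap.adjoint (V x) = x := by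
  refine ext_inner_left ℂ fun y => ?_
  rw [ContinuousLinearMap.adjoint_inner_right]
  exact V.inner_map_map y x

theorem adjoint_apply_apply_of_ne (hV : OrthogonalFamily ℂ F V) {i j : ι} (h : i ≠ j) (x : F j) :
    (V i).toContinuousLinearMap.adjoint (V j x) = 0 := by
  refine ext_inner_left ℂ fun y => ?_
  rw [ContinuousLinearMap.adjoint_inner_right, inner_zero_right]
  exact hV h y x

theorem IsHilbertSum.hasSum_adjoint (hV : IsHilbertSum ℂ F V) (x : H) :
    HasSum (fun i => V i ((V i).toContinuousLinearMap.adjoint x)) x := by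
  have h := hV.hasSum_linearIsometryEquiv_symm (hV.linearIsometryEquiv x)
  rw [LinearIsometryEquiv.symm_apply_apply] at h
  convert h using 3 with i
  have h1 := h.mapL ((V i).toContinuousLinearMap.adjoint)
  refine h1.unique ?_
  have h2 := hasSum_single (f := fun j => (V i).toContinuousLinearMap.adjoint
    (V j (hV.linearIsometryEquiv x j))) i fun j hj => adjoint_apply_apply_of_ne hV.1 hj.symm _
  rwa [adjoint_apply_apply] at h2

end HilbertSum

/-! ### The twirl in an isotypic decomposition -/

/-- The orthonormal basis `|r, i⟩` of the representation space. -/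
def Dual.orthonormalBasis {G : Type*} [Group G] [TopologicalSpace G] (r : Dual G) :
    OrthonormalBasis (Fin r.dim) ℂ r.irrep.Space := EuclideanSpace.basisFun (Fin r.irrep.dim) ℂ

theorem Dual.orthonormalBasis_apply {G : Type*} [Group G] [TopologicalSpace G] (r : Dual G)
    (i : Fin r.dim) : r.orthonormalBasis i = r.basisVec i :=
  EuclideanSpace.basisFun_apply (Fin r.irrep.dim) ℂ i

theorem Dual.matrix_eq_inner {G : Type*} [Group G] [TopologicalSpace G] (r : Dual G) (g : G)
    (j i : Fin r.dim) :
    r.matrix g j i = ⟪r.orthonormalBasis j, r.irrep.rep.toHom g (r.orthonormalBasis i)⟫_ℂ := by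
  have h (x : r.irrep.Space) (j : Fin r.irrep.dim) :
      ⟪(EuclideanSpace.single j (1 : ℂ) : r.irrep.Space), x⟫_ℂ = x j := by
    rw [EuclideanSpace.inner_single_left]; simp
  rw [orthonormalBasis_apply, orthonormalBasis_apply]
  exact (h _ _).symm

theorem Dual.dim_pos {G : Type*} [Group G] [TopologicalSpace G] (r : Dual G) : 0 < r.dim :=
  r.irrep.dim_pos

theorem UnitaryRep.integrable_inner_conj {G : Type*} [Group G] [TopologicalSpace G]
    [IsTopologicalGroup G] [CompactSpace G] [MeasurableSpace G] [BorelSpace G]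
    {H : Type*} [NormedAddCommGroup H] [InnerProductSpace ℂ H]
    (U : UnitaryRep G H) (a : H →L[ℂ] H) (x y : H) :
    Integrable (fun g => ⟪U.toHom g⁻¹ x, a (U.toHom g⁻¹ y)⟫_ℂ) (haarProb G) := by
  have hc : Continuous fun g => ⟪U.toHom g⁻¹ x, a (U.toHom g⁻¹ y)⟫_ℂ :=
    ((U.continuous_apply x).comp continuous_inv).inner
      (a.continuous.comp ((U.continuous_apply y).comp continuous_inv))
  exact hc.integrable_of_hasCompactSupport (HasCompactSupport.of_compactSpace _)

namespace IsotypicDecomposition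

variable {G : Type*} [Group G] [TopologicalSpace G]
  {H : Type*} [NormedAddCommGroup H] [InnerProductSpace ℂ H] [CompleteSpace H]
  {U : UnitaryRep G H} {K : Dual G → Type*} [∀ r, NormedAddCommGroup (K r)]
  [∀ r, InnerProductSpace ℂ (K r)] [∀ r, CompleteSpace (K r)] (D : IsotypicDecomposition U K)

theorem adjoint_inc_inc (r : Dual G) (i : Fin r.dim) (k : K r) :
    (D.inc r i).adjoint (D.inc r i k) = k := adjoint_apply_apply (D.J r i) k

theorem adjoint_inc_inc_of_ne {x y : Σ r : Dual G, Fin r.dim} (h : x ≠ y) (k : K y.1) :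
    (D.inc x.1 x.2).adjoint (D.inc y.1 y.2 k) = 0 :=
  adjoint_apply_apply_of_ne (V := fun x : Σ r : Dual G, Fin r.dim => D.J x.1 x.2)
    D.isHilbertSum.1 h k

theorem inner_inc_inc (r : Dual G) (i : Fin r.dim) (k l : K r) :
    ⟪D.inc r i k, D.inc r i l⟫_ℂ = ⟪k, l⟫_ℂ := (D.J r i).inner_map_map k l

theorem hasSum_inc (x : H) :
    HasSum (fun y : Σ r : Dual G, Fin r.dim => D.inc y.1 y.2 ((D.inc y.1 y.2).adjoint x)) x :=
  IsHilbertSum.hasSum_adjoint (V := fun x : Σ r : Dual G, Fin r.dim => D.J x.1 x.2)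
    D.isHilbertSum x

theorem hasSum_apply {F : Type*} [NormedAddCommGroup F] [NormedSpace ℂ F] (a : H →L[ℂ] F)
    (x : H) : HasSum (fun r : Dual G => ∑ i, a (D.inc r i ((D.inc r i).adjoint x))) (a x) :=
  (((D.hasSum_inc x).mapL a).sigma fun _ => hasSum_fintype _)

theorem clm_ext {F : Type*} [NormedAddCommGroup F] [NormedSpace ℂ F] {a b : H →L[ℂ] F}
    (h : ∀ r i k, a (D.inc r i k) = b (D.inc r i k)) : a = b := by
  ext x
  refine (D.hasSum_apply a x).unique ?_
  simpa only [h] using D.hasSum_apply b x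

theorem toHom_inc (g : G) (r : Dual G) (i : Fin r.dim) (k : K r) :
    U.toHom g (D.inc r i k) = ∑ j, r.matrix g j i • D.inc r j k := D.equivariant g r i k

/-- The intertwiner `|r, i⟩ ↦ |r, i⟩ ⊗ k`. -/
def tensorVec (r : Dual G) (k : K r) : r.irrep.Space →L[ℂ] H :=
  ∑ i, (innerSL ℂ (r.orthonormalBasis i)).smulRight (D.inc r i k)

theorem tensorVec_apply (r : Dual G) (k : K r) (x : r.irrep.Space) :
    D.tensorVec r k x = ∑ i, ⟪r.orthonormalBasis i, x⟫_ℂ • D.inc r i k := by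
  simp [tensorVec]

theorem tensorVec_basis (r : Dual G) (k : K r) (i : Fin r.dim) :
    D.tensorVec r k (r.orthonormalBasis i) = D.inc r i k := by
  classical
  rw [tensorVec_apply]
  simp [orthonormal_iff_ite.1 r.orthonormalBasis.orthonormal]

theorem tensorVec_mem (r : Dual G) (k : K r) : D.tensorVec r k ∈ U.intertwiners r.irrep := by
  intro g x
  have h1 : ((U.op g ∘L D.tensorVec r k) : r.irrep.Space →ₗ[ℂ] H) =
      (D.tensorVec r k ∘L r.irrep.rep.op g : r.irrep.Space →ₗ[ℂ] H) := by
    refine r.orthonormalBasis.toBasis.ext fun i => ?_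
    simp only [OrthonormalBasis.coe_toBasis]
    change U.toHom g (D.tensorVec r k (r.orthonormalBasis i)) =
      D.tensorVec r k (r.irrep.rep.toHom g (r.orthonormalBasis i))
    rw [tensorVec_basis, toHom_inc, tensorVec_apply]
    simp only [Dual.matrix_eq_inner]
  exact (congrArg (fun q : r.irrep.Space →ₗ[ℂ] H => q x) h1).symm

theorem inner_mult (a : H →L[ℂ] H) (r : Dual G) (k l : K r) :
    ⟪k, D.mult a r l⟫_ℂ = ∑ i, ⟪D.inc r i k, a (D.inc r i l)⟫_ℂ := by
  simp [mult, ContinuousLinearMap.adjoint_inner_right]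

/-- An operator that commutes with the representation acts on the multiplicity spaces. -/
theorem apply_inc_of_commute {a : H →L[ℂ] H} (ha : ∀ g x, U.toHom g (a x) = a (U.toHom g x))
    (r : Dual G) (i : Fin r.dim) (k : K r) :
    a (D.inc r i k) = D.inc r i (((r.dim : ℂ)⁻¹ • D.mult a r) k) := by
  have hmem : a ∘L D.tensorVec r k ∈ U.intertwiners r.irrep := fun g x => by
    rw [ContinuousLinearMap.comp_apply, ContinuousLinearMap.comp_apply, D.tensorVec_mem r k, ha]
  have happ (j : Fin r.dim) : (a ∘L D.tensorVec r k) (r.orthonormalBasis j) = a (D.inc r j k) := by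
    rw [ContinuousLinearMap.comp_apply, tensorVec_basis]
  -- Composing `a` with the intertwiner `|r, i⟩ ↦ |r, i⟩ ⊗ k` gives another intertwiner, so Schur
  -- kills all components outside the block `(r, i)`.
  have hzero (y : Σ r : Dual G, Fin r.dim) (hy : y ≠ ⟨r, i⟩) (l : K y.1) :
      ⟪D.inc y.1 y.2 l, a (D.inc r i k)⟫_ℂ = 0 := by
    obtain ⟨s, j⟩ := y
    rw [← D.tensorVec_basis s l j, ← happ]
    by_cases h : r = s
    · subst h
      have hij : j ≠ i := fun h => hy (by rw [h])
      rw [Irrep.exists_inner_eq (D.tensorVec_mem r l) hmem, r.orthonormalBasis.orthonormal.2 hij,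
        mul_zero]
    · exact U.inner_intertwiner_eq_zero (fun h' => h (Dual.eq_of_equiv h')) (D.tensorVec_mem s l)
        hmem _ _
  have h1 : a (D.inc r i k) = D.inc r i ((D.inc r i).adjoint (a (D.inc r i k))) := by
    refine (D.hasSum_inc _).unique (hasSum_single (f := fun y : Σ r : Dual G, Fin r.dim =>
      D.inc y.1 y.2 ((D.inc y.1 y.2).adjoint (a (D.inc r i k)))) ⟨r, i⟩ fun y hy => ?_)
    have h2 : (D.inc y.1 y.2).adjoint (a (D.inc r i k)) = 0 := by
      refine ext_inner_left ℂ fun l => ?_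
      rw [ContinuousLinearMap.adjoint_inner_right, hzero y hy, inner_zero_right]
    rw [h2, map_zero]
  rw [h1]
  congr 1
  refine ext_inner_left ℂ fun l => ?_
  -- The diagonal coefficient does not depend on `j`, so each one equals the average over `j`, which
  -- is the partial trace divided by `d_r`.
  have h3 (j : Fin r.dim) : ⟪D.inc r j l, a (D.inc r j k)⟫_ℂ =
      ⟪D.tensorVec r l r.irrep.vec, (a ∘L D.tensorVec r k) r.irrep.vec⟫_ℂ := by
    rw [← happ, ← D.tensorVec_basis r l j, Irrep.exists_inner_eq (D.tensorVec_mem r l) hmem,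
      inner_self_eq_norm_sq_to_K, r.orthonormalBasis.orthonormal.1 j]
    simp
  have hd : (r.dim : ℂ) ≠ 0 := by exact_mod_cast r.dim_pos.ne'
  rw [ContinuousLinearMap.adjoint_inner_right, smul_apply, inner_smul_right, inner_mult]
  simp_rw [h3]
  simp [hd]

/-- The blocks are orthogonal and total, so a convergent sum over sectors can be replaced by
equations on each block. -/
theorem isBlockSum_iff {a : H →L[ℂ] H} {b : ∀ r, K r →L[ℂ] K r} :
    D.IsBlockSum a b ↔ ∀ r i k, a (D.inc r i k) = D.inc r i (b r k) := by
  constructor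
  · intro h r i k
    refine (h (D.inc r i k)).unique ?_
    have h1 : ∀ s ≠ r, ∑ j, D.inc s j (b s ((D.inc s j).adjoint (D.inc r i k))) = 0 := by
      intro s hs
      refine Finset.sum_eq_zero fun j _ => ?_
      rw [D.adjoint_inc_inc_of_ne (x := ⟨s, j⟩) (y := ⟨r, i⟩) (fun h => hs (congrArg Sigma.fst h)),
        map_zero, map_zero]
    have h2 := hasSum_single r h1
    rw [Finset.sum_eq_single i (fun j _ hj => ?_) (by simp), D.adjoint_inc_inc] at h2
    · exact h2
    · rw [D.adjoint_inc_inc_of_ne (x := ⟨r, j⟩) (y := ⟨r, i⟩) (fun h => hj (by simpa using h)),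
        map_zero, map_zero]
  · intro h x
    simpa only [h] using D.hasSum_apply a x

theorem IsBlockSum.commute {D : IsotypicDecomposition U K} {a : H →L[ℂ] H}
    {b : ∀ r, K r →L[ℂ] K r} (h : D.IsBlockSum a b) (g : G) (x : H) :
    U.toHom g (a x) = a (U.toHom g x) := by
  rw [isBlockSum_iff] at h
  have h1 : U.op g ∘L a = a ∘L U.op g := by
    refine D.clm_ext fun r i k => ?_
    simp [h, toHom_inc]
  exact congrArg (fun q : H →L[ℂ] H => q x) h1

section Compact

variable [IsTopologicalGroup G] [CompactSpace G] [MeasurableSpace G] [BorelSpace G]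

/-- Each matrix element of the partial trace is the trace of an operator `A` on the
finite-dimensional `H_r`. Conjugating `a` by `U(g)` only rotates the orthonormal basis in which that
trace is computed, so the integrand is constant. -/
theorem mult_twirl (a : H →L[ℂ] H) (r : Dual G) : D.mult (U.twirl a) r = D.mult a r := by
  ext l
  refine ext_inner_left ℂ fun k => ?_
  let A : r.irrep.Space →L[ℂ] r.irrep.Space := (D.tensorVec r k).adjoint ∘L a ∘L D.tensorVec r l
  have hA (b : OrthonormalBasis (Fin r.dim) ℂ r.irrep.Space) :
      ∑ i, ⟪D.tensorVec r k (b i), a (D.tensorVec r l (b i))⟫_ℂ =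
        LinearMap.trace ℂ r.irrep.Space (A : r.irrep.Space →ₗ[ℂ] r.irrep.Space) := by
    rw [LinearMap.trace_eq_sum_inner _ b]
    refine Finset.sum_congr rfl fun i _ => ?_
    exact (ContinuousLinearMap.adjoint_inner_right _ _ _).symm
  have hg (g : G) : ∑ i, ⟪U.toHom g⁻¹ (D.inc r i k), a (U.toHom g⁻¹ (D.inc r i l))⟫_ℂ =
      LinearMap.trace ℂ r.irrep.Space (A : r.irrep.Space →ₗ[ℂ] r.irrep.Space) := by
    rw [← hA (r.orthonormalBasis.map (r.irrep.rep.toHom g⁻¹))]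
    refine Finset.sum_congr rfl fun i _ => ?_
    rw [OrthonormalBasis.map_apply, D.tensorVec_mem r k, D.tensorVec_mem r l, tensorVec_basis,
      tensorVec_basis]
  rw [inner_mult, inner_mult]
  simp_rw [UnitaryRep.inner_twirl]
  rw [← integral_finsetSum _ fun i _ => U.integrable_inner_conj a _ _]
  simp_rw [hg, ← D.tensorVec_basis]
  rw [hA]
  simp

/-- `𝔊(a) = ⨁_[r] (1_r / d_r) ⊗ Tr_{H_r}(a|_r)`. -/
theorem isBlockSum_twirl (a : H →L[ℂ] H) :
    D.IsBlockSum (U.twirl a) fun r => (r.dim : ℂ)⁻¹ • D.mult a r := by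
  rw [isBlockSum_iff]
  intro r i k
  rw [← D.mult_twirl a, D.apply_inc_of_commute (U.toHom_twirl a)]

theorem IsBlockSum.twirl_eq {D : IsotypicDecomposition U K} {a : H →L[ℂ] H}
    {b : ∀ r, K r →L[ℂ] K r} (h : D.IsBlockSum a b) : U.twirl a = a :=
  U.twirl_eq_self h.commute

theorem mem_range_twirl_iff (a : H →L[ℂ] H) :
    a ∈ Set.range U.twirl ↔ ∃ b, D.IsBlockSum a b := by
  constructor
  · rintro ⟨a, rfl⟩
    exact ⟨_, D.isBlockSum_twirl a⟩
  · rintro ⟨b, h⟩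
    exact ⟨a, h.twirl_eq⟩

/-- Commuting with `|k⟩⟨l|` and evaluating at `l` gives `⟨l, l⟩ b k = ⟨l, b l⟩ k`. On the zero space
any scalar serves. -/
theorem apply_eq_smul_of_commute_rankOne {F : Type*} [NormedAddCommGroup F]
    [InnerProductSpace ℂ F] (b : F →L[ℂ] F)
    (hb : ∀ k l x, b (InnerProductSpace.rankOne ℂ k l x) = InnerProductSpace.rankOne ℂ k l (b x)) :
    ∃ c : ℂ, ∀ k, b k = c • k := by
  by_cases h : ∃ l : F, l ≠ 0
  · obtain ⟨l, hl⟩ := h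
    refine ⟨(⟪l, l⟫_ℂ)⁻¹ * ⟪l, b l⟫_ℂ, fun k => ?_⟩
    have h1 := hb k l l
    rw [InnerProductSpace.rankOne_apply, InnerProductSpace.rankOne_apply, map_smul] at h1
    rw [mul_smul, ← h1, smul_smul, inv_mul_cancel₀ (inner_self_ne_zero.2 hl), one_smul]
  · push Not at h
    exact ⟨0, fun k => by rw [h k]; simp⟩

/-- The center of `𝔊(B(H))`. -/
theorem mem_center_iff (z : H →L[ℂ] H) :
    (z ∈ Set.range U.twirl ∧ ∀ a ∈ Set.range U.twirl, z ∘L a = a ∘L z) ↔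
      ∃ c : Dual G → ℂ, ∀ r i, z ∘L D.inc r i = c r • D.inc r i := by
  constructor
  · rintro ⟨hz, hc⟩
    obtain ⟨b, hb⟩ := (D.mem_range_twirl_iff z).1 hz
    rw [isBlockSum_iff] at hb
    have hsc (r : Dual G) : ∃ c : ℂ, ∀ k, b r k = c • k := by
      refine apply_eq_smul_of_commute_rankOne (b r) fun k l x => ?_
      classical
      -- The test operator `1_r ⊗ |k⟩⟨l|` is a block sum, hence in the range of the twirl; commuting
      -- with all of these makes `b_r` a scalar.
      let R : K r →L[ℂ] K r := InnerProductSpace.rankOne ℂ k l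
      let a : H →L[ℂ] H := ∑ i, D.inc r i ∘L R ∘L (D.inc r i).adjoint
      have ha (s : Dual G) (j : Fin s.dim) (y : K s) :
          a (D.inc s j y) =
            D.inc s j ((Function.update (fun s => (0 : K s →L[ℂ] K s)) r R s) y) := by
        simp only [a, sum_apply, ContinuousLinearMap.comp_apply]
        by_cases hs : s = r
        · subst hs
          rw [Function.update_self, Finset.sum_eq_single j (fun i _ hi => ?_) (by simp),
            D.adjoint_inc_inc]
          rw [D.adjoint_inc_inc_of_ne (x := ⟨s, i⟩) (y := ⟨s, j⟩) (fun h => hi (by simpa using h)),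
            map_zero, map_zero]
        · rw [Function.update_of_ne hs, zero_apply, map_zero]
          refine Finset.sum_eq_zero fun i _ => ?_
          rw [D.adjoint_inc_inc_of_ne (x := ⟨r, i⟩) (y := ⟨s, j⟩)
            (fun h => hs (congrArg Sigma.fst h).symm), map_zero, map_zero]
      have hac := hc a ((D.mem_range_twirl_iff a).2 ⟨_, D.isBlockSum_iff.2 ha⟩)
      have h1 := congrArg (fun q : H →L[ℂ] H => q (D.inc r ⟨0, r.dim_pos⟩ x)) hac
      simp only [ContinuousLinearMap.comp_apply, ha, hb, Function.update_self] at h1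
      exact (D.J r ⟨0, r.dim_pos⟩).injective h1
    choose c hc' using hsc
    refine ⟨c, fun r i => ?_⟩
    ext k
    rw [ContinuousLinearMap.comp_apply, hb, hc', map_smul, smul_apply]
  · rintro ⟨c, hc⟩
    have hz : D.IsBlockSum z fun r => c r • (1 : K r →L[ℂ] K r) := by
      rw [isBlockSum_iff]
      intro r i k
      have h1 := congrArg (fun q : K r →L[ℂ] H => q k) (hc r i)
      simpa using h1
    refine ⟨⟨z, hz.twirl_eq⟩, fun a ha => ?_⟩
    obtain ⟨b, hb⟩ := (D.mem_range_twirl_iff a).1 ha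
    rw [isBlockSum_iff] at hb hz
    refine D.clm_ext fun r i k => ?_
    simp [hb, hz]

end Compact

/-! ### Traces and entropy in an isotypic decomposition -/

/-- The index set of the standard basis of the multiplicity space. -/
abbrev BasisIndex (K : Dual G → Type*) [∀ r, NormedAddCommGroup (K r)]
    [∀ r, InnerProductSpace ℂ (K r)] [∀ r, CompleteSpace (K r)] (r : Dual G) : Type _ :=
  (exists_hilbertBasis ℂ (K r)).choose

/-- The vectors `|r, i⟩ ⊗ k` with `k` in a basis of the multiplicity space. -/
def basisVec (x : Σ y : (Σ r : Dual G, BasisIndex K r), Fin y.1.dim) : H :=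
  D.inc x.1.1 x.2 (stdBasis (K x.1.1) x.1.2)

theorem orthonormal_basisVec : Orthonormal ℂ D.basisVec := by
  refine ⟨fun x => ?_, ?_⟩
  · change ‖D.J x.1.1 x.2 _‖ = 1
    rw [LinearIsometry.norm_map]
    exact (stdBasis (K x.1.1)).orthonormal.1 _
  · rintro ⟨⟨r, k⟩, i⟩ ⟨⟨s, l⟩, j⟩ hne
    by_cases h : (⟨r, i⟩ : Σ r : Dual G, Fin r.dim) = ⟨s, j⟩
    · obtain ⟨rfl, hij⟩ := Sigma.mk.inj_iff.1 h
      obtain rfl := eq_of_heq hij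
      change ⟪D.inc r i _, D.inc r i _⟫_ℂ = 0
      rw [inner_inc_inc]
      exact (stdBasis (K r)).orthonormal.2 fun h => hne (by rw [show k = l from h])
    · exact D.isHilbertSum.1 h _ _

/-- The Hilbert basis of vectors `|r, i⟩ ⊗ k`. -/
def basis : HilbertBasis (Σ y : (Σ r : Dual G, BasisIndex K r), Fin y.1.dim) ℂ H :=
  HilbertBasis.mkOfOrthogonalEqBot D.orthonormal_basisVec <| by
    rw [Submodule.eq_bot_iff]
    intro x hx
    rw [Submodule.mem_orthogonal] at hx
    have h0 (r : Dual G) (i : Fin r.dim) : (D.inc r i).adjoint x = 0 := by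
      rw [← norm_eq_zero, ← sq_eq_zero_iff]
      refine (hasSum_norm_inner_sq (stdBasis (K r)) ((D.inc r i).adjoint x)).unique ?_
      convert hasSum_zero with k
      have h1 : ⟪D.inc r i (stdBasis (K r) k), x⟫_ℂ = 0 :=
        hx _ (Submodule.subset_span ⟨⟨⟨r, k⟩, i⟩, rfl⟩)
      rw [ContinuousLinearMap.adjoint_inner_right, h1]
      simp
    refine (D.hasSum_inc x).unique ?_
    convert hasSum_zero with y
    rw [h0, map_zero]

theorem basis_apply (x : Σ y : (Σ r : Dual G, BasisIndex K r), Fin y.1.dim) :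
    D.basis x = D.inc x.1.1 x.2 (stdBasis (K x.1.1) x.1.2) :=
  congrFun (HilbertBasis.coe_mkOfOrthogonalEqBot D.orthonormal_basisVec _) x

theorem isPositive_mult {a : H →L[ℂ] H} (ha : a.IsPositive) (r : Dual G) :
    (D.mult a r).IsPositive :=
  ContinuousLinearMap.isPositive_sum _ fun i _ => ha.adjoint_conj (D.inc r i)

/-- In the basis `|r, i⟩ ⊗ k`, summing over the innermost index `i` first produces the partial
trace. -/
theorem posTrace_eq_tsum_mult {a : H →L[ℂ] H} (ha : a.IsPositive) :
    posTrace a = ∑' r, posTrace (D.mult a r) := by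
  rw [posTrace_eq_tsum D.basis ha]
  simp_rw [basis_apply]
  rw [ENNReal.tsum_sigma (fun (y : Σ r : Dual G, BasisIndex K r) (i : Fin y.1.dim) =>
    ENNReal.ofReal (⟪D.inc y.1 i (stdBasis (K y.1) y.2),
      a (D.inc y.1 i (stdBasis (K y.1) y.2))⟫_ℂ).re),
    ENNReal.tsum_sigma (fun (r : Dual G) (k : BasisIndex K r) =>
    ∑' i : Fin r.dim, ENNReal.ofReal (⟪D.inc r i (stdBasis (K r) k),
      a (D.inc r i (stdBasis (K r) k))⟫_ℂ).re)]
  refine tsum_congr fun r => tsum_congr fun k => ?_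
  rw [inner_mult, tsum_fintype, Complex.re_sum, ENNReal.ofReal_sum_of_nonneg]
  intro i _
  exact (RCLike.nonneg_iff.1 (ha.inner_nonneg_right _)).1

theorem mult_eq_of_apply_inc {a : H →L[ℂ] H} {b : ∀ r, K r →L[ℂ] K r}
    (h : ∀ r i k, a (D.inc r i k) = D.inc r i (b r k)) (r : Dual G) :
    D.mult a r = (r.dim : ℂ) • b r := by
  ext l
  refine ext_inner_left ℂ fun k => ?_
  simp [inner_mult, h, inner_inc_inc, inner_smul_right]

section Density

variable {ρ : H →L[ℂ] H}

theorem tsum_prob (hρ : IsDensityOperator ρ) : ∑' r, D.prob ρ r = 1 := by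
  rw [← hρ.2, D.posTrace_eq_tsum_mult hρ.1]; rfl

theorem prob_le_one (hρ : IsDensityOperator ρ) (r : Dual G) : D.prob ρ r ≤ 1 := by
  rw [← D.tsum_prob hρ]; exact ENNReal.le_tsum r

theorem prob_ne_top (hρ : IsDensityOperator ρ) (r : Dual G) : D.prob ρ r ≠ ∞ :=
  ne_top_of_le_ne_top ENNReal.one_ne_top (D.prob_le_one hρ r)

theorem isDensityOperator_sectorState (hρ : IsDensityOperator ρ) (r : Dual G)
    (h : D.prob ρ r ≠ 0) : IsDensityOperator (D.sectorState ρ r) := by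
  have hp : 0 < (D.prob ρ r).toReal := ENNReal.toReal_pos h (D.prob_ne_top hρ r)
  refine ⟨?_, ?_⟩
  · refine (D.isPositive_mult hρ.1 r).smul_of_nonneg ?_
    rw [Complex.nonneg_iff]
    simp [hp.le]
  · rw [sectorState, posTrace_smul (inv_nonneg.2 hp.le), ENNReal.ofReal_inv_of_pos hp,
      ENNReal.ofReal_toReal (D.prob_ne_top hρ r)]
    exact ENNReal.inv_mul_cancel h (D.prob_ne_top hρ r)

/-- A positive operator of trace zero vanishes, so the default value `0` of the sector state is
consistent when `p_r = 0`. -/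
theorem mult_eq_smul_sectorState (hρ : IsDensityOperator ρ) (r : Dual G) :
    D.mult ρ r = ((D.prob ρ r).toReal : ℂ) • D.sectorState ρ r := by
  by_cases h : D.prob ρ r = 0
  · rw [eq_zero_of_posTrace_eq_zero (D.isPositive_mult hρ.1 r) h, h]
    simp
  · have hp : 0 < (D.prob ρ r).toReal := ENNReal.toReal_pos h (D.prob_ne_top hρ r)
    rw [sectorState, smul_smul, ← Complex.ofReal_mul, mul_inv_cancel₀ hp.ne', Complex.ofReal_one,
      one_smul]

theorem smul_mult_eq (hρ : IsDensityOperator ρ) (r : Dual G) :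
    (r.dim : ℂ)⁻¹ • D.mult ρ r =
      (((D.prob ρ r).toReal / r.dim : ℝ) : ℂ) • D.sectorState ρ r := by
  rw [D.mult_eq_smul_sectorState hρ, smul_smul]
  congr 1
  push_cast
  rw [div_eq_inv_mul]

end Density

end IsotypicDecomposition

/-- The entropy of a scaled density operator. -/
theorem posTrace_cfc_negMulLog_smul {F : Type*} [NormedAddCommGroup F] [InnerProductSpace ℂ F]
    [CompleteSpace F] {σ : F →L[ℂ] F} (hσ : IsDensityOperator σ) {t : ℝ} (h0 : 0 ≤ t)
    (h1 : t ≤ 1) :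
    posTrace (cfc Real.negMulLog ((t : ℂ) • σ)) =
      ENNReal.ofReal (Real.negMulLog t) + ENNReal.ofReal t * vonNeumannEntropy σ := by
  have hsa := hσ.1.isSelfAdjoint
  have hc := Real.continuous_negMulLog
  have h2 : cfc Real.negMulLog ((t : ℂ) • σ) =
      ((Real.negMulLog t : ℝ) : ℂ) • σ + (t : ℂ) • cfc Real.negMulLog σ := by
    rw [Complex.coe_smul, Complex.coe_smul, Complex.coe_smul,
      ← cfc_comp_const_mul t Real.negMulLog σ hc.continuousOn hsa]
    -- The rule `η(t x) = x η(t) + t η(x)` makes `η(t σ)` a combination of `σ`, whose trace is one,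
    -- and `η(σ)`.
    have h3 : (fun x => Real.negMulLog (t * x)) =
        fun x => Real.negMulLog t * x + t * Real.negMulLog x := by
      funext x
      rw [Real.negMulLog_mul, mul_comm x]
    rw [h3, cfc_add σ (fun x => Real.negMulLog t * x) (fun x => t * Real.negMulLog x)
      (by fun_prop) (by fun_prop), cfc_const_mul _ (fun x => x) σ, cfc_const_mul _ _ σ
      hc.continuousOn, cfc_id' ℝ σ hsa]
  have h6 : (cfc Real.negMulLog σ).IsPositive := by
    rw [← ContinuousLinearMap.nonneg_iff_isPositive]
    refine cfc_nonneg fun x hx => ?_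
    exact Real.negMulLog_nonneg (hσ.spectrum_subset hx).1 (hσ.spectrum_subset hx).2
  have h7 : 0 ≤ Real.negMulLog t := Real.negMulLog_nonneg h0 h1
  rw [h2, posTrace_add (hσ.1.smul_of_nonneg ?_) (h6.smul_of_nonneg ?_), posTrace_smul h7,
    posTrace_smul h0, hσ.2, mul_one]
  · rfl
  · rw [Complex.nonneg_iff]; simpa using h7
  · rw [Complex.nonneg_iff]; simpa using h0

/-! ### Entropy of twirled states and duality of the twirl. -/

namespace IsotypicDecomposition

variable {G : Type*} [Group G] [TopologicalSpace G]
  {H : Type*} [NormedAddCommGroup H] [InnerProductSpace ℂ H] [CompleteSpace H]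
  {U : UnitaryRep G H} {K : Dual G → Type*} [∀ r, NormedAddCommGroup (K r)]
  [∀ r, InnerProductSpace ℂ (K r)] [∀ r, CompleteSpace (K r)] (D : IsotypicDecomposition U K)
  [IsTopologicalGroup G] [CompactSpace G] [MeasurableSpace G] [BorelSpace G]
  {ρ : H →L[ℂ] H}

/-- The trace is determined by the partial traces, which the twirl leaves unchanged. -/
theorem _root_.LGT.UnitaryRep.isDensityOperator_twirl (U : UnitaryRep G H)
    (hρ : IsDensityOperator ρ) : IsDensityOperator (U.twirl ρ) := by
  let D := U.isotypicDecomposition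
  have hcomp (r : Dual G) : CompleteSpace (U.multSpace r) :=
    (U.isClosed_multSpace r).completeSpace_coe
  refine ⟨U.isPositive_twirl hρ.1, ?_⟩
  rw [D.posTrace_eq_tsum_mult (U.isPositive_twirl hρ.1), ← hρ.2, D.posTrace_eq_tsum_mult hρ.1]
  simp_rw [mult_twirl]

theorem isBlockSum_twirl_density (hρ : IsDensityOperator ρ) :
    D.IsBlockSum (U.twirl ρ)
      (fun r => (((D.prob ρ r).toReal / r.dim : ℝ) : ℂ) • D.sectorState ρ r) := by
  have h := D.isBlockSum_twirl ρ
  simp_rw [D.smul_mult_eq hρ] at h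
  exact h

/-- On sector `r` the functional calculus gives `1_r ⊗ η((p_r/d_r) ρ̂_r)`, and the trace over `H_r`
multiplies by `d_r`. The term `log d_r` arises from `d η(p/d) = η(p) + p log d`. -/
theorem vonNeumannEntropy_twirl (hρ : IsDensityOperator ρ) :
    vonNeumannEntropy (U.twirl ρ) =
      shannonEntropy (D.prob ρ) +
        ∑' r, D.prob ρ r *
          (ENNReal.ofReal (Real.log r.dim) + vonNeumannEntropy (D.sectorState ρ r)) := by
  have hω := U.isDensityOperator_twirl hρ
  have hpos : (cfc Real.negMulLog (U.twirl ρ)).IsPositive := by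
    rw [← ContinuousLinearMap.nonneg_iff_isPositive]
    refine cfc_nonneg fun x hx => ?_
    exact Real.negMulLog_nonneg (hω.spectrum_subset hx).1 (hω.spectrum_subset hx).2
  have hblock := D.isBlockSum_iff.1 (D.isBlockSum_twirl_density hρ)
  set c : ∀ r, K r →L[ℂ] K r :=
    fun r => (((D.prob ρ r).toReal / r.dim : ℝ) : ℂ) • D.sectorState ρ r with hc
  have hcsa (r : Dual G) : IsSelfAdjoint (c r) := by
    rw [hc]; dsimp only
    rw [← D.smul_mult_eq hρ]
    refine ((D.isPositive_mult hρ.1 r).smul_of_nonneg ?_).isSelfAdjoint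
    rw [← Complex.ofReal_natCast, ← Complex.ofReal_inv, Complex.nonneg_iff]
    simp
  have hcfc (r : Dual G) (i : Fin r.dim) (k : K r) :
      cfc Real.negMulLog (U.twirl ρ) (D.inc r i k) =
        D.inc r i (cfc Real.negMulLog (c r) k) := by
    have := cfc_comp_intertwine hω.1.isSelfAdjoint (hcsa r) (J := D.inc r i)
      (by ext k; exact hblock r i k) Real.continuous_negMulLog
    exact congrArg (fun q : K r →L[ℂ] H => q k) this
  unfold vonNeumannEntropy shannonEntropy
  rw [D.posTrace_eq_tsum_mult hpos, ← ENNReal.tsum_add]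
  refine tsum_congr fun r => ?_
  have hd : (0 : ℝ) < r.dim := by exact_mod_cast r.dim_pos
  have hd1 : (1 : ℝ) ≤ r.dim := by exact_mod_cast r.dim_pos
  rw [D.mult_eq_of_apply_inc hcfc, ← Complex.ofReal_natCast, posTrace_smul hd.le]
  -- An empty sector is treated apart, since its sector state is `0` and not a density operator;
  -- both sides then vanish.
  by_cases h : D.prob ρ r = 0
  · have : c r = 0 := by rw [hc]; simp [h]
    rw [this, cfc_apply_zero, h]
    simp [posTrace_zero]
  · have hp : 0 < (D.prob ρ r).toReal := ENNReal.toReal_pos h (D.prob_ne_top hρ r)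
    have hp1 : (D.prob ρ r).toReal ≤ 1 := by
      simpa using ENNReal.toReal_mono ENNReal.one_ne_top (D.prob_le_one hρ r)
    have hpt : D.prob ρ r = ENNReal.ofReal (D.prob ρ r).toReal :=
      (ENNReal.ofReal_toReal (D.prob_ne_top hρ r)).symm
    rw [hc]; dsimp only
    rw [posTrace_cfc_negMulLog_smul (D.isDensityOperator_sectorState hρ r h) (by positivity)
      (div_le_one_of_le₀ (hp1.trans hd1) hd.le), mul_add, ← mul_assoc, ← ENNReal.ofReal_mul hd.le,
      ← ENNReal.ofReal_mul hd.le, mul_div_cancel₀ _ hd.ne', ← hpt, mul_add, ← add_assoc]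
    congr 1
    have hlog : (r.dim : ℝ) * Real.negMulLog ((D.prob ρ r).toReal / r.dim) =
        Real.negMulLog (D.prob ρ r).toReal + (D.prob ρ r).toReal * Real.log r.dim := by
      rw [Real.negMulLog, Real.negMulLog, Real.log_div hp.ne' hd.ne']
      field_simp
      ring
    rw [hlog, ENNReal.ofReal_add (Real.negMulLog_nonneg hp.le hp1)
      (mul_nonneg hp.le (Real.log_nonneg hd1)), ENNReal.ofReal_mul hp.le, ← hpt]

/-- In the basis `|r, i⟩ ⊗ k`, the sum over `i` turns each side into `d_r⁻¹ ⟨k, ρ_r f_r k⟩` with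
`ρ_r`, `f_r` the partial traces. No interchange of the trace with the Haar integral is needed. -/
theorem trace_comp_twirl (D : IsotypicDecomposition U K) (hρ : IsDensityOperator ρ)
    (f : H →L[ℂ] H) : trace (ρ ∘L U.twirl f) = trace (U.twirl ρ ∘L f) := by
  have hf := D.isBlockSum_iff.1 (D.isBlockSum_twirl f)
  have hσ := D.isBlockSum_iff.1 (D.isBlockSum_twirl ρ)
  have hself (x y : H) : ⟪x, U.twirl ρ y⟫_ℂ = ⟪U.twirl ρ x, y⟫_ℂ :=
    ((U.isPositive_twirl hρ.1).isSelfAdjoint.isSymmetric x y).symm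
  have key (r : Dual G) (k : K r) : ∑ i, ⟪D.inc r i k, ρ (U.twirl f (D.inc r i k))⟫_ℂ =
      ∑ i, ⟪D.inc r i k, U.twirl ρ (f (D.inc r i k))⟫_ℂ := by
    have hmself (x y : K r) : ⟪D.mult ρ r x, y⟫_ℂ = ⟪x, D.mult ρ r y⟫_ℂ :=
      (D.isPositive_mult hρ.1 r).isSelfAdjoint.isSymmetric x y
    simp only [hself, hσ, hf]
    rw [← inner_mult, ← inner_mult, smul_apply, smul_apply, map_smul, inner_smul_right,
      inner_smul_left, hmself]
    simp
  have h1 := (hρ.hasSum_trace_basis D.basis (U.twirl f)).sigma fun y => hasSum_fintype _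
  have h2 := ((U.isDensityOperator_twirl hρ).hasSum_trace_basis D.basis f).sigma
    fun y => hasSum_fintype _
  refine h1.unique (h2.congr_fun fun y => ?_)
  simp only [basis_apply]
  convert key y.1 (stdBasis (K y.1) y.2)

end IsotypicDecomposition

/-- The twirl is self-dual with respect to the trace pairing. -/
theorem UnitaryRep.trace_comp_twirl {G : Type*} [Group G] [TopologicalSpace G]
    [IsTopologicalGroup G] [CompactSpace G] [MeasurableSpace G] [BorelSpace G]
    {H : Type*} [NormedAddCommGroup H] [InnerProductSpace ℂ H] [CompleteSpace H]
    (U : UnitaryRep G H) {ρ : H →L[ℂ] H} (hρ : IsDensityOperator ρ)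
    (f : H →L[ℂ] H) : trace (ρ ∘L U.twirl f) = trace (U.twirl ρ ∘L f) :=
  have (r : Dual G) : CompleteSpace (U.multSpace r) := (U.isClosed_multSpace r).completeSpace_coe
  U.isotypicDecomposition.trace_comp_twirl hρ f

/-! ### Square-integrable vector-valued functions as a tensor product -/

section VectorValued

variable {α : Type*} [MeasurableSpace α] {μ : Measure α}
  {F : Type*} [NormedAddCommGroup F] [InnerProductSpace ℂ F]
  {F' : Type*} [NormedAddCommGroup F'] [InnerProductSpace ℂ F']

theorem compLpL_comp {F'' : Type*} [NormedAddCommGroup F''] [InnerProductSpace ℂ F'']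
    (a : F' →L[ℂ] F'') (b : F →L[ℂ] F') (ψ : Lp F 2 μ) :
    (a ∘L b).compLpL 2 μ ψ = a.compLpL 2 μ (b.compLpL 2 μ ψ) := by
  refine Lp.ext ?_
  filter_upwards [(a ∘L b).coeFn_compLpL ψ, a.coeFn_compLpL (b.compLpL 2 μ ψ), b.coeFn_compLpL ψ]
    with y h1 h2 h3
  rw [h1, h2, h3]; rfl

theorem compLpL_one (ψ : Lp F 2 μ) : (1 : F →L[ℂ] F).compLpL 2 μ ψ = ψ := by
  refine Lp.ext ?_
  filter_upwards [(1 : F →L[ℂ] F).coeFn_compLpL ψ] with y h1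
  rw [h1]; rfl

theorem inner_compLpL [CompleteSpace F] (a : F →L[ℂ] F) (χ ψ : Lp F 2 μ) :
    ⟪a.compLpL 2 μ χ, ψ⟫_ℂ = ⟪χ, a.adjoint.compLpL 2 μ ψ⟫_ℂ := by
  rw [L2.inner_def, L2.inner_def]
  refine integral_congr_ae ?_
  filter_upwards [a.coeFn_compLpL χ, a.adjoint.coeFn_compLpL ψ] with y h1 h2
  rw [h1, h2, ContinuousLinearMap.adjoint_inner_right]

/-- The function `y ↦ f(y) x`. -/
def tensorFun (x : F) (f : Lp ℂ 2 μ) : Lp F 2 μ :=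
  (ContinuousLinearMap.toSpanSingleton ℂ x).compLpL 2 μ f

theorem coeFn_tensorFun (x : F) (f : Lp ℂ 2 μ) : tensorFun x f =ᵐ[μ] fun y => f y • x := by
  refine ((ContinuousLinearMap.toSpanSingleton ℂ x).coeFn_compLpL f).trans ?_
  filter_upwards with y
  rw [ContinuousLinearMap.toSpanSingleton_apply]

theorem inner_tensorFun (x x' : F) (f f' : Lp ℂ 2 μ) :
    ⟪tensorFun x f, tensorFun x' f'⟫_ℂ = ⟪f, f'⟫_ℂ * ⟪x, x'⟫_ℂ := by
  rw [L2.inner_def, L2.inner_def, ← integral_mul_const]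
  refine integral_congr_ae ?_
  filter_upwards [coeFn_tensorFun x f, coeFn_tensorFun x' f'] with y h1 h2
  rw [h1, h2, inner_smul_left, inner_smul_right, RCLike.inner_apply]
  ring

theorem norm_tensorFun (x : F) (f : Lp ℂ 2 μ) : ‖tensorFun x f‖ = ‖f‖ * ‖x‖ := by
  have h := inner_tensorFun x x f f
  rw [inner_self_eq_norm_sq_to_K, inner_self_eq_norm_sq_to_K, inner_self_eq_norm_sq_to_K] at h
  norm_cast at h
  rwa [← mul_pow, sq_eq_sq₀ (norm_nonneg _) (by positivity)] at h

theorem compLpL_tensorFun (a : F →L[ℂ] F') (x : F) (f : Lp ℂ 2 μ) :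
    a.compLpL 2 μ (tensorFun x f) = tensorFun (a x) f := by
  refine Lp.ext ?_
  filter_upwards [a.coeFn_compLpL (tensorFun x f), coeFn_tensorFun x f, coeFn_tensorFun (a x) f]
    with y h1 h2 h3
  rw [h1, h2, h3, map_smul]

/-- The operator `x ↦ f ⊗ x`. -/
def tensorLeft (f : Lp ℂ 2 μ) : F →L[ℂ] Lp F 2 μ :=
  LinearMap.mkContinuous
    { toFun := fun x => tensorFun x f
      map_add' := fun x y => by
        refine Lp.ext ?_
        filter_upwards [coeFn_tensorFun (x + y) f, coeFn_tensorFun x f, coeFn_tensorFun y f,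
          Lp.coeFn_add (tensorFun x f) (tensorFun y f)] with t h1 h2 h3 h4
        rw [h1, h4, Pi.add_apply, h2, h3, smul_add]
      map_smul' := fun c x => by
        refine Lp.ext ?_
        filter_upwards [coeFn_tensorFun (c • x) f, coeFn_tensorFun x f,
          Lp.coeFn_smul c (tensorFun x f)] with t h1 h2 h3
        rw [h1, RingHom.id_apply, h3, Pi.smul_apply, h2, smul_comm] }
    ‖f‖ fun x => (norm_tensorFun x f).le

@[simp] theorem tensorLeft_apply (f : Lp ℂ 2 μ) (x : F) : tensorLeft f x = tensorFun x f := rfl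

/-- The isometry `x ↦ f ⊗ x` for a unit vector `f`. -/
def tensorLeftₗᵢ (f : Lp ℂ 2 μ) (hf : ‖f‖ = 1) : F →ₗᵢ[ℂ] Lp F 2 μ where
  toLinearMap := (tensorLeft f : F →L[ℂ] Lp F 2 μ).toLinearMap
  norm_map' x := by
    change ‖tensorFun x f‖ = ‖x‖
    rw [norm_tensorFun, hf, one_mul]

/-- The elementary tensors are total. -/
theorem mem_of_tensorFun_mem {M : Submodule ℂ (Lp F 2 μ)} (hM : IsClosed (M : Set (Lp F 2 μ)))
    (h : ∀ x f, tensorFun x f ∈ M) (ψ : Lp F 2 μ) : ψ ∈ M := by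
  refine Lp.induction (by norm_num) (fun ψ => ψ ∈ M) (fun c s hs hμs => ?_)
    (fun f g hf hg _ hfM hgM => M.add_mem hfM hgM) hM ψ
  convert h c (indicatorConstLp 2 hs hμs.ne 1)
  rw [Lp.simpleFunc.coe_indicatorConst]
  refine Lp.ext ?_
  filter_upwards [indicatorConstLp_coeFn (p := 2) (hs := hs) (hμs := hμs.ne) (c := c),
    coeFn_tensorFun c (indicatorConstLp 2 hs hμs.ne 1),
    indicatorConstLp_coeFn (p := 2) (hs := hs) (hμs := hμs.ne) (c := (1 : ℂ))] with y h1 h2 h3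
  rw [h1, h2, h3]
  by_cases hy : y ∈ s <;> simp [hy]

theorem clm_ext_tensorFun {E : Type*} [NormedAddCommGroup E] [NormedSpace ℂ E]
    {A B : Lp F 2 μ →L[ℂ] E} (h : ∀ x f, A (tensorFun x f) = B (tensorFun x f)) : A = B := by
  ext1 ψ
  refine mem_of_tensorFun_mem (M := LinearMap.eqLocus A.toLinearMap B.toLinearMap) ?_ h ψ
  exact isClosed_eq A.continuous B.continuous

theorem isHilbertSum_tensorLeft [CompleteSpace F] {ι : Type*} (e : HilbertBasis ι ℂ (Lp ℂ 2 μ)) :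
    IsHilbertSum ℂ (fun _ : ι => F) fun j => tensorLeftₗᵢ (e j) (e.orthonormal.1 j) := by
  refine IsHilbertSum.mk (fun i j hij x y => ?_) ?_
  · change ⟪tensorFun x (e i), tensorFun y (e j)⟫_ℂ = 0
    rw [inner_tensorFun, e.orthonormal.2 hij, zero_mul]
  · rw [top_le_iff, Submodule.topologicalClosure_eq_top_iff, Submodule.eq_bot_iff]
    intro ψ hψ
    rw [← Submodule.iInf_orthogonal, Submodule.mem_iInf] at hψ
    have h0 (j : ι) (x : F) : ⟪ψ, tensorFun x (e j)⟫_ℂ = 0 :=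
      (Submodule.mem_orthogonal' _ _).1 (hψ j) _ ⟨x, rfl⟩
    have h1 : innerSL ℂ ψ = 0 := by
      refine clm_ext_tensorFun fun x f => ?_
      have h2 := (e.hasSum_repr f).mapL
        (innerSL ℂ ψ ∘L (ContinuousLinearMap.toSpanSingleton ℂ x).compLpL 2 μ)
      refine h2.unique ?_
      rw [zero_apply]
      convert hasSum_zero with j
      rw [map_smul]
      exact (congrArg _ (h0 j x)).trans (smul_zero _)
    rw [← inner_self_eq_zero (𝕜 := ℂ), ← innerSL_apply_apply ℂ, h1]
    rfl

variable [CompleteSpace F]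

theorem adjoint_tensorLeft_compLpL (f : Lp ℂ 2 μ) (a : F →L[ℂ] F) (ψ : Lp F 2 μ) :
    (tensorLeft f).adjoint (a.compLpL 2 μ ψ) = a ((tensorLeft f).adjoint ψ) := by
  refine ext_inner_left ℂ fun x => ?_
  rw [ContinuousLinearMap.adjoint_inner_right, ← ContinuousLinearMap.adjoint_inner_left a,
    ContinuousLinearMap.adjoint_inner_right, tensorLeft_apply, tensorLeft_apply,
    ← compLpL_tensorFun, inner_compLpL, ContinuousLinearMap.adjoint_adjoint]

theorem hasSum_tensorLeft {ι : Type*} (e : HilbertBasis ι ℂ (Lp ℂ 2 μ)) (ψ : Lp F 2 μ) :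
    HasSum (fun j => tensorLeft (e j) ((tensorLeft (e j)).adjoint ψ)) ψ :=
  IsHilbertSum.hasSum_adjoint (isHilbertSum_tensorLeft (F := F) e) ψ

/-- The expectation value of `a ⊗ 1`. -/
theorem hasSum_inner_compLpL {ι : Type*} (e : HilbertBasis ι ℂ (Lp ℂ 2 μ)) (a : F →L[ℂ] F)
    (χ ψ : Lp F 2 μ) :
    HasSum (fun j => ⟪(tensorLeft (e j)).adjoint χ, a ((tensorLeft (e j)).adjoint ψ)⟫_ℂ)
      ⟪χ, a.compLpL 2 μ ψ⟫_ℂ := by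
  have h := (hasSum_tensorLeft e (a.compLpL 2 μ ψ)).mapL (innerSL ℂ χ)
  simp only [adjoint_tensorLeft_compLpL, innerSL_apply_apply] at h
  simpa only [ContinuousLinearMap.adjoint_inner_left] using h

end VectorValued

/-- The representation `U ⊗ 1` on vector-valued functions. -/
def UnitaryRep.amplify {α : Type*} [MeasurableSpace α] (μ : Measure α)
    {F : Type*} [NormedAddCommGroup F] [InnerProductSpace ℂ F] {N : Type*} [Group N]
    [TopologicalSpace N] (U : UnitaryRep N F) : UnitaryRep N (Lp F 2 μ) where
  toHom :=
    { toFun := fun g =>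
        { toFun := (U.op g).compLpL 2 μ
          invFun := (U.op g⁻¹).compLpL 2 μ
          left_inv := fun ψ => by
            rw [← compLpL_comp, show U.op g⁻¹ ∘L U.op g = 1 by ext x; simp, compLpL_one]
          right_inv := fun ψ => by
            rw [← compLpL_comp, show U.op g ∘L U.op g⁻¹ = 1 by ext x; simp, compLpL_one]
          map_add' := map_add _
          map_smul' := map_smul _
          norm_map' := fun ψ => by
            change ‖(U.op g).compLpL 2 μ ψ‖ = ‖ψ‖
            refine le_antisymm ?_ ?_ <;> refine Lp.norm_le_norm_of_ae_le ?_ <;>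
            filter_upwards [(U.op g).coeFn_compLpL ψ] with y h1 <;>
            rw [h1, op_apply, LinearIsometryEquiv.norm_map] }
      map_one' := by
        ext1 ψ
        change (U.op 1).compLpL 2 μ ψ = ψ
        rw [show U.op 1 = 1 by ext x; simp, compLpL_one]
      map_mul' := fun g h => by
        ext1 ψ
        change (U.op (g * h)).compLpL 2 μ ψ = (U.op g).compLpL 2 μ ((U.op h).compLpL 2 μ ψ)
        rw [← compLpL_comp, show U.op (g * h) = U.op g ∘L U.op h by ext x; simp] }
  continuous_apply ψ := by
    -- Vectors with continuous orbit form a subspace that is closed, because isometries make the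
    -- approximation uniform in `g`; it contains the elementary tensors, which are total.
    let M : Submodule ℂ (Lp F 2 μ) :=
      { carrier := {ψ | Continuous fun g => (U.op g).compLpL 2 μ ψ}
        zero_mem' := by simpa using continuous_const
        add_mem' := fun {ψ χ} hψ hχ => by
          simp only [Set.mem_ofPred_eq, map_add] at hψ hχ ⊢
          exact hψ.add hχ
        smul_mem' := fun c ψ hψ => by
          simp only [Set.mem_ofPred_eq, map_smul] at hψ ⊢
          exact hψ.const_smul c }
    have hnorm (g : N) (ψ : Lp F 2 μ) : ‖(U.op g).compLpL 2 μ ψ‖ ≤ ‖ψ‖ := by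
      refine Lp.norm_le_norm_of_ae_le ?_
      filter_upwards [(U.op g).coeFn_compLpL ψ] with y h1
      rw [h1, op_apply, LinearIsometryEquiv.norm_map]
    refine mem_of_tensorFun_mem (M := M) ?_ (fun x f => ?_) ψ
    · refine isClosed_of_closure_subset fun ψ hψ => ?_
      refine continuous_of_uniform_approx_of_continuous fun u hu => ?_
      obtain ⟨ε, hε, hεu⟩ := Metric.mem_uniformity_dist.1 hu
      obtain ⟨χ, hχ, hd⟩ := Metric.mem_closure_iff.1 hψ ε hε
      refine ⟨fun g => (U.op g).compLpL 2 μ χ, hχ, fun g => hεu ?_⟩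
      change dist ((U.op g).compLpL 2 μ ψ) ((U.op g).compLpL 2 μ χ) < ε
      rw [dist_eq_norm, ← map_sub]
      rw [dist_eq_norm] at hd
      exact (hnorm g _).trans_lt hd
    · change Continuous fun g => (U.op g).compLpL 2 μ (tensorFun x f)
      simp only [compLpL_tensorFun]
      exact (tensorLeft f : F →L[ℂ] Lp F 2 μ).continuous.comp (U.continuous_apply x)

theorem UnitaryRep.amplify_apply {α : Type*} [MeasurableSpace α] {μ : Measure α}
    {F : Type*} [NormedAddCommGroup F] [InnerProductSpace ℂ F] {N : Type*} [Group N]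
    [TopologicalSpace N] (U : UnitaryRep N F) (g : N) (ψ : Lp F 2 μ) :
    (U.amplify μ).toHom g ψ = (U.op g).compLpL 2 μ ψ := rfl

/-- On an elementary tensor, the bounded map `x ↦ f ⊗ x` passes through the integral. -/
theorem UnitaryRep.twirl_amplify {α : Type*} [MeasurableSpace α] {μ : Measure α}
    {F : Type*} [NormedAddCommGroup F] [InnerProductSpace ℂ F] [CompleteSpace F] {N : Type*}
    [Group N] [TopologicalSpace N] [IsTopologicalGroup N] [CompactSpace N] [MeasurableSpace N]
    [BorelSpace N] (U : UnitaryRep N F) (a : F →L[ℂ] F) :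
    (U.amplify μ).twirl (a.compLpL 2 μ) = (U.twirl a).compLpL 2 μ := by
  refine clm_ext_tensorFun fun x f => ?_
  have h := (tensorLeft f : F →L[ℂ] Lp F 2 μ).integral_comp_comm (U.integrable_conj a x)
  rw [compLpL_tensorFun, ← tensorLeft_apply f (U.twirl a x), twirl_apply, twirl_apply, ← h]
  refine integral_congr_ae (.of_forall fun g => ?_)
  simp only [amplify_apply, tensorLeft_apply, compLpL_tensorFun, op_apply]

/-! ### Translations and fibrewise representations -/

section Fiberwise

variable {P : Type*} [Group P] [TopologicalSpace P] [IsTopologicalGroup P] [CompactSpace P]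
  [MeasurableSpace P] [BorelSpace P]
  {F : Type*} [NormedAddCommGroup F] [InnerProductSpace ℂ F]
  {N : Type*} [Group N] [TopologicalSpace N] [TopologicalSpace.PseudoMetrizableSpace N]
  [SecondCountableTopology N] (U : UnitaryRep N F)

theorem coeFn_fiberwise (k : C(P, N)) (ψ : Lp F 2 (haarProb P)) :
    fiberwise U k ψ =ᵐ[haarProb P] fun y => U.toHom (k y) (ψ y) :=
  (memLp_fiberwise U k ψ).coeFn_toLp

theorem fiberwise_fiberwise_inv (k k' : C(P, N)) (hk : ∀ y, k y * k' y = 1)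
    (ψ : Lp F 2 (haarProb P)) : fiberwise U k (fiberwise U k' ψ) = ψ := by
  refine Lp.ext ?_
  filter_upwards [coeFn_fiberwise U k (fiberwise U k' ψ), coeFn_fiberwise U k' ψ] with y h1 h2
  rw [h1, h2, ← UnitaryRep.toHom_mul_apply, hk, UnitaryRep.toHom_one_apply]

theorem inner_fiberwise (k k' : C(P, N)) (hk : ∀ y, k y * k' y = 1)
    (χ ψ : Lp F 2 (haarProb P)) : ⟪fiberwise U k χ, ψ⟫_ℂ = ⟪χ, fiberwise U k' ψ⟫_ℂ := by
  conv_lhs => rw [← fiberwise_fiberwise_inv U k k' hk ψ, LinearIsometry.inner_map_map]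

theorem fiberwise_compLpL (k : C(P, N)) {a : F →L[ℂ] F}
    (ha : ∀ g x, U.toHom g (a x) = a (U.toHom g x)) (ψ : Lp F 2 (haarProb P)) :
    fiberwise U k (a.compLpL 2 (haarProb P) ψ) = a.compLpL 2 (haarProb P) (fiberwise U k ψ) := by
  refine Lp.ext ?_
  filter_upwards [coeFn_fiberwise U k (a.compLpL 2 (haarProb P) ψ), a.coeFn_compLpL ψ,
    a.coeFn_compLpL (fiberwise U k ψ), coeFn_fiberwise U k ψ] with y h1 h2 h3 h4
  rw [h1, h2, h3, h4, ha]

/-- Covariance of the fibrewise representation under translations. -/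
theorem lrLin_fiberwise (k : C(P, N)) (p : P × P) (n m : N)
    (hk : ∀ y, k (lrMap p y) = n * k y * m) (ψ : Lp F 2 (haarProb P)) :
    lrLin p (fiberwise U k ψ) =
      (U.op n).compLpL 2 (haarProb P)
        (fiberwise U k ((U.op m).compLpL 2 (haarProb P) (lrLin p ψ))) := by
  refine Lp.ext ?_
  filter_upwards [lrLin_coeFn p (fiberwise U k ψ),
    (measurePreserving_lrMap p).quasiMeasurePreserving.ae (coeFn_fiberwise U k ψ),
    (U.op n).coeFn_compLpL (fiberwise U k ((U.op m).compLpL 2 (haarProb P) (lrLin p ψ))),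
    coeFn_fiberwise U k ((U.op m).compLpL 2 (haarProb P) (lrLin p ψ)),
    (U.op m).coeFn_compLpL (lrLin p ψ), lrLin_coeFn p ψ] with y h1 h2 h3 h4 h5 h6
  rw [h1, Function.comp_apply, h2, h3, h4, h5, h6, hk]
  simp

theorem compLpL_const (a : F →L[ℂ] F) (x : F) :
    a.compLpL 2 (haarProb P) (Lp.const 2 (haarProb P) x) = Lp.const 2 (haarProb P) (a x) := by
  refine Lp.ext ?_
  filter_upwards [a.coeFn_compLpL (Lp.const 2 (haarProb P) x), Lp.coeFn_const 2 (haarProb P) x,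
    Lp.coeFn_const 2 (haarProb P) (a x)] with y h1 h2 h3
  rw [h1, h2, h3]; rfl

theorem lrLin_const (p : P × P) (x : F) :
    lrLin p (Lp.const 2 (haarProb P) x) = Lp.const 2 (haarProb P) x := by
  refine Lp.ext ?_
  filter_upwards [lrLin_coeFn p (Lp.const 2 (haarProb P) x),
    (measurePreserving_lrMap p).quasiMeasurePreserving.ae (Lp.coeFn_const 2 (haarProb P) x),
    Lp.coeFn_const 2 (haarProb P) x] with y h1 h2 h3
  rw [h1, Function.comp_apply, h2, h3]; rfl

theorem inner_const (x y : F) :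
    ⟪Lp.const 2 (haarProb P) x, Lp.const 2 (haarProb P) y⟫_ℂ = ⟪x, y⟫_ℂ := by
  rw [L2.inner_def]
  have h : (fun t => ⟪Lp.const 2 (haarProb P) x t, Lp.const 2 (haarProb P) y t⟫_ℂ)
      =ᵐ[haarProb P] fun _ => ⟪x, y⟫_ℂ := by
    filter_upwards [Lp.coeFn_const 2 (haarProb P) x, Lp.coeFn_const 2 (haarProb P) y] with t h1 h2
    rw [h1, h2]; rfl
  rw [integral_congr_ae h]
  simp

end Fiberwise

/-! ### Existence of induced states -/

theorem UnitaryRep.inner_toHom_right {N : Type*} [Group N] [TopologicalSpace N] {H : Type*}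
    [NormedAddCommGroup H] [InnerProductSpace ℂ H] (U : UnitaryRep N H) (g : N) (x y : H) :
    ⟪x, U.toHom g y⟫_ℂ = ⟪U.toHom g⁻¹ x, y⟫_ℂ := by
  rw [U.inner_toHom_left, inv_inv]

theorem reCLM_inner_one_apply {H : Type*} [NormedAddCommGroup H] [InnerProductSpace ℂ H] (y : H) :
    Complex.reCLM ⟪y, (1 : H →L[ℂ] H) y⟫_ℂ = ‖y‖ ^ 2 := by
  rw [one_apply_eq_self, inner_self_eq_norm_sq_to_K]
  change (((‖y‖ : ℝ) : ℂ) ^ 2).re = _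
  rw [← Complex.ofReal_pow, Complex.ofReal_re]

/-- A unital map `O(f) = ∑ Q_j† f Q_j` pulls density operators back to density operators. -/
theorem IsDensityOperator.exists_pullback {H : Type*} [NormedAddCommGroup H]
    [InnerProductSpace ℂ H] [CompleteSpace H] {H' : Type*} [NormedAddCommGroup H']
    [InnerProductSpace ℂ H'] [CompleteSpace H'] {ι : Type*} {ρ : H →L[ℂ] H}
    (hρ : IsDensityOperator ρ) (Q : ι → H →L[ℂ] H') (O : (H' →L[ℂ] H') → H →L[ℂ] H)
    (hO : ∀ f v, HasSum (fun j => ⟪Q j v, f (Q j v)⟫_ℂ) ⟪v, O f v⟫_ℂ) (h1 : O 1 = 1) :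
    ∃ σ, IsDensityOperator σ ∧ ∀ f, trace (ρ ∘L O f) = trace (σ ∘L f) := by
  obtain ⟨v, hv, hv1⟩ := hρ.exists_isEnsemble
  -- Unitality says `∑ Q_j† Q_j = 1`, so the ensemble of all `Q_j v_n` keeps total weight one; it
  -- defines the pulled-back state.
  have hn (x : H) : HasSum (fun j => ‖Q j x‖ ^ 2) (‖x‖ ^ 2) := by
    have h := (hO 1 x).mapL Complex.reCLM
    rw [h1] at h
    simpa only [reCLM_inner_one_apply] using h
  have hs : Summable fun p : (exists_hilbertBasis ℂ H).choose × ι => ‖Q p.2 (v p.1)‖ ^ 2 := by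
    rw [summable_prod_of_nonneg (fun _ => by positivity)]
    refine ⟨fun n => (hn (v n)).summable, ?_⟩
    simpa only [(hn (v _)).tsum_eq] using hv.summable
  obtain ⟨σ, hσ⟩ := LGT.exists_isEnsemble hs
  refine ⟨σ, hσ.isDensityOperator ?_, fun f => ?_⟩
  · rw [← hv1]
    exact ((hs.hasSum.prod_fiberwise fun n => hn (v n)).tsum_eq).symm
  · exact (hv.hasSum_trace (O f)).unique
      ((hσ.hasSum_trace f).prod_fiberwise fun n => hO f (v n))

/-! ### Holonomies -/

theorem holonomy_congr {X G : Type*} [Group G] {l : List (X × Bool)} {y z : X → G}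
    (h : ∀ s ∈ l, y s.1 = z s.1) : holonomy l y = holonomy l z := by
  induction l with
  | nil => rfl
  | cons s l ih =>
    rw [holonomy, holonomy, ih fun t ht => h t (List.mem_cons_of_mem _ ht),
      h s List.mem_cons_self]

/-- Gauge covariance of Wilson lines. -/
theorem holonomy_gauge {V E : Type*} (L : Lattice V E) {X : Set E} {G : Type*} [Group G]
    (h : V → G) (y : X → G) {a b : V} {l : List (X × Bool)}
    (hl : L.IsPath a (l.map fun s => (s.1.1, s.2)) b) :
    holonomy l (lrMap (gaugeHom L G X h) y) = (h b)⁻¹ * holonomy l y * h a := by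
  induction l generalizing a with
  | nil =>
    have hab : a = b := hl
    simp [holonomy, hab]
  | cons s l ih =>
    obtain ⟨h1, h2⟩ := hl
    rw [holonomy, holonomy, ih h2, ← h1]
    obtain ⟨e, d⟩ := s
    cases d
    · simp [lrMap, gaugeHom, Lattice.stepSrc, Lattice.stepTgt, mul_assoc]
    · simp [lrMap, gaugeHom, Lattice.stepSrc, Lattice.stepTgt, mul_assoc]

theorem extendOne_apply {V G : Type*} [Group G] {A : Set V} (h : A → G) (v : A) :
    extendOne G A h v = h v := Subtype.val_injective.extend_apply h 1 v

theorem extendOne_restrict {V G : Type*} [Group G] {A B : Set V} (hAB : A ⊆ B) (h : A → G) :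
    (extendOne G B fun v => extendOne G A h v) = extendOne G A h := by
  funext v
  by_cases hv : v ∈ B
  · exact extendOne_apply _ (⟨v, hv⟩ : B)
  · rw [extendOne_of_notMem _ hv, extendOne_of_notMem _ fun h => hv (hAB h)]

namespace ExtrinsicFrame

variable {V E : Type*} {L : Lattice V E} {R : Region L} (Φ : ExtrinsicFrame R)
  {G : Type*} [Group G]

theorem firstEdgeHom_eq_one {d : Bool} (k : R.corner → G) {e : (R.edgesᶜ : Set E)}
    (h : ∀ v, (Φ.line v).head? ≠ some (e, d)) : Φ.firstEdgeHom G d k e = 1 :=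
  dif_neg fun ⟨v, hv⟩ => h v hv

theorem eq_of_mem_line {v w : R.corner} {s t : (R.edgesᶜ : Set E) × Bool} (hs : s ∈ Φ.line v)
    (ht : t ∈ Φ.line w) (hst : s.1 = t.1) : v = w := by
  by_contra hne
  exact Φ.disjoint v w hne (List.mem_map_of_mem hs) (by
    rw [hst]; exact List.mem_map_of_mem ht)

theorem firstEdgeHom_head {v : R.corner} {s : (R.edgesᶜ : Set E) × Bool}
    (hs : (Φ.line v).head? = some s) (k : R.corner → G) :
    Φ.firstEdgeHom G s.2 k s.1 = k v := by
  have hex : ∃ w, (Φ.line w).head? = some (s.1, s.2) := ⟨v, hs⟩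
  -- Distinct lines share no edge, so the vertex picked by choice is `v`.
  refine (dif_pos hex).trans (congrArg k ?_)
  exact Φ.eq_of_mem_line (List.mem_of_head? hex.choose_spec) (List.mem_of_head? hs) rfl

theorem firstEdgeHom_head_not {v : R.corner} {s : (R.edgesᶜ : Set E) × Bool}
    (hs : (Φ.line v).head? = some s) (k : R.corner → G) :
    Φ.firstEdgeHom G (!s.2) k s.1 = 1 := by
  refine Φ.firstEdgeHom_eq_one k fun w hw => ?_
  obtain rfl := Φ.eq_of_mem_line (List.mem_of_head? hw) (List.mem_of_head? hs) rfl
  rw [hs, Option.some.injEq] at hw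
  have := congrArg Prod.snd hw
  simp at this

theorem firstEdgeHom_tail {v : R.corner} {s t : (R.edgesᶜ : Set E) × Bool}
    {l : List ((R.edgesᶜ : Set E) × Bool)} (hl : Φ.line v = s :: l) (ht : t ∈ l) (d : Bool)
    (k : R.corner → G) : Φ.firstEdgeHom G d k t.1 = 1 := by
  refine Φ.firstEdgeHom_eq_one k fun w hw => ?_
  have htv : t ∈ Φ.line v := by rw [hl]; exact List.mem_cons_of_mem _ ht
  obtain rfl := Φ.eq_of_mem_line (List.mem_of_head? hw) htv rfl
  rw [hl, List.head?_cons, Option.some.injEq] at hw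
  have hnd := Φ.nodup w
  rw [hl, List.map_cons, List.nodup_cons] at hnd
  refine hnd.1 ?_
  have hst : s.1 = t.1 := by rw [hw]
  rw [hst]
  exact List.mem_map_of_mem ht

/-- A reorientation multiplies the frame orientation from the right. -/
theorem holonomy_reorient (k : R.corner → G) (y : (R.edgesᶜ : Set E) → G) (v : R.corner) :
    holonomy (Φ.line v) (lrMap (Φ.reorientHom G k) y) = holonomy (Φ.line v) y * k v := by
  have hy (e) : lrMap (Φ.reorientHom G k) y e =
      (Φ.firstEdgeHom G false k e)⁻¹ * y e * Φ.firstEdgeHom G true k e := rfl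
  cases hl : Φ.line v with
  | nil =>
    -- An empty line would identify the anchor, on the boundary, with a corner vertex, off the
    -- boundary.
    have hp := Φ.isPath v
    rw [hl] at hp
    have hp' : Φ.anchor v = v := hp
    exact absurd (hp' ▸ Φ.anchor_mem v) (Set.disjoint_left.1 R.disjoint_corner_boundary v.2)
  | cons s l =>
    have hs : (Φ.line v).head? = some s := by rw [hl]; rfl
    have h1 := Φ.firstEdgeHom_head hs k
    have h2 := Φ.firstEdgeHom_head_not hs k
    -- Edges after the first are untouched because no edge repeats; on the first edge only the
    -- translation on the anchor side is non-trivial.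
    rw [holonomy, holonomy, holonomy_congr (z := y) fun t ht => by
      rw [hy, Φ.firstEdgeHom_tail hl ht, Φ.firstEdgeHom_tail hl ht, inv_one, one_mul, mul_one], hy]
    obtain ⟨e, d⟩ := s
    cases d
    · simp only [Bool.not_false] at h1 h2
      rw [h1, h2]
      simp [mul_assoc]
    · simp only [Bool.not_true] at h1 h2
      rw [h1, h2]
      simp [mul_assoc]

end ExtrinsicFrame

/-! ### The physical subspaces -/

section Gauge

variable {V E : Type*} [Finite V] [Finite E] {L : Lattice V E} (R : Region L)
  {G : Type*} [Group G] [TopologicalSpace G] [IsTopologicalGroup G] [CompactSpace G]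
  [T2Space G] [SecondCountableTopology G] [MeasurableSpace G] [BorelSpace G]

/-! ### Gauss laws and their effect on regional operators. -/

namespace Region

theorem extendOp_eq (f : R.physSpace G →L[ℂ] R.physSpace G) :
    R.extendOp G f = (R.physSpace G).subtypeL ∘L f ∘L (R.physSpace G).subtypeL.adjoint := by
  rw [Submodule.adjoint_subtypeL]; rfl

theorem compress_eq (a : R.KinSpace G →L[ℂ] R.KinSpace G) :
    R.compress G a =
      (R.globalPhysSpace G).subtypeL.adjoint ∘L a ∘L (R.globalPhysSpace G).subtypeL := by
  rw [Submodule.adjoint_subtypeL]; rfl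

theorem inner_compress (a : R.KinSpace G →L[ℂ] R.KinSpace G) (χ ψ : R.globalPhysSpace G) :
    ⟪χ, R.compress G a ψ⟫_ℂ = ⟪(χ : R.KinSpace G), a ψ⟫_ℂ := by
  rw [compress_eq, ContinuousLinearMap.comp_apply, ContinuousLinearMap.adjoint_inner_right]
  rfl

theorem extendOp_one_apply {x : LinkSpace G R.edges} (hx : x ∈ R.physSpace G) :
    R.extendOp G 1 x = x := by
  change (((R.physSpace G).orthogonalProjectionOnto x : R.physSpace G) : LinkSpace G R.edges) = x
  exact Submodule.starProjection_eq_self_iff.2 hx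

theorem extendOp_one_mem (x : LinkSpace G R.edges) : R.extendOp G 1 x ∈ R.physSpace G :=
  ((R.physSpace G).orthogonalProjectionOnto x).2

theorem projection_cornerRepLinks (k : R.corner → G) (x : LinkSpace G R.edges) :
    (R.physSpace G).subtypeL.adjoint ((R.cornerRepLinks G).toHom k x) =
      (R.cornerRep G).toHom k ((R.physSpace G).subtypeL.adjoint x) := by
  refine ext_inner_left ℂ fun y => ?_
  rw [ContinuousLinearMap.adjoint_inner_right, ← inv_inv k, ← UnitaryRep.inner_toHom_left,
    ← UnitaryRep.inner_toHom_left, ContinuousLinearMap.adjoint_inner_right]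
  rfl

/-- The twirl over the corner commutes with extension by zero. -/
theorem twirl_extendOp (f : R.physSpace G →L[ℂ] R.physSpace G) :
    (R.cornerRepLinks G).twirl (R.extendOp G f) = R.extendOp G ((R.cornerRep G).twirl f) := by
  rw [extendOp_eq, extendOp_eq]
  refine UnitaryRep.twirl_conj _ _ _ _ _ fun k x => ?_
  rw [projection_cornerRepLinks]
  rfl

theorem extendOne_inner_apply (h : V → G) {v : V} (hv : v ∈ R.inner ∪ R.corner) :
    (extendOne G R.corner (fun v => h v) * extendOne G R.inner (fun v => h v)) v = h v := by
  rw [Pi.mul_apply]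
  rcases hv with hv | hv
  · rw [extendOne_of_notMem _ (Set.disjoint_left.1 R.disjoint_inner_corner hv), one_mul]
    exact extendOne_apply _ (⟨v, hv⟩ : R.inner)
  · rw [extendOne_of_notMem (A := R.inner) _ (Set.disjoint_right.1 R.disjoint_inner_corner hv),
      mul_one]
    exact extendOne_apply _ (⟨v, hv⟩ : R.corner)

/-- On the regional physical space only the corner gauge transformations act. -/
theorem gaugeRep_apply_of_mem (h : V → G) {x : LinkSpace G R.edges} (hx : x ∈ R.physSpace G) :
    (R.gaugeRep G).toHom h x = (R.cornerRepLinks G).toHom (fun v => h v) x := by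
  -- Edges of `Σ` see `h` only at interior and corner vertices, and the interior factor fixes `x`.
  have h1 : gaugeHom L G R.edges h = gaugeHom L G R.edges
      (extendOne G R.corner (fun v => h v) * extendOne G R.inner (fun v => h v)) :=
    Prod.ext (funext fun e => (R.extendOne_inner_apply h (R.tgt_mem e e.2)).symm)
      (funext fun e => (R.extendOne_inner_apply h (R.src_mem e e.2)).symm)
  have h2 : (R.gaugeRep G).toHom h x = (R.gaugeRep G).toHom
      (extendOne G R.corner (fun v => h v) * extendOne G R.inner (fun v => h v)) x :=
    congrArg (fun p => (biregular (R.edges → G) ℂ).toHom p x) h1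
  rw [h2, UnitaryRep.toHom_mul_apply]
  exact congrArg _ (hx fun v => h v)

theorem gaugeOp_apply (h : V → G) (ψ : R.KinSpace G) :
    R.gaugeOp G h ψ = R.ampliation G ((R.gaugeRep G).op h) (lrLin (gaugeHom L G R.edgesᶜ h) ψ) :=
  rfl

theorem gaugeOp_of_mem {A : Set V} (hA : A ⊆ L.boundaryᶜ) (h : A → G) {ψ : R.KinSpace G}
    (hψ : ψ ∈ R.globalPhysSpace G) : R.gaugeOp G (extendOne G A h) ψ = ψ := by
  rw [← extendOne_restrict hA h]
  exact hψ _

theorem ampliation_inner_of_mem (h : R.inner → G) {ψ : R.KinSpace G}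
    (hψ : ψ ∈ R.globalPhysSpace G) :
    R.ampliation G ((R.gaugeRep G).op (extendOne G R.inner h)) ψ = ψ := by
  have h1 := R.gaugeOp_of_mem
    (fun v hv hv' => Set.disjoint_left.1 R.disjoint_inner_boundary hv hv') h hψ
  -- Outside edges avoid the interior vertices, so the interior Gauss law acts on the regional
  -- factor alone.
  have h2 : gaugeHom L G R.edgesᶜ (extendOne G R.inner h) = 1 :=
    Prod.ext (funext fun e => extendOne_of_notMem h (R.tgt_notMem e e.2))
      (funext fun e => extendOne_of_notMem h (R.src_notMem e e.2))
  rwa [gaugeOp_apply, h2, lrLin_one] at h1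

/-- A global physical state takes values in the regional physical space. -/
theorem adjoint_tensorLeft_mem (f : Lp ℂ 2 (haarProb ((R.edgesᶜ : Set E) → G)))
    {ψ : R.KinSpace G} (hψ : ψ ∈ R.globalPhysSpace G) :
    (tensorLeft f).adjoint ψ ∈ R.physSpace G := by
  intro h
  rw [← adjoint_tensorLeft_compLpL]
  exact congrArg _ (R.ampliation_inner_of_mem h hψ)

/-- A physical `ψ` is a sum of tensors `e_j ⊗ x_j` whose regional components `x_j` satisfy the
interior Gauss law, so the projection fixes each term. -/
theorem ampliation_extendOp_one {ψ : R.KinSpace G} (hψ : ψ ∈ R.globalPhysSpace G) :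
    R.ampliation G (R.extendOp G 1) ψ = ψ := by
  have h := hasSum_tensorLeft (stdBasis (Lp ℂ 2 (haarProb ((R.edgesᶜ : Set E) → G)))) ψ
  refine (h.mapL (R.ampliation G (R.extendOp G 1))).unique (h.congr_fun fun j => ?_)
  rw [tensorLeft_apply, ampliation, compLpL_tensorFun,
    R.extendOp_one_apply (R.adjoint_tensorLeft_mem _ hψ)]

theorem extendOp_one_commute (k : R.corner → G) (x : LinkSpace G R.edges) :
    (R.cornerRepLinks G).toHom k (R.extendOp G 1 x) =
      R.extendOp G 1 ((R.cornerRepLinks G).toHom k x) := by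
  rw [extendOp_eq]
  change _ = (R.physSpace G).subtypeL ((R.physSpace G).subtypeL.adjoint _)
  rw [projection_cornerRepLinks]
  rfl

theorem twirl_extendOp_commute (f : R.physSpace G →L[ℂ] R.physSpace G) (k : R.corner → G)
    (x : LinkSpace G R.edges) :
    (R.cornerRepLinks G).toHom k (R.extendOp G ((R.cornerRep G).twirl f) x) =
      R.extendOp G ((R.cornerRep G).twirl f) ((R.cornerRepLinks G).toHom k x) := by
  rw [← twirl_extendOp, UnitaryRep.toHom_twirl]

/-- The compression of a regional operator depends only on its corner twirl. -/
theorem compress_ampliation_twirl (a : LinkSpace G R.edges →L[ℂ] LinkSpace G R.edges) :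
    R.compress G (R.ampliation G ((R.cornerRepLinks G).twirl a)) =
      R.compress G (R.ampliation G a) := by
  ext1 ψ
  refine ext_inner_left ℂ fun χ => ?_
  rw [inner_compress, inner_compress]
  -- By the corner Gauss law, undoing `k` on the links of `Σ` equals applying `k` to the outside
  -- links. That action commutes with `a ⊗ 1` and is isometric, so the integrand of the twirl is
  -- constant.
  have hinv (k : R.corner → G) (ψ : R.globalPhysSpace G) :
      ((R.cornerRepLinks G).amplify (haarProb ((R.edgesᶜ : Set E) → G))).toHom k⁻¹ ψ =
        lrLin (gaugeHom L G R.edgesᶜ (extendOne G R.corner k)) (ψ : R.KinSpace G) := by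
    have h1 := R.gaugeOp_of_mem
      (fun v hv hv' => Set.disjoint_left.1 R.disjoint_corner_boundary hv hv') k ψ.2
    conv_lhs => rw [← h1]
    exact UnitaryRep.toHom_inv_apply_apply
      ((R.cornerRepLinks G).amplify (haarProb ((R.edgesᶜ : Set E) → G))) k _
  rw [ampliation, ← UnitaryRep.twirl_amplify, UnitaryRep.inner_twirl]
  simp only [hinv, compLpL_lrLin, LinearIsometry.inner_map_map]
  simp [ampliation]

end Region

/-! ### Relational observables and frame reorientations. -/

namespace ExtrinsicFrame

variable {R} (Φ : ExtrinsicFrame R)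

theorem orientation_reorient (k : R.corner → G) (y : (R.edgesᶜ : Set E) → G) :
    Φ.orientation G (lrMap (Φ.reorientHom G k) y) = 1 * Φ.orientation G y * k := by
  rw [one_mul]
  exact funext fun v => Φ.holonomy_reorient k y v

theorem orientation_gauge (h : (L.boundaryᶜ : Set V) → G) (y : (R.edgesᶜ : Set E) → G) :
    Φ.orientation G (lrMap (gaugeHom L G R.edgesᶜ (extendOne G L.boundaryᶜ h)) y) =
      (fun v : R.corner => extendOne G L.boundaryᶜ h v)⁻¹ * Φ.orientation G y * 1 := by
  rw [mul_one]
  funext v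
  have h1 := holonomy_gauge L (extendOne G L.boundaryᶜ h) y (Φ.isPath v)
  -- Gauge transformations are trivial at the anchor, so only the corner endpoint of the line
  -- contributes.
  rw [extendOne_of_notMem (v := Φ.anchor v) h (by simpa using Φ.anchor_mem v), mul_one] at h1
  exact h1

theorem kinObservable_apply (f : R.physSpace G →L[ℂ] R.physSpace G) (ψ : R.KinSpace G) :
    Φ.kinObservable G f ψ = fiberwise (R.cornerRepLinks G) (Φ.orientation G)
      (R.ampliation G (R.extendOp G f)
        (fiberwise (R.cornerRepLinks G) (Φ.orientation G)⁻¹ ψ)) := rfl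

theorem orientation_mul_inv (y : (R.edgesᶜ : Set E) → G) :
    Φ.orientation G y * (Φ.orientation G)⁻¹ y = 1 := mul_inv_cancel _

theorem orientation_inv_mul (y : (R.edgesᶜ : Set E) → G) :
    (Φ.orientation G)⁻¹ y * Φ.orientation G y = 1 := inv_mul_cancel _

/-- This is `R(k) W = W (U_Σ(k) ⊗ 1) R(k)`, the relation that converts frame reorientations into
corner transformations of the region. -/
theorem lrLin_reorient_fiberwise (k : R.corner → G) (ψ : R.KinSpace G) :
    lrLin (Φ.reorientHom G k) (fiberwise (R.cornerRepLinks G) (Φ.orientation G) ψ) =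
      fiberwise (R.cornerRepLinks G) (Φ.orientation G)
        (R.ampliation G ((R.cornerRepLinks G).op k) (lrLin (Φ.reorientHom G k) ψ)) := by
  rw [lrLin_fiberwise _ _ _ 1 k (Φ.orientation_reorient k),
    show (R.cornerRepLinks G).op 1 = 1 by ext x; simp, compLpL_one]
  rfl

/-- The twirl of a dressed observable over the reorientations, on the kinematical space. -/
theorem twirl_kinObservable (f : R.physSpace G →L[ℂ] R.physSpace G) :
    (Φ.kinReorientRep G).twirl (Φ.kinObservable G f) =
      Φ.kinObservable G ((R.cornerRep G).twirl f) := by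
  have h1 : R.ampliation G (R.extendOp G ((R.cornerRep G).twirl f)) =
      ((R.cornerRepLinks G).amplify (haarProb ((R.edgesᶜ : Set E) → G))).twirl
        (R.ampliation G (R.extendOp G f)) := by
    rw [← R.twirl_extendOp]
    exact (UnitaryRep.twirl_amplify _ _).symm
  unfold kinObservable
  rw [h1]
  refine UnitaryRep.twirl_conj _ _ _ _ _ fun k ψ => ?_
  simp only [LinearIsometry.coe_toContinuousLinearMap]
  -- Writing `ψ = W χ` lets the covariance relation be used on both sides of `f ⊗ 1`; the
  -- reorientations then cancel and conjugation by `U_Σ(k)` remains.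
  obtain ⟨χ, rfl⟩ : ∃ χ, ψ = fiberwise (R.cornerRepLinks G) (Φ.orientation G) χ :=
    ⟨_, (fiberwise_fiberwise_inv _ _ _ Φ.orientation_mul_inv ψ).symm⟩
  change lrLin (Φ.reorientHom G k) (fiberwise (R.cornerRepLinks G) (Φ.orientation G)
    (R.ampliation G (R.extendOp G f) (fiberwise (R.cornerRepLinks G) (Φ.orientation G)⁻¹
      (lrLin (Φ.reorientHom G k⁻¹) (fiberwise (R.cornerRepLinks G) (Φ.orientation G) χ))))) = _
  rw [lrLin_reorient_fiberwise, lrLin_reorient_fiberwise,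
    fiberwise_fiberwise_inv _ _ _ Φ.orientation_inv_mul,
    fiberwise_fiberwise_inv _ _ _ Φ.orientation_inv_mul]
  simp only [Region.ampliation, compLpL_lrLin, ← lrLin_mul, ← map_mul, mul_inv_cancel, map_one,
    lrLin_one]
  rfl

/-- The corner twirl of relational observables. -/
theorem twirl_relObservable (f : R.physSpace G →L[ℂ] R.physSpace G) :
    (Φ.reorientRep G).twirl (Φ.relObservable G f) =
      Φ.relObservable G ((R.cornerRep G).twirl f) := by
  unfold relObservable
  rw [← twirl_kinObservable, Region.compress_eq, Region.compress_eq]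
  -- Reorientations preserve the physical subspace and are unitary, so compression commutes with
  -- conjugation by them.
  refine UnitaryRep.twirl_conj _ _ _ _ _ fun k ψ => ?_
  refine ext_inner_left ℂ fun χ => ?_
  rw [(Φ.reorientRep G).inner_toHom_right, ContinuousLinearMap.adjoint_inner_right,
    ContinuousLinearMap.adjoint_inner_right, (Φ.kinReorientRep G).inner_toHom_right]
  rfl

theorem fiberwise_inv_extendOp_one {ψ : R.KinSpace G} (hψ : ψ ∈ R.globalPhysSpace G) :
    R.ampliation G (R.extendOp G 1) (fiberwise (R.cornerRepLinks G) (Φ.orientation G)⁻¹ ψ) =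
      fiberwise (R.cornerRepLinks G) (Φ.orientation G)⁻¹ ψ := by
  rw [Region.ampliation, ← fiberwise_compLpL _ _ R.extendOp_one_commute]
  exact congrArg _ (R.ampliation_extendOp_one hψ)

theorem relObservable_one : Φ.relObservable G 1 = 1 := by
  ext1 ψ
  refine ext_inner_left ℂ fun χ => ?_
  rw [relObservable, Region.inner_compress, kinObservable_apply,
    Φ.fiberwise_inv_extendOp_one ψ.2, fiberwise_fiberwise_inv _ _ _ Φ.orientation_mul_inv]
  rfl

theorem inner_relObservable (f : R.physSpace G →L[ℂ] R.physSpace G)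
    (χ ψ : R.globalPhysSpace G) :
    ⟪χ, Φ.relObservable G f ψ⟫_ℂ =
      ⟪fiberwise (R.cornerRepLinks G) (Φ.orientation G)⁻¹ (χ : R.KinSpace G),
        R.ampliation G (R.extendOp G f)
          (fiberwise (R.cornerRepLinks G) (Φ.orientation G)⁻¹ (ψ : R.KinSpace G))⟫_ℂ := by
  rw [relObservable, Region.inner_compress, kinObservable_apply,
    inner_fiberwise _ _ _ Φ.orientation_inv_mul]

/-- The dressed state `∫ dh |h⟩ ⊗ U_Σ(h) φ`. -/
theorem fiberwise_const_mem (φ : R.physSpace G) :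
    fiberwise (R.cornerRepLinks G) (Φ.orientation G)
      (Lp.const 2 (haarProb ((R.edgesᶜ : Set E) → G)) (φ : LinkSpace G R.edges)) ∈
        R.globalPhysSpace G := by
  intro h
  set n : R.corner → G := fun v => extendOne G L.boundaryᶜ h v
  set ψ := fiberwise (R.cornerRepLinks G) (Φ.orientation G)
      (Lp.const 2 (haarProb ((R.edgesᶜ : Set E) → G)) (φ : LinkSpace G R.edges)) with hψ
  have h1 : (R.extendOp G 1).compLpL 2 (haarProb ((R.edgesᶜ : Set E) → G)) ψ = ψ := by
    rw [hψ, ← fiberwise_compLpL _ _ R.extendOp_one_commute, compLpL_const,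
      R.extendOp_one_apply φ.2]
  -- On the outside links the gauge transformation shifts the orientation and so acts on the dressed
  -- state as `U_Σ(n)⁻¹`; on the links of `Σ` it acts as `U_Σ(n)`, and the two cancel.
  have h2 : lrLin (gaugeHom L G R.edgesᶜ (extendOne G L.boundaryᶜ h)) ψ =
      ((R.cornerRepLinks G).op n⁻¹).compLpL 2 (haarProb ((R.edgesᶜ : Set E) → G)) ψ := by
    rw [hψ, lrLin_fiberwise _ _ _ n⁻¹ 1 (Φ.orientation_gauge h), lrLin_const, compLpL_const]
    simp
  rw [Region.gaugeOp_apply, h2, Region.ampliation, ← compLpL_comp]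
  conv_lhs => rw [← h1]
  rw [← compLpL_comp]
  conv_rhs => rw [← h1]
  congr 2
  ext1 x
  change (R.gaugeRep G).toHom (extendOne G L.boundaryᶜ h)
    ((R.cornerRepLinks G).toHom n⁻¹ (R.extendOp G 1 x)) = R.extendOp G 1 x
  rw [R.gaugeRep_apply_of_mem]
  · exact UnitaryRep.toHom_apply_inv_apply _ n _
  · exact ((R.cornerRep G).toHom n⁻¹ ⟨_, R.extendOp_one_mem x⟩).2

/-- Relational observables determine the regional observables they describe. -/
theorem relObservable_injective : Function.Injective (Φ.relObservable G) := by
  intro f f' hff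
  ext1 φ
  refine ext_inner_left ℂ fun φ' => ?_
  -- Undressing by `W†` turns the dressed states into constant functions, whose inner product is the
  -- regional one since Haar measure has mass one.
  have key (f : R.physSpace G →L[ℂ] R.physSpace G) :
      ⟪(⟨_, Φ.fiberwise_const_mem φ'⟩ : R.globalPhysSpace G),
        Φ.relObservable G f ⟨_, Φ.fiberwise_const_mem φ⟩⟫_ℂ = ⟪φ', f φ⟫_ℂ := by
    rw [inner_relObservable]
    change ⟪fiberwise (R.cornerRepLinks G) (Φ.orientation G)⁻¹ (fiberwise _ (Φ.orientation G) _),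
      R.ampliation G (R.extendOp G f) (fiberwise (R.cornerRepLinks G) (Φ.orientation G)⁻¹
        (fiberwise _ (Φ.orientation G) _))⟫_ℂ = _
    rw [fiberwise_fiberwise_inv _ _ _ Φ.orientation_inv_mul,
      fiberwise_fiberwise_inv _ _ _ Φ.orientation_inv_mul]
    rw [Region.ampliation, compLpL_const, inner_const, R.extendOp_eq]
    simp only [ContinuousLinearMap.comp_apply]
    rw [Submodule.adjoint_subtypeL, Submodule.orthogonalProjectionOnto_mem_subspace_eq_self]
    rfl
  rw [← key f, ← key f', hff]

/-- The compression of a regional operator is a relational observable. -/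
theorem compress_ampliation (a : LinkSpace G R.edges →L[ℂ] LinkSpace G R.edges) :
    R.compress G (R.ampliation G a) = Φ.relObservable G ((R.cornerRep G).twirl
      ((R.physSpace G).subtypeL.adjoint ∘L a ∘L (R.physSpace G).subtypeL)) := by
  set f := (R.physSpace G).subtypeL.adjoint ∘L a ∘L (R.physSpace G).subtypeL with hf
  -- A twirled operator commutes with `U_Σ`, so `W` and `W†` cancel around it.
  have h1 : Φ.kinObservable G ((R.cornerRep G).twirl f) =
      R.ampliation G (R.extendOp G ((R.cornerRep G).twirl f)) := by
    ext1 ψ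
    rw [kinObservable_apply, Region.ampliation,
      fiberwise_compLpL _ _ (R.twirl_extendOp_commute f),
      fiberwise_fiberwise_inv _ _ _ Φ.orientation_mul_inv]
  -- `f` is the compression of `a`; the two projections are moved onto the physical states, which
  -- they fix.
  have h2 : R.extendOp G f = R.extendOp G 1 ∘L a ∘L R.extendOp G 1 := by
    rw [hf, R.extendOp_eq, R.extendOp_eq]
    rfl
  have h3 : (R.extendOp G 1).adjoint = R.extendOp G 1 := by
    rw [R.extendOp_eq, ContinuousLinearMap.adjoint_comp, ContinuousLinearMap.adjoint_comp,
      ContinuousLinearMap.adjoint_adjoint,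
      show ContinuousLinearMap.adjoint (1 : R.physSpace G →L[ℂ] R.physSpace G) = 1 from
        star_one (R.physSpace G →L[ℂ] R.physSpace G)]
    rfl
  rw [relObservable, h1, ← R.twirl_extendOp, R.compress_ampliation_twirl, h2]
  ext1 ψ
  refine ext_inner_left ℂ fun χ => ?_
  rw [Region.inner_compress, Region.inner_compress, Region.ampliation, Region.ampliation,
    compLpL_comp, compLpL_comp]
  conv_rhs => rw [← h3, ← inner_compLpL]
  exact congrArg₂ (fun x y => ⟪x, R.ampliation G a y⟫_ℂ) (R.ampliation_extendOp_one χ.2).symm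
    ((R.ampliation_extendOp_one ψ.2).symm.trans (by rw [h3]; rfl))

end ExtrinsicFrame

end Gauge

/-! ### States on the relational algebra, the electric center and the extended Hilbert space -/

theorem UnitaryRep.twirl_twirl {N : Type*} [Group N] [TopologicalSpace N]
    [IsTopologicalGroup N] [CompactSpace N] [MeasurableSpace N] [BorelSpace N]
    {H : Type*} [NormedAddCommGroup H] [InnerProductSpace ℂ H] [CompleteSpace H]
    (U : UnitaryRep N H) (a : H →L[ℂ] H) : U.twirl (U.twirl a) = U.twirl a :=
  U.twirl_eq_self (U.toHom_twirl a)

section Isometry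

variable {H : Type*} [NormedAddCommGroup H] [InnerProductSpace ℂ H] [CompleteSpace H]
  {H' : Type*} [NormedAddCommGroup H'] [InnerProductSpace ℂ H'] [CompleteSpace H']

theorem IsDensityOperator.conj_isometry {δ : H →L[ℂ] H} (hδ : IsDensityOperator δ)
    {J : H →L[ℂ] H'} (hJ : ∀ x, ‖J x‖ = ‖x‖) : IsDensityOperator (J ∘L δ ∘L J.adjoint) := by
  obtain ⟨v, hv, hv1⟩ := hδ.exists_isEnsemble
  refine (hv.conj J).isDensityOperator ?_
  simpa only [Function.comp_apply, hJ] using hv1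

theorem IsDensityOperator.trace_conj {δ : H →L[ℂ] H} (hδ : IsDensityOperator δ)
    (J : H →L[ℂ] H') (a : H' →L[ℂ] H') :
    trace ((J ∘L δ ∘L J.adjoint) ∘L a) = trace (δ ∘L (J.adjoint ∘L a ∘L J)) := by
  obtain ⟨v, hv, -⟩ := hδ.exists_isEnsemble
  refine ((hv.conj J).hasSum_trace a).unique ?_
  refine (hv.hasSum_trace (J.adjoint ∘L a ∘L J)).congr_fun fun n => ?_
  simp only [ContinuousLinearMap.comp_apply, ContinuousLinearMap.adjoint_inner_right]

end Isometry

section Gauge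

variable {V E : Type*} [Finite V] [Finite E] {L : Lattice V E} {R : Region L}
  {G : Type*} [Group G] [TopologicalSpace G] [IsTopologicalGroup G] [CompactSpace G]
  [T2Space G] [SecondCountableTopology G] [MeasurableSpace G] [BorelSpace G]
  {ρ : R.globalPhysSpace G →L[ℂ] R.globalPhysSpace G}

theorem Region.compress_ampliation_one : R.compress G (R.ampliation G 1) = 1 := by
  ext1 ψ
  refine ext_inner_left ℂ fun χ => ?_
  rw [Region.inner_compress, Region.ampliation, compLpL_one]
  rfl

/-- Contractions with a basis of outside functions are the Kraus operators of the partial trace. -/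
theorem Region.exists_isExtendedReducedState (hρ : IsDensityOperator ρ) :
    ∃ τ, R.IsExtendedReducedState ρ τ := by
  obtain ⟨τ, h1, h2⟩ := hρ.exists_pullback
    (fun j => (tensorLeft (stdBasis (Lp ℂ 2 (haarProb ((R.edgesᶜ : Set E) → G))) j)).adjoint ∘L
      (R.globalPhysSpace G).subtypeL)
    (fun a => R.compress G (R.ampliation G a))
    (fun a ψ => by
      rw [Region.inner_compress]
      exact hasSum_inner_compLpL _ a _ _)
    Region.compress_ampliation_one
  exact ⟨τ, h1, h2⟩

theorem Region.inner_extendOp (f : R.physSpace G →L[ℂ] R.physSpace G) (x y : LinkSpace G R.edges) :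
    ⟪x, R.extendOp G f y⟫_ℂ =
      ⟪(R.physSpace G).subtypeL.adjoint x, f ((R.physSpace G).subtypeL.adjoint y)⟫_ℂ := by
  rw [R.extendOp_eq, ContinuousLinearMap.comp_apply, ← ContinuousLinearMap.adjoint_inner_left]
  rfl

theorem Region.extendOp_isDensityOperator {δ : R.physSpace G →L[ℂ] R.physSpace G}
    (hδ : IsDensityOperator δ) : IsDensityOperator (R.extendOp G δ) := by
  rw [R.extendOp_eq]
  exact hδ.conj_isometry fun _ => rfl

theorem Region.vonNeumannEntropy_extendOp {δ : R.physSpace G →L[ℂ] R.physSpace G}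
    (hδ : IsDensityOperator δ) : vonNeumannEntropy (R.extendOp G δ) = vonNeumannEntropy δ := by
  rw [R.extendOp_eq]
  refine vonNeumannEntropy_conj_isometry hδ ?_
  rw [Submodule.adjoint_subtypeL]
  ext1 x
  exact Submodule.orthogonalProjectionOnto_mem_subspace_eq_self x

namespace ExtrinsicFrame

variable (Φ : ExtrinsicFrame R)

/-- The Kraus operators `ψ ↦ ⟨e| W_Φ† ψ⟩` of the reduction to the frame perspective, with `W_Φ`
the frame-controlled corner transformation. -/
def kraus (e : Lp ℂ 2 (haarProb ((R.edgesᶜ : Set E) → G))) :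
    R.globalPhysSpace G →L[ℂ] R.physSpace G :=
  (R.physSpace G).subtypeL.adjoint ∘L (tensorLeft e).adjoint ∘L
    (fiberwise (R.cornerRepLinks G) (Φ.orientation G)⁻¹).toContinuousLinearMap ∘L
      (R.globalPhysSpace G).subtypeL

theorem hasSum_inner_relObservable {ι : Type*}
    (e : HilbertBasis ι ℂ (Lp ℂ 2 (haarProb ((R.edgesᶜ : Set E) → G))))
    (f : R.physSpace G →L[ℂ] R.physSpace G) (χ ψ : R.globalPhysSpace G) :
    HasSum (fun j => ⟪Φ.kraus (e j) χ, f (Φ.kraus (e j) ψ)⟫_ℂ) ⟪χ, Φ.relObservable G f ψ⟫_ℂ := by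
  have h := hasSum_inner_compLpL e (R.extendOp G f)
    (fiberwise (R.cornerRepLinks G) (Φ.orientation G)⁻¹ (χ : R.KinSpace G))
    (fiberwise (R.cornerRepLinks G) (Φ.orientation G)⁻¹ (ψ : R.KinSpace G))
  simp only [Region.inner_extendOp] at h
  rw [inner_relObservable]
  exact h

theorem exists_isRelationalState (hρ : IsDensityOperator ρ) : ∃ σ, Φ.IsRelationalState ρ σ :=
  (hρ.exists_pullback
    (fun j => Φ.kraus (stdBasis (Lp ℂ 2 (haarProb ((R.edgesᶜ : Set E) → G))) j))
    (Φ.relObservable G) (fun f ψ => Φ.hasSum_inner_relObservable _ f ψ ψ) Φ.relObservable_one).imp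
      fun _ h => h

theorem mem_electricCenterAlgebra_iff {a : R.globalPhysSpace G →L[ℂ] R.globalPhysSpace G} :
    a ∈ Φ.electricCenterAlgebra G ↔ ∃ f, a = Φ.relObservable G ((R.cornerRep G).twirl f) :=
  exists_congr fun f => by rw [Φ.twirl_relObservable]

/-- Injectivity of `f ↦ O_f` turns membership in `A_E` into a condition on `f` alone. -/
theorem relObservable_mem_electricCenterAlgebra_iff {f : R.physSpace G →L[ℂ] R.physSpace G} :
    Φ.relObservable G f ∈ Φ.electricCenterAlgebra G ↔ (R.cornerRep G).twirl f = f := by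
  rw [mem_electricCenterAlgebra_iff]
  constructor
  · rintro ⟨f', hf'⟩
    rw [Φ.relObservable_injective hf', UnitaryRep.twirl_twirl]
  · intro h
    exact ⟨f, by rw [h]⟩

theorem mem_electricCenterAlgebra_iff_isBlockSum {K : Dual (R.corner → G) → Type*}
    [∀ r, NormedAddCommGroup (K r)] [∀ r, InnerProductSpace ℂ (K r)] [∀ r, CompleteSpace (K r)]
    (D : IsotypicDecomposition (R.cornerRep G) K)
    (a : R.globalPhysSpace G →L[ℂ] R.globalPhysSpace G) :
    a ∈ Φ.electricCenterAlgebra G ↔ ∃ f b, D.IsBlockSum f b ∧ a = Φ.relObservable G f := by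
  rw [mem_electricCenterAlgebra_iff]
  constructor
  · rintro ⟨f, rfl⟩
    exact ⟨_, _, D.isBlockSum_twirl f, rfl⟩
  · rintro ⟨f, b, h, rfl⟩
    exact ⟨f, by rw [h.twirl_eq]⟩

variable {Φ}

/-- Observables of `A_E` come from twirl-invariant `f`, and self-duality of the twirl moves it from
`f` to `σ`. -/
theorem IsRelationalState.twirl {σ : R.physSpace G →L[ℂ] R.physSpace G} (h : Φ.IsRelationalState ρ σ) :
    Φ.IsElectricCenterState ρ ((R.cornerRep G).twirl σ) := by
  refine ⟨UnitaryRep.isDensityOperator_twirl _ h.1,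
    Φ.relObservable_mem_electricCenterAlgebra_iff.2 (UnitaryRep.twirl_twirl _ _), fun f hf => ?_⟩
  rw [h.2, ← UnitaryRep.trace_comp_twirl _ h.1,
    Φ.relObservable_mem_electricCenterAlgebra_iff.1 hf]

/-- Since `δ` is itself twirl-invariant, its pairing with arbitrary `f` is fixed by `ρ`, although
only `A_E` was tested. Uniqueness follows. -/
theorem IsElectricCenterState.trace_twirl {δ : R.physSpace G →L[ℂ] R.physSpace G}
    (h : Φ.IsElectricCenterState ρ δ) (f : R.physSpace G →L[ℂ] R.physSpace G) :
    trace (ρ ∘L Φ.relObservable G ((R.cornerRep G).twirl f)) = trace (δ ∘L f) := by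
  rw [h.2.2 _ (Φ.relObservable_mem_electricCenterAlgebra_iff.2 (UnitaryRep.twirl_twirl _ _)),
    UnitaryRep.trace_comp_twirl _ h.1, Φ.relObservable_mem_electricCenterAlgebra_iff.1 h.2.1]

theorem IsElectricCenterState.unique {δ δ' : R.physSpace G →L[ℂ] R.physSpace G}
    (h : Φ.IsElectricCenterState ρ δ) (h' : Φ.IsElectricCenterState ρ δ') : δ = δ' :=
  h.1.ext h'.1 fun f => by rw [← h.trace_twirl, ← h'.trace_twirl]

/-- By `compress_ampliation`, measuring `a ⊗ 1` on physical states is measuring a relational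
observable of `A_E`, so `τ` carries the same data as `δ`. -/
theorem IsElectricCenterState.eq_extendOp {δ : R.physSpace G →L[ℂ] R.physSpace G}
    (h : Φ.IsElectricCenterState ρ δ) {τ : LinkSpace G R.edges →L[ℂ] LinkSpace G R.edges}
    (hτ : R.IsExtendedReducedState ρ τ) : τ = R.extendOp G δ :=
  hτ.1.ext (Region.extendOp_isDensityOperator h.1) fun a => by
    rw [← hτ.2, Φ.compress_ampliation, h.trace_twirl, R.extendOp_eq, h.1.trace_conj]

end ExtrinsicFrame

end Gauge

end LGT

end

/-! ### The main theorem. -/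

theorem mainTheorem6 :
    -- the twirl over a compact group `Γ` and its superselection sectors
    (∀ (Γ : Type*) [Group Γ] [TopologicalSpace Γ] [IsTopologicalGroup Γ] [CompactSpace Γ]
        [T2Space Γ] [MeasurableSpace Γ] [BorelSpace Γ]
        (H : Type*) [NormedAddCommGroup H] [InnerProductSpace ℂ H] [CompleteSpace H]
        (U : LGT.UnitaryRep Γ H),
      -- `H ≅ ⨁_[r] H_r ⊗ K_r` with `U = ⨁_[r] U_r ⊗ 1`
      (∃ K : LGT.Dual Γ → Submodule ℂ H, (∀ r, IsClosed (K r : Set H)) ∧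
        Nonempty (LGT.IsotypicDecomposition U fun r => K r)) ∧
      ∀ (K : LGT.Dual Γ → Type*) [∀ r, NormedAddCommGroup (K r)]
        [∀ r, InnerProductSpace ℂ (K r)] [∀ r, CompleteSpace (K r)]
        (D : LGT.IsotypicDecomposition U K),
        -- `𝔊(a) = ⨁_[r] (1_r / d_r) ⊗ Tr_{H_r}(a|_r)`
        (∀ a : H →L[ℂ] H,
          D.IsBlockSum (U.twirl a) fun r => (r.dim : ℂ)⁻¹ • D.mult a r) ∧
        -- `𝔊(B(H)) = ⨁_[r] 1_r ⊗ B(K_r)`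
        (∀ a : H →L[ℂ] H, a ∈ Set.range U.twirl ↔ ∃ b, D.IsBlockSum a b) ∧
        -- the center of `𝔊(B(H))` consists of the operators that are scalar on every sector
        (∀ z : H →L[ℂ] H,
          (z ∈ Set.range U.twirl ∧ ∀ a ∈ Set.range U.twirl, z ∘L a = a ∘L z) ↔
            ∃ c : LGT.Dual Γ → ℂ, ∀ r i, z ∘L D.inc r i = c r • D.inc r i) ∧
        -- twirled states and their entropy
        (∀ ρ : H →L[ℂ] H, LGT.IsDensityOperator ρ →
          LGT.IsDensityOperator (U.twirl ρ) ∧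
          ∑' r, D.prob ρ r = 1 ∧
          (∀ r, D.prob ρ r ≠ 0 → LGT.IsDensityOperator (D.sectorState ρ r)) ∧
          D.IsBlockSum (U.twirl ρ)
            (fun r => (((D.prob ρ r).toReal / r.dim : ℝ) : ℂ) • D.sectorState ρ r) ∧
          LGT.vonNeumannEntropy (U.twirl ρ) =
            LGT.shannonEntropy (D.prob ρ) +
              ∑' r, D.prob ρ r *
                (ENNReal.ofReal (Real.log r.dim) + LGT.vonNeumannEntropy (D.sectorState ρ r)))) ∧
    -- the electric center algebra of a region in lattice gauge theory with structure group `G`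
    (∀ (G : Type*) [Group G] [TopologicalSpace G] [IsTopologicalGroup G] [CompactSpace G]
        [T2Space G] [SecondCountableTopology G] [MeasurableSpace G] [BorelSpace G]
        (V E : Type*) [Finite V] [Finite E] (L : LGT.Lattice V E) (R : LGT.Region L)
        (Φ : LGT.ExtrinsicFrame R),
      -- the corner twirl of relational observables, and the resulting form of `A_E`
      (∀ f, (Φ.reorientRep G).twirl (Φ.relObservable G f) =
        Φ.relObservable G ((R.cornerRep G).twirl f)) ∧
      (∀ (K : LGT.Dual (R.corner → G) → Type*) [∀ r, NormedAddCommGroup (K r)]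
        [∀ r, InnerProductSpace ℂ (K r)] [∀ r, CompleteSpace (K r)]
        (D : LGT.IsotypicDecomposition (R.cornerRep G) K) (a),
        a ∈ Φ.electricCenterAlgebra G ↔ ∃ f b, D.IsBlockSum f b ∧ a = Φ.relObservable G f) ∧
      -- the states induced by a global physical state `ρ`
      ∀ ρ, LGT.IsDensityOperator ρ →
        (∃ σ, Φ.IsRelationalState ρ σ) ∧ (∃ δ, Φ.IsElectricCenterState ρ δ) ∧
        (∃ τ, R.IsExtendedReducedState ρ τ) ∧
        ∀ σ δ τ, Φ.IsRelationalState ρ σ → Φ.IsElectricCenterState ρ δ →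
          R.IsExtendedReducedState ρ τ →
          δ = (R.cornerRep G).twirl σ ∧ τ = R.extendOp G δ ∧
          ∀ (K : LGT.Dual (R.corner → G) → Type*) [∀ r, NormedAddCommGroup (K r)]
            [∀ r, InnerProductSpace ℂ (K r)] [∀ r, CompleteSpace (K r)]
            (D : LGT.IsotypicDecomposition (R.cornerRep G) K),
            D.IsBlockSum δ
              (fun r => (((D.prob δ r).toReal / r.dim : ℝ) : ℂ) • D.sectorState δ r) ∧
            LGT.vonNeumannEntropy δ =
              LGT.shannonEntropy (D.prob δ) +
                ∑' r, D.prob δ r *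
                  (ENNReal.ofReal (Real.log r.dim) + LGT.vonNeumannEntropy (D.sectorState δ r)) ∧
            LGT.vonNeumannEntropy τ = LGT.vonNeumannEntropy δ) := by
  refine ⟨?_, ?_⟩
  · intro Γ _ _ _ _ _ _ _ H _ _ _ U
    refine ⟨⟨U.multSpace, U.isClosed_multSpace, ⟨U.isotypicDecomposition⟩⟩, ?_⟩
    intro K _ _ _ D
    exact ⟨D.isBlockSum_twirl, D.mem_range_twirl_iff, D.mem_center_iff, fun ρ hρ =>
      ⟨U.isDensityOperator_twirl hρ, D.tsum_prob hρ, D.isDensityOperator_sectorState hρ,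
        D.isBlockSum_twirl_density hρ, D.vonNeumannEntropy_twirl hρ⟩⟩
  · intro G _ _ _ _ _ _ _ _ V E _ _ L R Φ
    refine ⟨Φ.twirl_relObservable, ?_, fun ρ hρ => ?_⟩
    · intro K _ _ _ D a
      exact Φ.mem_electricCenterAlgebra_iff_isBlockSum D a
    · obtain ⟨σ₀, hσ₀⟩ := Φ.exists_isRelationalState hρ
      refine ⟨⟨σ₀, hσ₀⟩, ⟨_, hσ₀.twirl⟩, LGT.Region.exists_isExtendedReducedState hρ, ?_⟩
      intro σ δ τ hσ hδ hτ
      refine ⟨hδ.unique (hσ.twirl), hδ.eq_extendOp hτ, ?_⟩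
      intro K _ _ _ D
      -- Twirl invariance of `δ` lets the block form and entropy formula for twirled states apply to
      -- `δ` itself.
      have htw : (R.cornerRep G).twirl δ = δ :=
        Φ.relObservable_mem_electricCenterAlgebra_iff.1 hδ.2.1
      have hblock := D.isBlockSum_twirl_density hδ.1
      have hentropy := D.vonNeumannEntropy_twirl hδ.1
      rw [htw] at hblock hentropy
      refine ⟨hblock, hentropy, ?_⟩
      rw [hδ.eq_extendOp hτ, LGT.Region.vonNeumannEntropy_extendOp hδ.1]
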